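/- **Setting.** Write $\langle y\rangle=(1+|y|^2)^{1/2}$, $\langle y,z\rangle=(1+|y|^2+|z|^2)^{1/2}$, $|y,z|=(|y|^2+|z|^2)^{1/2}$. Let $n,L,M,L',M'\in\mathbb N_0$ and $d\in\mathbb R$. *Function spaces.* $H^s(\mathbb R)$ is the $L^2$-Sobolev space of order $s\in\mathbb R$; $H^{s}_0(\overline{\mathbb R}_+)$ is the subspace of distributions supported in $[0,\infty)$; $H^s(\mathbb R_+)$ is the space of restrictions to $\mathbb R_+=(0,\infty)$ of elements of $H^s(\mathbb R)$, with the quotient norm. With the isomorphism $\theta:\mathscr D'(\mathbb R_+)\to\mathscr D'(\mathbb R)$, $\langle\theta u,\varphi\rangle=\langle u,\varphi(-\ln t)/t\rangle$, and a cut-off function $\omega$ (smooth on $[0,\infty)$ with bounded support, $\omega=1$ near $0$), $\mathcal K^{s,\gamma}(\mathbb R_+)$ consists of all $u\in\mathscr D'(\mathbb R_+)$ with $\theta(t^{1/2-\gamma}\omega u)\in H^s(\mathbb R)$ and $(1-\omega)u\in H^s(\mathbb R_+)$, normed by the sum of the two norms. Put $H^{s,\delta}_0(\overline{\mathbb R}_+)=\langle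 t\rangle^{-\delta}H^s_0(\overline{\mathbb R}_+)$, $H^{s,\delta}(\mathbb R_+)=\langle t\rangle^{-\delta}H^s(\mathbb R_+)$, $\mathcal K^{s,\gamma}(\mathbb R_+)^\delta=\langle t\rangle^{-\delta}\mathcal K^{s,\gamma}(\mathbb R_+)$. On spaces $\mathcal E(\mathbb C^N)\oplus\mathbb C^{K}$, with $\mathcal E$ one of these spaces, let $\kappa_\lambda(u\oplus z)=(\kappa_\lambda u)\oplus z$, where $(\kappa_\lambda u)(t)=\lambda^{1/2}u(\lambda t)$, $\lambda>0$. *Strongly parameter-dependent symbols.* Let $E_0,E_1$ be two such spaces. $S^d_{1,0}(E_0,E_1)$ is the space of smooth $a:\mathbb R^n_x\times\mathbb R^n_\xi\times[0,\infty)_\mu\to\mathscr L(E_0,E_1)$ such that, for all $\alpha,\beta,j$, uniformly in $(x,\xi,\mu)$, $$\|\kappa^{-1}_{\langle\xi,\mu\rangle}\{D^\alpha_\xi D^\beta_xD^j_\mu a\}\kappa_{\langle\xi,\mu\rangle}\|\le C_{\alpha\beta j}\langle\xi,\mu\rangle^{d-|\alpha|-j}.$$ $S^{(d)}(E_0,E_1)$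 is the space of smooth $a$ defined for $\mu\ge0$, $(\xi,\mu)\ne0$, that are $\kappa$-homogeneous, $a(x,\lambda\xi;\lambda\mu)=\lambda^d\kappa_\lambda a(x,\xi;\mu)\kappa_\lambda^{-1}$ for $\lambda>0$, and satisfy the same estimates with $|\xi,\mu|$ in place of $\langle\xi,\mu\rangle$. $S^d(E_0,E_1)$ (classical symbols) is the space of $a\in S^d_{1,0}(E_0,E_1)$ for which there are $a_j\in S^{(d-j)}(E_0,E_1)$, $j\in\mathbb N_0$, with $a-\sum_{j<N}\chi(\xi,\mu)a_j\in S^{d-N}_{1,0}(E_0,E_1)$ for all $N$; here $\chi$ is a $0$-excision function (smooth, $0$ near the origin and $1$ near infinity), whose choice is irrelevant. *Weakly parameter-dependent symbols.* For $\nu\in\mathbb R$, $\widetilde S^{d,\nu}_{1,0}(E_0,E_1)_{\boldsymbol\kappa,\boldsymbol\kappa}$ is defined as $S^d_{1,0}(E_0,E_1)$, but with the right-hand side $C_{\alpha\beta j}\langle\xi\rangle^{\nu-|\alpha|}\langle\xi,\mu\rangle^{d-\nu-j}$. Replacing the first subscript $\boldsymbol\kappa$ by $\kappa$ means replacing the factor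 $\kappa_{\langle\xi,\mu\rangle}$ on the right of $\{\cdot\}$ by $\kappa_{\langle\xi\rangle}$; replacing the second one means replacing the factor $\kappa^{-1}_{\langle\xi,\mu\rangle}$ on the left by $\kappa^{-1}_{\langle\xi\rangle}$. The spaces $\widetilde S^{(d,\nu)}(E_0,E_1)$ consist of the smooth functions defined for $\mu\ge0$, $\xi\neq0$ that are $\kappa$-homogeneous of degree $d$ and satisfy the same estimates with $|\xi|$, $|\xi,\mu|$ in place of $\langle\xi\rangle$, $\langle\xi,\mu\rangle$; the classical spaces $\widetilde S^{d,\nu}(E_0,E_1)$ are defined by expansions $a-\sum_{j<N}\chi(\xi)a_j\in\widetilde S^{d-N,\nu-N}_{1,0}$ with $a_j\in\widetilde S^{(d-j,\nu-j)}$ (same subscripts). *Green symbols.* Operators on different spaces are identified if they agree on $C_c^\infty(\mathbb R_+,\mathbb C^L)\oplus\mathbb C^M$, which is dense in all source spaces. Let $$\mathcal B^{d;0}_G=\bigcap_{s,s',\delta,\delta'\in\mathbb R}S^d\big(H^{s,\delta}_0(\overline{\mathbb R}_+,\mathbb C^L)\oplus\mathbb C^M,\;H^{s',\delta'}(\mathbb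 R_+,\mathbb C^{L'})\oplus\mathbb C^{M'}\big),$$ and let $\widetilde{\mathcal B}^{d,\nu;0}_G$ be the space of symbols that for all $s,s',\delta,\delta'\in\mathbb R$ belong to each of $$\begin{aligned}&\widetilde S^{d,\nu}\big(H^{s}_0(\overline{\mathbb R}_+,\mathbb C^L)\oplus\mathbb C^M,\,H^{s'}(\mathbb R_+,\mathbb C^{L'})\oplus\mathbb C^{M'}\big)_{\boldsymbol\kappa,\boldsymbol\kappa},\\ &\widetilde S^{d,\nu}\big(H^{s}_0(\overline{\mathbb R}_+,\mathbb C^L)\oplus\mathbb C^M,\,\mathcal K^{s',0}(\mathbb R_+,\mathbb C^{L'})^{\delta'}\oplus\mathbb C^{M'}\big)_{\boldsymbol\kappa,\kappa},\\ &\widetilde S^{d,\nu}\big(\mathcal K^{s,0}(\mathbb R_+,\mathbb C^L)^\delta\oplus\mathbb C^M,\,H^{s'}(\mathbb R_+,\mathbb C^{L'})\oplus\mathbb C^{M'}\big)_{\kappa,\boldsymbol\kappa},\\ &\widetilde S^{d,\nu}\big(\mathcal K^{s,0}(\mathbb R_+,\mathbb C^L)^\delta\oplus\mathbb C^M,\,\mathcal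 K^{s',0}(\mathbb R_+,\mathbb C^{L'})^{\delta'}\oplus\mathbb C^{M'}\big)_{\kappa,\kappa}.\end{aligned}$$ The spaces $\mathcal B^{(d);0}_G$ and $\widetilde{\mathcal B}^{(d,\nu);0}_G$ of $\kappa$-homogeneous symbols are defined in the same way with $S^{(d)}$ and $\widetilde S^{(d,\nu)}$. Finally, $\mathcal B^{d,\nu;0}_G=\mathcal B^{d;0}_G+\widetilde{\mathcal B}^{d,\nu;0}_G$ (non-direct sum). **Proposition.** 1. $\mathcal B^{d;0}_G\subset\widetilde{\mathcal B}^{d,0;0}_G$. 2. $\mathcal B^{(d);0}_G\subset\widetilde{\mathcal B}^{(d,0);0}_G$, in the sense that the restriction to $\{\xi\ne0\}$ of every element of $\mathcal B^{(d);0}_G$ belongs to $\widetilde{\mathcal B}^{(d,0);0}_G$. 3. $\mathcal B^{d,\nu;0}_G=\widetilde{\mathcal B}^{d,\nu;0}_G$ for every $\nu\le0$. -/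

import Mathlib

open scoped SchwartzMap Distributions ContDiff
open MeasureTheory

noncomputable section

namespace GreenSymbols

/-! ### Test functions and distributions on the half-line -/

/-- The open half-line `ℝ₊ = (0, ∞)`. -/
def halfLine : TopologicalSpace.Opens ℝ := ⟨Set.Ioi 0, isOpen_Ioi⟩

/-- `C_c^∞(ℝ₊)`. -/
abbrev Test : Type := 𝓓(halfLine, ℂ)

/-- `C_c^∞(ℝ)`. -/
abbrev TestR : Type := 𝓓((⊤ : TopologicalSpace.Opens ℝ), ℂ)

/-- Linear functionals on `C_c^∞(ℝ₊)`: the vector space in which all spaces of distributions on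
`ℝ₊` live. Continuity is not imposed here, because the members of each of the function spaces below
are automatically distributions. -/
abbrev Dist : Type := Test →ₗ[ℂ] ℂ

/-- A test function on an open subset of the line, as a Schwartz function. -/
def toSchwartz {Ω : TopologicalSpace.Opens ℝ} : 𝓓(Ω, ℂ) →ₗ[ℂ] 𝓢(ℝ, ℂ) where
  toFun φ := φ.hasCompactSupport.toSchwartzMap φ.contDiff
  map_add' φ ψ := by ext t; simp
  map_smul' c φ := by ext t; simp

/-- A function that is smooth on `Ω` and vanishes off a compact subset of `Ω` is a test function. -/
def mkTest {Ω : TopologicalSpace.Opens ℝ} (f : ℝ → ℂ) (hf : ContDiffOn ℝ ∞ f Ω)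
    (hK : ∃ K : Set ℝ, IsCompact K ∧ K ⊆ Ω ∧ ∀ t, t ∉ K → f t = 0) : 𝓓(Ω, ℂ) where
  toFun := f
  contDiff' := by
    obtain ⟨K, hKc, hKΩ, hK0⟩ := hK
    rw [contDiff_iff_contDiffAt]
    intro t
    by_cases ht : t ∈ K
    · exact hf.contDiffAt (Ω.isOpen.mem_nhds (hKΩ ht))
    · have : f =ᶠ[nhds t] fun _ => (0 : ℂ) := by
        filter_upwards [hKc.isClosed.isOpen_compl.mem_nhds ht] with r hr using hK0 r hr
      exact contDiffAt_const.congr_of_eventuallyEq this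
  hasCompactSupport' := by
    obtain ⟨K, hKc, -, hK0⟩ := hK
    exact HasCompactSupport.intro hKc hK0
  tsupport_subset' := by
    obtain ⟨K, hKc, hKΩ, hK0⟩ := hK
    refine (closure_minimal (fun t ht => ?_) hKc.isClosed).trans hKΩ
    by_contra h
    exact ht (hK0 t h)

theorem test_zero {Ω : TopologicalSpace.Opens ℝ} (φ : 𝓓(Ω, ℂ)) {t : ℝ} (ht : t ∉ tsupport φ) :
    φ t = 0 := image_eq_zero_of_notMem_tsupport ht

/-- Multiplication `φ ↦ m φ` of test functions on `ℝ₊` by a function that is smooth on `ℝ₊`. -/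
def mulTest (m : ℝ → ℝ) (hm : ContDiffOn ℝ ∞ m (Set.Ioi 0)) : Test →ₗ[ℂ] Test where
  toFun φ := mkTest (fun t => (m t : ℂ) * φ t)
    ((Complex.ofRealCLM.contDiff.comp_contDiffOn hm).mul φ.contDiff.contDiffOn)
    ⟨tsupport φ, φ.hasCompactSupport, φ.tsupport_subset, fun t ht => by simp [test_zero φ ht]⟩
  map_add' φ ψ := by ext t; simp [mkTest, mul_add]
  map_smul' c φ := by ext t; simp [mkTest]; ring

/-- The standard group action `(κ_r φ)(t) = r^{1/2} φ(r t)` on `C_c^∞(ℝ₊)`. -/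
def dilTest (r : ℝ) (hr : 0 < r) : Test →ₗ[ℂ] Test where
  toFun φ := mkTest (fun t => ((r ^ (1 / 2 : ℝ) : ℝ) : ℂ) * φ (r * t))
    (contDiff_const.mul (φ.contDiff.comp (contDiff_const.mul contDiff_id))).contDiffOn
    ⟨(fun t => r⁻¹ * t) '' tsupport φ, φ.hasCompactSupport.isCompact.image (by fun_prop), by
      rintro _ ⟨t, ht, rfl⟩
      exact mul_pos (inv_pos.2 hr) (φ.tsupport_subset ht), fun t ht => by
      rw [test_zero φ (t := r * t), mul_zero]
      exact fun h => ht ⟨r * t, h, by field_simp⟩⟩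
  map_add' φ ψ := by ext t; simp [mkTest, mul_add]
  map_smul' c φ := by ext t; simp [mkTest]; ring

/-- The standard group action `(κ_r φ)(t) = r^{1/2} φ(r t)` on `𝓢(ℝ)`. -/
def dilSchwartz (r : ℝ) (hr : 0 < r) : 𝓢(ℝ, ℂ) →L[ℂ] 𝓢(ℝ, ℂ) :=
  ((r ^ (1 / 2 : ℝ) : ℝ) : ℂ) • SchwartzMap.compCLMOfContinuousLinearEquiv ℂ
    (ContinuousLinearEquiv.smulLeft (M₁ := ℝ) (R₁ := ℝ) (Units.mk0 r hr.ne'))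

/-- The substitution `φ ↦ (t ↦ φ(-ln t)/t)`, mapping `C_c^∞(ℝ)` to `C_c^∞(ℝ₊)`. Its transpose is
the isomorphism `θ` of distributions on `ℝ₊` with distributions on `ℝ`. -/
def thetaTest : TestR →ₗ[ℂ] Test where
  toFun φ := mkTest (fun t => if 0 < t then ((t⁻¹ : ℝ) : ℂ) * φ (-Real.log t) else 0)
    (by
      have h : ContDiffOn ℝ ∞ (fun t : ℝ => ((t⁻¹ : ℝ) : ℂ) * φ (-Real.log t)) (Set.Ioi 0) := by
        refine ContDiffOn.mul ?_ (φ.contDiff.comp_contDiffOn (ContDiffOn.neg ?_))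
        · exact Complex.ofRealCLM.contDiff.comp_contDiffOn
            (contDiffOn_id.inv fun t ht => (ne_of_gt ht))
        · exact contDiffOn_id.log fun t ht => (ne_of_gt ht)
      exact h.congr fun t ht => if_pos ht)
    ⟨(fun r => Real.exp (-r)) '' tsupport φ,
      φ.hasCompactSupport.isCompact.image (by fun_prop), by
      rintro _ ⟨r, -, rfl⟩
      exact Real.exp_pos _, fun t ht => by
      split_ifs with h
      · rw [test_zero φ, mul_zero]
        exact fun h' => ht ⟨_, h', by simp [Real.exp_log h]⟩
      · rfl⟩
  map_add' φ ψ := by ext t; simp only [mkTest]; simp; split_ifs <;> simp [mul_add]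
  map_smul' c φ := by ext t; simp only [mkTest]; simp; split_ifs <;> ring

/-- The inverse substitution `ψ ↦ (r ↦ e^{-r} ψ(e^{-r}))`. -/
def thetaInvTest : Test →ₗ[ℂ] TestR where
  toFun ψ := mkTest (fun r => ((Real.exp (-r) : ℝ) : ℂ) * ψ (Real.exp (-r)))
    (by
      have h : ContDiff ℝ ∞ (fun r : ℝ => Real.exp (-r)) := contDiff_neg.exp
      exact ((Complex.ofRealCLM.contDiff.comp h).mul (ψ.contDiff.comp h)).contDiffOn)
    ⟨(fun t => -Real.log t) '' tsupport ψ, by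
      refine ψ.hasCompactSupport.isCompact.image_of_continuousOn (ContinuousOn.neg ?_)
      exact Real.continuousOn_log.mono fun t ht => ne_of_gt (ψ.tsupport_subset ht),
      fun _ _ => trivial, fun r hr => by
      rw [test_zero ψ, mul_zero]
      exact fun h => hr ⟨_, h, by simp⟩⟩
  map_add' φ ψ := by ext t; simp [mkTest, mul_add]
  map_smul' c φ := by ext t; simp [mkTest]; ring

theorem thetaTest_thetaInvTest (ψ : Test) : thetaTest (thetaInvTest ψ) = ψ := by
  ext t
  by_cases ht : 0 < t
  · have : (t : ℂ) ≠ 0 := Complex.ofReal_ne_zero.2 ht.ne'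
    change (if 0 < t then ((t⁻¹ : ℝ) : ℂ) * (((Real.exp (-(-Real.log t)) : ℝ) : ℂ) *
      ψ (Real.exp (-(-Real.log t)))) else 0) = ψ t
    rw [if_pos ht, neg_neg, Real.exp_log ht]
    push_cast
    field_simp
  · change (if 0 < t then ((t⁻¹ : ℝ) : ℂ) * (thetaInvTest ψ) (-Real.log t) else 0) = ψ t
    rw [if_neg ht, test_zero ψ fun h => ht (ψ.tsupport_subset h)]

/-- `⟨t⟩^δ = (1 + t²)^{δ/2}`. -/
def japanese (δ : ℝ) (t : ℝ) : ℝ := (1 + ‖t‖ ^ 2) ^ (δ / 2)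

theorem contDiff_japanese (δ : ℝ) : ContDiff ℝ ∞ (japanese δ) := by
  unfold japanese
  refine (contDiff_const.add (contDiff_norm_sq ℝ)).rpow_const_of_ne fun t => ?_
  positivity

theorem japanese_neg_mul (δ t : ℝ) : japanese δ t * japanese (-δ) t = 1 := by
  unfold japanese
  rw [← Real.rpow_add (by positivity)]
  ring_nf
  simp

/-- The cut-off function `ω`, equal to `1` for `t ≤ 1` and to `0` for `t ≥ 2`. -/
def cutoff (t : ℝ) : ℝ := Real.smoothTransition (2 - t)

theorem contDiff_cutoff : ContDiff ℝ ∞ cutoff :=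
  Real.smoothTransition.contDiff.comp (contDiff_const.sub contDiff_id)

/-! ### The function spaces on the half-line -/

/-- `L²(ℝ)`. -/
abbrev L2 : Type := Lp ℂ 2 (volume : Measure ℝ)

/-- The isometric parametrization `f ↦ ⟨t⟩^{-δ} ⟨D⟩^{-s} f` of the weighted Sobolev space
`H^{s,δ}(ℝ) = ⟨t⟩^{-δ} H^s(ℝ)` by `L²(ℝ)`. The elements of all Sobolev spaces on the line are
represented below through this parametrization. -/
def sobolev (s δ : ℝ) : L2 →L[ℂ] 𝓢'(ℝ, ℂ) :=
  (TemperedDistribution.smulLeftCLM ℂ (fun t : ℝ => ((japanese (-δ) t : ℝ) : ℂ))).comp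
    ((TemperedDistribution.besselPotential ℝ ℂ (-s)).comp
      (Lp.toTemperedDistributionCLM ℂ (volume : Measure ℝ) 2))

/-- Restriction of tempered distributions to `ℝ₊`. -/
def restrict : 𝓢'(ℝ, ℂ) →ₗ[ℂ] Dist where
  toFun u := { toFun φ := u (toSchwartz φ), map_add' := by simp, map_smul' := by simp }
  map_add' u v := by ext φ; simp
  map_smul' c u := by ext φ; simp

/-- `H^{s,δ}_0([0,∞))`: the elements of `H^{s,δ}(ℝ)` with support in `[0,∞)`. -/
def hZero (s δ : ℝ) : Submodule ℂ L2 where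
  carrier := {f | Distribution.IsVanishingOn (sobolev s δ f) (Set.Iio 0)}
  add_mem' hf hg φ hφ := by simp [hf φ hφ, hg φ hφ]
  zero_mem' φ _ := by simp
  smul_mem' c f hf φ hφ := by simp [hf φ hφ]

def HZero (s δ : ℝ) : Type := hZero s δ

instance (s δ : ℝ) : NormedAddCommGroup (HZero s δ) := inferInstanceAs (NormedAddCommGroup (hZero s δ))

instance (s δ : ℝ) : NormedSpace ℂ (HZero s δ) := inferInstanceAs (NormedSpace ℂ (hZero s δ))

/-- The tempered distribution given by an element of `H^{s,δ}_0([0,∞))`. -/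
def hZeroDist (s δ : ℝ) : HZero s δ →ₗ[ℂ] 𝓢'(ℝ, ℂ) :=
  (sobolev s δ : L2 →ₗ[ℂ] 𝓢'(ℝ, ℂ)) ∘ₗ (hZero s δ).subtype

/-- The elements of `H^{s,δ}(ℝ)` whose restriction to `ℝ₊` vanishes. -/
def hNull (s δ : ℝ) : Submodule ℂ L2 :=
  LinearMap.ker (restrict ∘ₗ (sobolev s δ : L2 →ₗ[ℂ] 𝓢'(ℝ, ℂ)))

instance isClosed_hNull (s δ : ℝ) : IsClosed (hNull s δ : Set L2) := by
  have : (hNull s δ : Set L2) = ⋂ φ : Test, {f | sobolev s δ f (toSchwartz φ) = 0} := by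
    ext f
    simp only [hNull, SetLike.mem_coe, LinearMap.mem_ker, Set.mem_iInter]
    exact LinearMap.ext_iff
  rw [this]
  refine isClosed_iInter fun φ => isClosed_eq ?_ continuous_const
  exact (PointwiseConvergenceCLM.evalCLM (RingHom.id ℂ) ℂ (toSchwartz φ)).continuous.comp
    (sobolev s δ).continuous

/-- `H^{s,δ}(ℝ₊)`, the space of restrictions to `ℝ₊` of the elements of `H^{s,δ}(ℝ)`, with the
quotient norm `‖v‖ = inf {‖u‖ | u|_{ℝ₊} = v}`. -/
def HPlus (s δ : ℝ) : Type := L2 ⧸ hNull s δ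

instance (s δ : ℝ) : NormedAddCommGroup (HPlus s δ) :=
  inferInstanceAs (NormedAddCommGroup (L2 ⧸ hNull s δ))

instance (s δ : ℝ) : NormedSpace ℂ (HPlus s δ) := inferInstanceAs (NormedSpace ℂ (L2 ⧸ hNull s δ))

/-- The distribution on `ℝ₊` given by an element of `H^{s,δ}(ℝ₊)`. -/
def hPlusDist (s δ : ℝ) : HPlus s δ →ₗ[ℂ] Dist :=
  (hNull s δ).liftQ (restrict ∘ₗ (sobolev s δ : L2 →ₗ[ℂ] 𝓢'(ℝ, ℂ))) le_rfl

theorem contDiffOn_near (γ δ : ℝ) :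
    ContDiffOn ℝ ∞ (fun t : ℝ => cutoff t * t ^ (1 / 2 - γ) * japanese δ t) (Set.Ioi 0) :=
  (contDiff_cutoff.contDiffOn.mul (contDiffOn_id.rpow_const_of_ne fun _ ht => ne_of_gt ht)).mul
    (contDiff_japanese δ).contDiffOn

theorem contDiffOn_far (δ : ℝ) :
    ContDiffOn ℝ ∞ (fun t : ℝ => (1 - cutoff t) * japanese δ t) (Set.Ioi 0) :=
  ((contDiff_const.sub contDiff_cutoff).mul (contDiff_japanese δ)).contDiffOn

/-- The weighted cone Sobolev space `𝒦^{s,γ}(ℝ₊)^δ = ⟨t⟩^{-δ} 𝒦^{s,γ}(ℝ₊)`. Its elements are the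
distributions `w` on `ℝ₊` such that `U = θ(t^{1/2-γ} ω ⟨t⟩^δ w)` belongs to `H^s(ℝ)` and
`V = (1-ω) ⟨t⟩^δ w` belongs to `H^s(ℝ₊)`; they are recorded together with `(U, V)`. -/
def coneSpace (s γ δ : ℝ) : Submodule ℂ (Dist × WithLp 1 (L2 × HPlus s 0)) where
  carrier := {q |
    (∀ φ : TestR, sobolev s 0 q.2.fst (toSchwartz φ) =
      q.1 (mulTest _ (contDiffOn_near γ δ) (thetaTest φ))) ∧
    (∀ φ : Test, hPlusDist s 0 q.2.snd φ = q.1 (mulTest _ (contDiffOn_far δ) φ))}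
  add_mem' {p q} hp hq := ⟨fun φ => by simp [hp.1 φ, hq.1 φ], fun φ => by simp [hp.2 φ, hq.2 φ]⟩
  zero_mem' := ⟨fun φ => by simp, fun φ => by simp⟩
  smul_mem' c q hq := ⟨fun φ => by simp [hq.1 φ], fun φ => by simp [hq.2 φ]⟩

/-- The pair `(U, V)` of an element of `𝒦^{s,γ}(ℝ₊)^δ`. -/
def conePair (s γ δ : ℝ) : coneSpace s γ δ →ₗ[ℂ] WithLp 1 (L2 × HPlus s 0) :=
  LinearMap.snd ℂ Dist (WithLp 1 (L2 × HPlus s 0)) ∘ₗ (coneSpace s γ δ).subtype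

theorem conePair_injective (s γ δ : ℝ) : Function.Injective (conePair s γ δ) := by
  rw [← LinearMap.ker_eq_bot, LinearMap.ker_eq_bot']
  rintro ⟨⟨w, p⟩, h1, h2⟩ hp
  replace hp : p = 0 := hp
  subst hp
  have hw : w = 0 := by
    ext ψ
    have hA : ContDiffOn ℝ ∞ (fun t : ℝ => t ^ (-(1 / 2 - γ)) * japanese (-δ) t) (Set.Ioi 0) :=
      (contDiffOn_id.rpow_const_of_ne fun _ ht => ne_of_gt ht).mul
        (contDiff_japanese (-δ)).contDiffOn
    have hB : ContDiffOn ℝ ∞ (japanese (-δ)) (Set.Ioi 0) := (contDiff_japanese (-δ)).contDiffOn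
    have e1 := h1 (thetaInvTest (mulTest _ hA ψ))
    have e2 := h2 (mulTest _ hB ψ)
    simp only [thetaTest_thetaInvTest] at e1
    have e3 : ψ = mulTest _ (contDiffOn_near γ δ) (mulTest _ hA ψ)
        + mulTest _ (contDiffOn_far δ) (mulTest _ hB ψ) := by
      ext t
      change ψ t = ((cutoff t * t ^ (1 / 2 - γ) * japanese δ t : ℝ) : ℂ) *
          (((t ^ (-(1 / 2 - γ)) * japanese (-δ) t : ℝ) : ℂ) * ψ t) +
        (((1 - cutoff t) * japanese δ t : ℝ) : ℂ) * ((japanese (-δ) t : ℝ) * ψ t)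
      by_cases ht : 0 < t
      · have a1 := japanese_neg_mul δ t
        have a2 : t ^ (1 / 2 - γ) * t ^ (-(1 / 2 - γ)) = 1 := by
          rw [← Real.rpow_add ht]; simp
        have a3 : cutoff t * t ^ (1 / 2 - γ) * japanese δ t *
            (t ^ (-(1 / 2 - γ)) * japanese (-δ) t) +
            (1 - cutoff t) * japanese δ t * japanese (-δ) t = 1 := by
          linear_combination (1 - cutoff t + cutoff t * (t ^ (1 / 2 - γ) * t ^ (-(1 / 2 - γ)))) * a1
            + cutoff t * a2
        have a4 := congrArg (fun r : ℝ => (r : ℂ) * ψ t) a3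
        simp only [Complex.ofReal_add, Complex.ofReal_one, one_mul] at a4
        refine a4.symm.trans ?_
        push_cast
        ring
      · rw [test_zero ψ fun h => ht (ψ.tsupport_subset h)]
        simp
    rw [e3, map_add, ← e1, ← e2]
    simp
  subst hw
  rfl

/-- `𝒦^{s,γ}(ℝ₊)^δ` with the norm
`‖w‖ = ‖θ(t^{1/2-γ} ω ⟨t⟩^δ w)‖_{H^s(ℝ)} + ‖(1-ω) ⟨t⟩^δ w‖_{H^s(ℝ₊)}`. -/
def Cone (s γ δ : ℝ) : Type := coneSpace s γ δ

instance (s γ δ : ℝ) : NormedAddCommGroup (Cone s γ δ) :=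
  NormedAddCommGroup.induced (coneSpace s γ δ) _ (conePair s γ δ) (conePair_injective s γ δ)

instance (s γ δ : ℝ) : NormedSpace ℂ (Cone s γ δ) :=
  NormedSpace.induced ℂ (coneSpace s γ δ) _ (conePair s γ δ)

/-- The distribution on `ℝ₊` given by an element of `𝒦^{s,γ}(ℝ₊)^δ`. -/
def coneDist (s γ δ : ℝ) : Cone s γ δ →ₗ[ℂ] Dist :=
  LinearMap.fst ℂ Dist (WithLp 1 (L2 × HPlus s 0)) ∘ₗ (coneSpace s γ δ).subtype

/-- The elements of `H^{s,δ}(ℝ)` parametrized by `sobolev s δ` are the tempered distributions `u`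
with `⟨t⟩^δ u ∈ H^s(ℝ)`. -/
theorem mem_range_sobolev (s δ : ℝ) (u : 𝓢'(ℝ, ℂ)) :
    u ∈ Set.range (sobolev s δ) ↔ TemperedDistribution.MemSobolev s 2
      (TemperedDistribution.smulLeftCLM ℂ (fun t : ℝ => ((japanese δ t : ℝ) : ℂ)) u) := by
  have hT (ε : ℝ) : (fun t : ℝ => ((japanese ε t : ℝ) : ℂ)).HasTemperateGrowth := by
    have := Function.hasTemperateGrowth_one_add_norm_sq_rpow ℝ (ε / 2)
    unfold japanese
    fun_prop
  have h1 (ε : ℝ) (v : 𝓢'(ℝ, ℂ)) :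
      TemperedDistribution.smulLeftCLM ℂ (fun t : ℝ => ((japanese ε t : ℝ) : ℂ))
        (TemperedDistribution.smulLeftCLM ℂ (fun t : ℝ => ((japanese (-ε) t : ℝ) : ℂ)) v) = v := by
    rw [TemperedDistribution.smulLeftCLM_smulLeftCLM_apply (hT _) (hT _)]
    have : (fun t : ℝ => ((japanese (-ε) t : ℝ) : ℂ)) * (fun t : ℝ => ((japanese ε t : ℝ) : ℂ))
        = fun _ => 1 := by
      ext t
      simp only [Pi.mul_apply]
      rw [mul_comm]
      exact_mod_cast japanese_neg_mul ε t
    rw [this]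
    simp
  constructor
  · rintro ⟨f, rfl⟩
    refine ⟨f, ?_⟩
    simp [sobolev, h1]
  · rintro ⟨f, hf⟩
    refine ⟨f, ?_⟩
    have h2 := h1 (-δ) u
    rw [neg_neg] at h2
    simp only [sobolev, ContinuousLinearMap.comp_apply, Lp.toTemperedDistributionCLM_apply]
    rw [← hf]
    simp [h2]

/-! ### Spaces with group action -/

/-- The dilations `κ_r` on a space of distributions: `dil r u v` means that `r > 0` and
`v = κ_r u`, where `⟨κ_r u, φ⟩ = ⟨u, κ_r⁻¹ φ⟩`. -/
class KappaSpace (E : Type*) where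
  dil : ℝ → E → E → Prop

/-- `isTest φ u` means that `u` is the regular distribution with density `φ`. -/
class SourceSpace (E : Type*) where
  isTest : Test → E → Prop

/-- The embedding into the distributions on `ℝ₊`. -/
class TargetSpace (E : Type*) where
  toDist : E → Dist

instance (s δ : ℝ) : KappaSpace (HZero s δ) where
  dil r u v := ∃ hr : 0 < r, ∀ φ : 𝓢(ℝ, ℂ),
    hZeroDist s δ v φ = hZeroDist s δ u (dilSchwartz r⁻¹ (inv_pos.2 hr) φ)

instance (s δ : ℝ) : SourceSpace (HZero s δ) where
  isTest φ u := ∀ ψ : 𝓢(ℝ, ℂ), hZeroDist s δ u ψ = ∫ t : ℝ, φ t * ψ t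

instance (s δ : ℝ) : TargetSpace (HPlus s δ) where
  toDist u := hPlusDist s δ u

instance (s δ : ℝ) : KappaSpace (HPlus s δ) where
  dil r u v := ∃ hr : 0 < r, ∀ φ : Test,
    hPlusDist s δ v φ = hPlusDist s δ u (dilTest r⁻¹ (inv_pos.2 hr) φ)

instance (s γ δ : ℝ) : TargetSpace (Cone s γ δ) where
  toDist u := coneDist s γ δ u

instance (s γ δ : ℝ) : SourceSpace (Cone s γ δ) where
  isTest φ u := ∀ ψ : Test, coneDist s γ δ u ψ = ∫ t : ℝ, φ t * ψ t

instance (s γ δ : ℝ) : KappaSpace (Cone s γ δ) where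
  dil r u v := ∃ hr : 0 < r, ∀ φ : Test,
    coneDist s γ δ v φ = coneDist s γ δ u (dilTest r⁻¹ (inv_pos.2 hr) φ)

/-- `E(ℝ₊, ℂ^L) ⊕ ℂ^M`; the maximum norm used here is equivalent to the Hilbert sum norm. -/
abbrev Block (E : Type*) (L M : ℕ) : Type _ := (Fin L → E) × (Fin M → ℂ)

/-- The group action `κ_r (u ⊕ z) = κ_r u ⊕ z`. -/
instance (E : Type*) [KappaSpace E] (L M : ℕ) : KappaSpace (Block E L M) where
  dil r u v := 0 < r ∧ (∀ i, KappaSpace.dil r (u.1 i) (v.1 i)) ∧ v.2 = u.2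

/-! ### Operator-valued symbols

Points `(x, (ξ, μ))`, where `x, ξ ∈ ℝ^n` and `μ ∈ ℝ`. -/

abbrev Phase (n : ℕ) : Type := EuclideanSpace ℝ (Fin n) × (EuclideanSpace ℝ (Fin n) × ℝ)

/-- `ℝ^n × ℝ^n × [0,∞)`. -/
def fullDomain (n : ℕ) : Set (Phase n) := {p | 0 ≤ p.2.2}

/-- `ℝ^n × ((ℝ^n × [0,∞)) \ {0})`. -/
def strongDomain (n : ℕ) : Set (Phase n) := {p | 0 ≤ p.2.2 ∧ p.2 ≠ 0}

/-- `ℝ^n × (ℝ^n \ {0}) × [0,∞)`. -/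
def weakDomain (n : ℕ) : Set (Phase n) := {p | 0 ≤ p.2.2 ∧ p.2.1 ≠ 0}

/-- `⟨ξ⟩`. -/
def brXi {n : ℕ} (p : Phase n) : ℝ := √(1 + ‖p.2.1‖ ^ 2)

/-- `⟨ξ, μ⟩`. -/
def brXiMu {n : ℕ} (p : Phase n) : ℝ := √(1 + ‖p.2.1‖ ^ 2 + p.2.2 ^ 2)

/-- `|ξ|`. -/
def absXi {n : ℕ} (p : Phase n) : ℝ := ‖p.2.1‖

/-- `|ξ, μ|`. -/
def absXiMu {n : ℕ} (p : Phase n) : ℝ := √(‖p.2.1‖ ^ 2 + p.2.2 ^ 2)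

/-- The coordinate directions `x_i`, `ξ_i`, `μ`. -/
inductive Direction (n : ℕ) : Type
  | x (i : Fin n) : Direction n
  | xi (i : Fin n) : Direction n
  | mu : Direction n

def Direction.vec {n : ℕ} : Direction n → Phase n
  | .x i => (EuclideanSpace.single i 1, (0, 0))
  | .xi i => (0, (EuclideanSpace.single i 1, 0))
  | .mu => (0, (0, 1))

def Direction.isXi {n : ℕ} : Direction n → Bool
  | .xi _ => true
  | _ => false

def Direction.isMu {n : ℕ} : Direction n → Bool
  | .mu => true
  | _ => false

/-- Iterated partial derivatives within `D`, along a list of coordinate directions. -/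
def partials {n : ℕ} {F : Type*} [NormedAddCommGroup F] [NormedSpace ℝ F] (D : Set (Phase n)) :
    List (Direction n) → (Phase n → F) → Phase n → F
  | [], a => a
  | e :: l, a => fun p => fderivWithin ℝ (partials D l a) D p e.vec

section Symbols

variable {n : ℕ} {E₀ E₁ : Type*} [NormedAddCommGroup E₀] [NormedSpace ℂ E₀] [KappaSpace E₀]
  [NormedAddCommGroup E₁] [NormedSpace ℂ E₁] [KappaSpace E₁]

/-- `‖κ_{1,r₁}⁻¹ T κ_{0,r₀}‖ ≤ C`. -/
def TwistedNormLE (r₀ r₁ : ℝ) (T : E₀ →L[ℂ] E₁) (C : ℝ) : Prop :=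
  ∀ u v : E₀, KappaSpace.dil r₀ u v → ∃ w : E₁, KappaSpace.dil r₁ w (T v) ∧ ‖w‖ ≤ C * ‖u‖

/-- Smooth functions on `D` satisfying
`‖κ₁⁻¹_{r₁} {D_ξ^α D_x^β D_μ^j a} κ_{0,r₀}‖ ≤ C_{αβj} weight(|α|, j)`. -/
def SymbolEstimates (D : Set (Phase n)) (r₀ r₁ : Phase n → ℝ) (weight : ℕ → ℕ → Phase n → ℝ)
    (a : Phase n → E₀ →L[ℂ] E₁) : Prop :=
  ContDiffOn ℝ ∞ a D ∧ ∀ l : List (Direction n), ∃ C : ℝ, ∀ p ∈ D,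
    TwistedNormLE (r₀ p) (r₁ p) (partials D l a p)
      (C * weight (l.countP Direction.isXi) (l.countP Direction.isMu) p)

/-- `κ`-homogeneity of degree `d` on `D`:
`a(x, rξ; rμ) κ_{0,r} u = r^d κ_{1,r} a(x, ξ; μ) u` for all `r > 0`. -/
def KappaHomogeneous (D : Set (Phase n)) (d : ℝ) (a : Phase n → E₀ →L[ℂ] E₁) : Prop :=
  ∀ p ∈ D, ∀ r : ℝ, 0 < r → ∀ u v : E₀, KappaSpace.dil r u v →
    KappaSpace.dil r (((r ^ d : ℝ) : ℂ) • a p u) (a (p.1, r • p.2) v)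

/-- `0`-excision functions: smooth, vanishing near `0`, equal to `1` near infinity. -/
def IsExcision {F : Type*} [NormedAddCommGroup F] [NormedSpace ℝ F] (χ : F → ℝ) : Prop :=
  ContDiff ℝ ∞ χ ∧ (∀ᶠ y in nhds 0, χ y = 0) ∧ ∃ R : ℝ, ∀ y, R ≤ ‖y‖ → χ y = 1

/-- `S^d_{1,0}(ℝ^n × [0,∞); E₀, E₁)`. -/
def StrongSymbol (d : ℝ) (a : Phase n → E₀ →L[ℂ] E₁) : Prop :=
  SymbolEstimates (fullDomain n) brXiMu brXiMu (fun k j p => brXiMu p ^ (d - k - j)) a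

/-- `S^{(d)}(ℝ^n × [0,∞); E₀, E₁)`. -/
def StrongHomogeneous (d : ℝ) (a : Phase n → E₀ →L[ℂ] E₁) : Prop :=
  KappaHomogeneous (strongDomain n) d a ∧
    SymbolEstimates (strongDomain n) absXiMu absXiMu (fun k j p => absXiMu p ^ (d - k - j)) a

/-- `S^d(ℝ^n × [0,∞); E₀, E₁)`, the classical strongly parameter-dependent symbols. -/
def StrongClassical (d : ℝ) (a : Phase n → E₀ →L[ℂ] E₁) : Prop :=
  StrongSymbol d a ∧ ∃ h : ℕ → Phase n → E₀ →L[ℂ] E₁, (∀ j : ℕ, StrongHomogeneous (d - j) (h j)) ∧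
    ∀ χ : EuclideanSpace ℝ (Fin n) × ℝ → ℝ, IsExcision χ → ∀ N : ℕ,
      StrongSymbol (d - N) (fun p => a p - ∑ j ∈ Finset.range N, ((χ p.2 : ℝ) : ℂ) • h j p)

/-- The kind of twisting: boldface `κ(ξ, μ)` or ordinary `κ(ξ)`. -/
inductive Twist : Type
  | bold : Twist
  | plain : Twist

def Twist.bracket : Twist → Phase n → ℝ
  | .bold => brXiMu
  | .plain => brXi

def Twist.modulus : Twist → Phase n → ℝ
  | .bold => absXiMu
  | .plain => absXi

/-- `S̃^{d,ν}_{1,0}(ℝ^n × [0,∞); E₀, E₁)_{k₀,k₁}`. -/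
def WeakSymbol (k₀ k₁ : Twist) (d ν : ℝ) (a : Phase n → E₀ →L[ℂ] E₁) : Prop :=
  SymbolEstimates (fullDomain n) k₀.bracket k₁.bracket
    (fun k j p => brXi p ^ (ν - k) * brXiMu p ^ (d - ν - j)) a

/-- `S̃^{(d,ν)}(ℝ^n × [0,∞); E₀, E₁)_{k₀,k₁}`. -/
def WeakHomogeneous (k₀ k₁ : Twist) (d ν : ℝ) (a : Phase n → E₀ →L[ℂ] E₁) : Prop :=
  KappaHomogeneous (weakDomain n) d a ∧
    SymbolEstimates (weakDomain n) k₀.modulus k₁.modulus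
      (fun k j p => absXi p ^ (ν - k) * absXiMu p ^ (d - ν - j)) a

/-- `S̃^{d,ν}(ℝ^n × [0,∞); E₀, E₁)_{k₀,k₁}`, the classical weakly parameter-dependent symbols. -/
def WeakClassical (k₀ k₁ : Twist) (d ν : ℝ) (a : Phase n → E₀ →L[ℂ] E₁) : Prop :=
  WeakSymbol k₀ k₁ d ν a ∧ ∃ h : ℕ → Phase n → E₀ →L[ℂ] E₁,
    (∀ j : ℕ, WeakHomogeneous k₀ k₁ (d - j) (ν - j) (h j)) ∧
    ∀ χ : EuclideanSpace ℝ (Fin n) → ℝ, IsExcision χ → ∀ N : ℕ,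
      WeakSymbol k₀ k₁ (d - N) (ν - N)
        (fun p => a p - ∑ j ∈ Finset.range N, ((χ p.2.1 : ℝ) : ℂ) • h j p)

end Symbols

/-! ### Singular Green symbols of type `0` -/

/-- Linear operators from `C_c^∞(ℝ₊, ℂ^L) ⊕ ℂ^M` to distributions on `ℝ₊` with values in `ℂ^{L'}`,
plus `ℂ^{M'}`. Since `C_c^∞(ℝ₊)` is dense in all the spaces `H^{s,δ}_0([0,∞))` and
`𝒦^{s,γ}(ℝ₊)^δ`, bounded operators on these spaces are identified with their restrictions to test
functions. -/
abbrev GreenOp (L M L' M' : ℕ) : Type := Block Test L M →ₗ[ℂ] Block Dist L' M'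

/-- The operator function `g`, given on test functions, is on `D` the restriction of `a`. -/
def Realizes {n L M L' M' : ℕ} {E₀ E₁ : Type*} [NormedAddCommGroup E₀] [NormedSpace ℂ E₀]
    [SourceSpace E₀] [NormedAddCommGroup E₁] [NormedSpace ℂ E₁] [TargetSpace E₁]
    {D : Set (Phase n)} (a : Phase n → Block E₀ L M →L[ℂ] Block E₁ L' M')
    (g : D → GreenOp L M L' M') : Prop :=
  ∀ (p : D) (φ : Block Test L M) (u : Fin L → E₀), (∀ i, SourceSpace.isTest (φ.1 i) (u i)) →
    (∀ i, TargetSpace.toDist ((a p (u, φ.2)).1 i) = (g p φ).1 i) ∧ (a p (u, φ.2)).2 = (g p φ).2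

section Membership

variable {n L M L' M' : ℕ} (E₀ E₁ : Type*)
  [NormedAddCommGroup E₀] [NormedSpace ℂ E₀] [KappaSpace E₀] [SourceSpace E₀]
  [NormedAddCommGroup E₁] [NormedSpace ℂ E₁] [KappaSpace E₁] [TargetSpace E₁]

/-- `g` belongs to `S^d(E₀(ℂ^L) ⊕ ℂ^M, E₁(ℂ^{L'}) ⊕ ℂ^{M'})`. -/
def MemStrong (d : ℝ) (g : fullDomain n → GreenOp L M L' M') : Prop :=
  ∃ a : Phase n → Block E₀ L M →L[ℂ] Block E₁ L' M', StrongClassical d a ∧ Realizes a g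

/-- `g` belongs to `S^{(d)}(E₀(ℂ^L) ⊕ ℂ^M, E₁(ℂ^{L'}) ⊕ ℂ^{M'})`. -/
def MemStrongHom (d : ℝ) (g : strongDomain n → GreenOp L M L' M') : Prop :=
  ∃ a : Phase n → Block E₀ L M →L[ℂ] Block E₁ L' M', StrongHomogeneous d a ∧ Realizes a g

/-- `g` belongs to `S̃^{d,ν}(E₀(ℂ^L) ⊕ ℂ^M, E₁(ℂ^{L'}) ⊕ ℂ^{M'})_{k₀,k₁}`. -/
def MemWeak (k₀ k₁ : Twist) (d ν : ℝ)
    (g : fullDomain n → GreenOp L M L' M') : Prop :=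
  ∃ a : Phase n → Block E₀ L M →L[ℂ] Block E₁ L' M',
    WeakClassical k₀ k₁ d ν a ∧ Realizes a g

/-- `g` belongs to `S̃^{(d,ν)}(E₀(ℂ^L) ⊕ ℂ^M, E₁(ℂ^{L'}) ⊕ ℂ^{M'})_{k₀,k₁}`. -/
def MemWeakHom (k₀ k₁ : Twist) (d ν : ℝ)
    (g : weakDomain n → GreenOp L M L' M') : Prop :=
  ∃ a : Phase n → Block E₀ L M →L[ℂ] Block E₁ L' M',
    WeakHomogeneous k₀ k₁ d ν a ∧ Realizes a g

end Membership

section Green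

variable (n L M L' M' : ℕ)

/-- `𝓑^{d;0}_G(ℝ^n × [0,∞); (L,M), (L',M'))`. -/
def StrongGreen (d : ℝ) : Set (fullDomain n → GreenOp L M L' M') :=
  {g | ∀ s s' δ δ' : ℝ, MemStrong (HZero s δ) (HPlus s' δ') d g}

/-- `𝓑^{(d);0}_G(ℝ^n × [0,∞); (L,M), (L',M'))`. -/
def StrongGreenHom (d : ℝ) : Set (strongDomain n → GreenOp L M L' M') :=
  {g | ∀ s s' δ δ' : ℝ, MemStrongHom (HZero s δ) (HPlus s' δ') d g}

/-- `𝓑̃^{d,ν;0}_G(ℝ^n × [0,∞); (L,M), (L',M'))`. -/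
def WeakGreen (d ν : ℝ) : Set (fullDomain n → GreenOp L M L' M') :=
  {g | ∀ s s' δ δ' : ℝ,
    MemWeak (HZero s 0) (HPlus s' 0) .bold .bold d ν g ∧
    MemWeak (HZero s 0) (Cone s' 0 δ') .bold .plain d ν g ∧
    MemWeak (Cone s 0 δ) (HPlus s' 0) .plain .bold d ν g ∧
    MemWeak (Cone s 0 δ) (Cone s' 0 δ') .plain .plain d ν g}

/-- `𝓑̃^{(d,ν);0}_G(ℝ^n × [0,∞); (L,M), (L',M'))`. -/
def WeakGreenHom (d ν : ℝ) : Set (weakDomain n → GreenOp L M L' M') :=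
  {g | ∀ s s' δ δ' : ℝ,
    MemWeakHom (HZero s 0) (HPlus s' 0) .bold .bold d ν g ∧
    MemWeakHom (HZero s 0) (Cone s' 0 δ') .bold .plain d ν g ∧
    MemWeakHom (Cone s 0 δ) (HPlus s' 0) .plain .bold d ν g ∧
    MemWeakHom (Cone s 0 δ) (Cone s' 0 δ') .plain .plain d ν g}

/-- `𝓑^{d,ν;0}_G = 𝓑^{d;0}_G + 𝓑̃^{d,ν;0}_G`, the singular Green symbols of order `d`, regularity
`ν` and type `0`. -/
def Green (d ν : ℝ) : Set (fullDomain n → GreenOp L M L' M') :=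
  {g | ∃ g₀ ∈ StrongGreen n L M L' M' d, ∃ g₁ ∈ WeakGreen n L M L' M' d ν, g = g₀ + g₁}

end Green

/-- Strongly homogeneous symbols, defined for `(ξ, μ) ≠ 0`, are restricted to `ξ ≠ 0`. -/
theorem weakDomain_subset (n : ℕ) : weakDomain n ⊆ strongDomain n :=
  fun _ hp => ⟨hp.1, fun h => hp.2 (by rw [h]; rfl)⟩

end GreenSymbols

end

open scoped SchwartzMap Distributions ContDiff
open MeasureTheory

noncomputable section

namespace GreenSymbols

open scoped FourierTransform LineDeriv

/-! A strong Green symbol acts from every `H^{k,ε}_0` to every `H^{k',ε'}(ℝ₊)`, with both sides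
twisted by `κ` at `r = ⟨ξ,μ⟩`. The weak classes ask for cone spaces on some sides, twisted there by
`κ` at `r' = ⟨ξ⟩ ≤ r`. One composes with fixed embeddings `I` of the cone space into `H^{k,ε}_0`
(with `k, ε` very negative) and `J` of `H^{k',ε'}(ℝ₊)` into the cone space (with `k', ε'` large).
The change of twist costs the norms of `κ_{r'}⁻¹ J κ_r` and `κ_r⁻¹ I κ_{r'}`, that is, of `J κ_λ`
and `κ_λ⁻¹ I` with `λ = r/r' ≥ 1`. Everything rests on bounds for these that are uniform in `λ ≥ 1`:
`exists_targetEmbedding` and `exists_sourceEmbedding`.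

The uniformity comes from the norm `conormal`. The operators `t^j ∂_t^j` commute with dilations and
`κ_λ` is unitary on `L²(ℝ₊)`, so only the weight `(1 + t²)^K` feels `κ_λ`, and for `λ ≥ 1` it makes
`κ_λ` a contraction (`conormal_dilSchwartz_le`). This norm is bounded by the norm of `H^{K,3K}`
(`exists_conormal_weighted_le`), and for suitable `K` it bounds both components of the cone norm:
the one near `0` after the substitution `t = e^{-r}` (`controlled_bessel_near`) and the one away
from `0` (`controlled_bessel_far`). This gives `J`.

The embedding `I` is obtained by transposition: an element of a cone space becomes a functional on
`𝓢(ℝ)` bounded by a `conormal` norm. Such a functional sees only `ℝ₊`, hence is supported in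
`[0,∞)`, and it is determined by its values on `C_c^∞(ℝ₊)`, because the test functions are dense for
the `conormal` norms (`eq_zero_of_controlled`). Hence the extension respects dilations and test
functions.

It remains to compare weights and expansions. For `ν ≤ 0` one has `⟨ξ,μ⟩^{d-k-j} ≤ ⟨ξ⟩^{ν-k}
⟨ξ,μ⟩^{d-ν-j}`, and likewise for homogeneous symbols. In the expansions an excision function of
`(ξ,μ)` is replaced by one of `ξ`; the difference is compactly supported in `ξ`, so powers of `⟨ξ⟩`
are free there (`SymbolEstimates.compact_mul`, `StrongClassical.comp_weakClassical`). The equality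
of the two Green classes follows from this inclusion, closure of the weak class under sums, and `g =
0 + g`. -/

/-! ### Bessel potentials on Schwartz functions -/

/-- The symbol `⟨x⟩^s`, as a complex-valued function. -/
def besselSymbol (s : ℝ) (x : ℝ) : ℂ := ((1 + ‖x‖ ^ 2) ^ (s / 2) : ℝ)

theorem hasTemperateGrowth_besselSymbol (s : ℝ) : (besselSymbol s).HasTemperateGrowth := by
  unfold besselSymbol
  fun_prop

theorem besselSymbol_mul (s s' : ℝ) :
    besselSymbol s * besselSymbol s' = besselSymbol (s + s') := by
  ext x
  simp only [besselSymbol, Pi.mul_apply]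
  norm_cast
  rw [← Real.rpow_add (by positivity), add_div]

/-- The Bessel potential `⟨D⟩^s` on Schwartz functions. -/
def bessel (s : ℝ) : 𝓢(ℝ, ℂ) →L[ℂ] 𝓢(ℝ, ℂ) :=
  SchwartzMap.fourierMultiplierCLM ℂ (besselSymbol s)

theorem bessel_bessel (s s' : ℝ) (ψ : 𝓢(ℝ, ℂ)) : bessel s (bessel s' ψ) = bessel (s + s') ψ := by
  unfold bessel
  rw [SchwartzMap.fourierMultiplierCLM_fourierMultiplierCLM_apply
    (hasTemperateGrowth_besselSymbol _) (hasTemperateGrowth_besselSymbol _)]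
  rw [besselSymbol_mul]

theorem bessel_zero (ψ : 𝓢(ℝ, ℂ)) : bessel 0 ψ = ψ := by
  have : besselSymbol 0 = fun _ => 1 := by ext x; simp [besselSymbol]
  unfold bessel
  rw [this, SchwartzMap.fourierMultiplierCLM_const]
  simp

theorem fourier_bessel (s : ℝ) (ψ : 𝓢(ℝ, ℂ)) (x : ℝ) :
    𝓕 (bessel s ψ) x = besselSymbol s x * 𝓕 ψ x := by
  rw [bessel, SchwartzMap.fourierMultiplierCLM_apply, FourierTransform.fourier_fourierInv_eq,
    SchwartzMap.smulLeftCLM_apply_apply (hasTemperateGrowth_besselSymbol s), smul_eq_mul]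

/-- The multiplier on tempered distributions is defined by transposition and agrees with the one on
Schwartz functions; evaluating this agreement at `g` gives the transpose in unsimplified form. -/
theorem integral_bessel_mul (s : ℝ) (f g : 𝓢(ℝ, ℂ)) :
    ∫ x, bessel s f x * g x =
      ∫ x, f x * 𝓕 (SchwartzMap.smulLeftCLM ℂ (besselSymbol s) (𝓕⁻ g)) x := by
  have h := TemperedDistribution.fourierMultiplierCLM_toTemperedDistributionCLM_eq
    (hasTemperateGrowth_besselSymbol s) f
  have h2 := DFunLike.congr_fun h g
  simp only [TemperedDistribution.fourierMultiplierCLM_apply_apply, SchwartzMap.coe_apply,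
    smul_eq_mul] at h2
  simp_rw [mul_comm (f _), bessel, mul_comm _ (g _)]
  exact h2.symm

/-- Reflection `t ↦ -t` of Schwartz functions. -/
def reflect : 𝓢(ℝ, ℂ) →L[ℂ] 𝓢(ℝ, ℂ) :=
  SchwartzMap.compCLMOfContinuousLinearEquiv ℂ (LinearIsometryEquiv.neg ℝ (E := ℝ))

theorem reflect_apply (ψ : 𝓢(ℝ, ℂ)) (t : ℝ) : reflect ψ t = ψ (-t) := rfl

theorem fourier_fourier (φ : 𝓢(ℝ, ℂ)) : 𝓕 (𝓕 φ) = reflect φ := by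
  have := SchwartzMap.fourierInv_apply_eq (𝓕 φ)
  rw [FourierTransform.fourierInv_fourier_eq] at this
  ext t
  have h3 := DFunLike.congr_fun this (-t)
  rw [reflect_apply, h3]
  change _ = (𝓕 (𝓕 φ)) (- -t)
  rw [neg_neg]

theorem fourier_reflect (ψ : 𝓢(ℝ, ℂ)) : 𝓕 (reflect ψ) = 𝓕⁻ ψ := by
  rw [← fourier_fourier, fourier_fourier (𝓕 ψ), SchwartzMap.fourierInv_apply_eq]
  rfl

/-- Exchanging `𝓕` with `𝓕⁻¹` amounts to a reflection, which the even symbol `⟨x⟩^s` does not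
notice. Hence `⟨D⟩^s` is its own transpose for the bilinear pairing. -/
theorem transpose_bessel (s : ℝ) (ψ : 𝓢(ℝ, ℂ)) :
    𝓕 (SchwartzMap.smulLeftCLM ℂ (besselSymbol s) (𝓕⁻ ψ)) = bessel s ψ := by
  rw [bessel, SchwartzMap.fourierMultiplierCLM_apply,
    ← fourier_reflect (SchwartzMap.smulLeftCLM ℂ (besselSymbol s) (𝓕 ψ))]
  congr 1
  ext t
  rw [reflect_apply, SchwartzMap.smulLeftCLM_apply_apply (hasTemperateGrowth_besselSymbol s),
    SchwartzMap.smulLeftCLM_apply_apply (hasTemperateGrowth_besselSymbol s),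
    SchwartzMap.fourierInv_apply_eq]
  have : besselSymbol s (-t) = besselSymbol s t := by simp [besselSymbol]
  rw [this]
  rfl

theorem integral_bessel_mul_eq (s : ℝ) (f g : 𝓢(ℝ, ℂ)) :
    ∫ x, bessel s f x * g x = ∫ x, f x * bessel s g x := by
  rw [integral_bessel_mul, transpose_bessel]

/-! ### Norms of Schwartz functions in `L²` -/

/-- The `L²`-norm of a Schwartz function. -/
def l2norm (ψ : 𝓢(ℝ, ℂ)) : ℝ := ‖(ψ.toLp 2 : L2)‖

theorem l2norm_nonneg (ψ : 𝓢(ℝ, ℂ)) : 0 ≤ l2norm ψ := norm_nonneg _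

theorem l2norm_eq (ψ : 𝓢(ℝ, ℂ)) : l2norm ψ = (eLpNorm ψ 2 volume).toReal :=
  SchwartzMap.norm_toLp

theorem l2norm_mono {φ ψ : 𝓢(ℝ, ℂ)} (h : ∀ t, ‖φ t‖ ≤ ‖ψ t‖) : l2norm φ ≤ l2norm ψ := by
  rw [l2norm_eq, l2norm_eq]
  exact ENNReal.toReal_mono (ψ.eLpNorm_lt_top 2 volume).ne
    (eLpNorm_mono fun t => h t)

theorem l2norm_add_le (φ ψ : 𝓢(ℝ, ℂ)) : l2norm (φ + ψ) ≤ l2norm φ + l2norm ψ := by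
  have : ((φ + ψ).toLp 2 : L2) = φ.toLp 2 volume + ψ.toLp 2 volume :=
    map_add (SchwartzMap.toLpCLM ℂ ℂ 2 volume) φ ψ
  rw [l2norm, this]
  exact norm_add_le _ _

theorem l2norm_smul (c : ℂ) (ψ : 𝓢(ℝ, ℂ)) : l2norm (c • ψ) = ‖c‖ * l2norm ψ := by
  have : ((c • ψ).toLp 2 : L2) = c • ψ.toLp 2 volume :=
    map_smul (SchwartzMap.toLpCLM ℂ ℂ 2 volume) c ψ
  rw [l2norm, this, norm_smul]
  rfl

theorem l2norm_fourier (ψ : 𝓢(ℝ, ℂ)) : l2norm (𝓕 ψ) = l2norm ψ :=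
  SchwartzMap.norm_fourier_toL2_eq ψ

theorem l2norm_bessel_mono {s s' : ℝ} (h : s ≤ s') (ψ : 𝓢(ℝ, ℂ)) :
    l2norm (bessel s ψ) ≤ l2norm (bessel s' ψ) := by
  rw [← l2norm_fourier, ← l2norm_fourier (bessel s' ψ)]
  refine l2norm_mono fun t => ?_
  rw [fourier_bessel, fourier_bessel, norm_mul, norm_mul]
  gcongr
  simp only [besselSymbol, Complex.norm_real, Real.norm_eq_abs]
  have ht : 1 ≤ 1 + |t| ^ 2 := by nlinarith [sq_nonneg |t|]
  rw [abs_of_nonneg (Real.rpow_nonneg (by positivity) _),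
    abs_of_nonneg (Real.rpow_nonneg (by positivity) _)]
  exact Real.rpow_le_rpow_of_exponent_le ht (by linarith)

/-- The derivative on Schwartz functions. -/
abbrev dS : 𝓢(ℝ, ℂ) →L[ℂ] 𝓢(ℝ, ℂ) := SchwartzMap.derivCLM ℂ ℂ

theorem lineDeriv_one_eq (ψ : 𝓢(ℝ, ℂ)) : ∂_{(1 : ℝ)} ψ = dS ψ := by
  ext t
  rw [SchwartzMap.lineDerivOp_apply_eq_fderiv, SchwartzMap.derivCLM_apply]
  simp

theorem dS_eq (ψ : 𝓢(ℝ, ℂ)) : dS ψ = (2 * Real.pi * Complex.I) •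
    SchwartzMap.fourierMultiplierCLM ℂ (fun x : ℝ => (x : ℂ)) ψ := by
  rw [← lineDeriv_one_eq, SchwartzMap.lineDeriv_eq_fourierMultiplierCLM]
  congr 1
  have := SchwartzMap.fourierMultiplierCLM_ofReal ℂ (g := fun x : ℝ => inner ℝ x 1) (F := ℂ)
    (by fun_prop) ψ
  rw [← this]
  congr 1
  ext x
  simp

theorem dS_bessel (s : ℝ) (ψ : 𝓢(ℝ, ℂ)) : dS (bessel s ψ) = bessel s (dS ψ) := by
  have hx : (fun x : ℝ => (x : ℂ)).HasTemperateGrowth := by fun_prop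
  rw [dS_eq, dS_eq, map_smul, bessel,
    SchwartzMap.fourierMultiplierCLM_fourierMultiplierCLM_apply hx
      (hasTemperateGrowth_besselSymbol s),
    SchwartzMap.fourierMultiplierCLM_fourierMultiplierCLM_apply
      (hasTemperateGrowth_besselSymbol s) hx, mul_comm (besselSymbol s)]

theorem fourier_dS (ψ : 𝓢(ℝ, ℂ)) (x : ℝ) :
    𝓕 (dS ψ) x = 2 * Real.pi * Complex.I * x * 𝓕 ψ x := by
  have hx : (fun x : ℝ => (x : ℂ)).HasTemperateGrowth := by fun_prop
  rw [dS_eq, FourierTransform.fourier_smul, SchwartzMap.fourierMultiplierCLM_apply,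
    FourierTransform.fourier_fourierInv_eq]
  simp only [_root_.smul_apply, SchwartzMap.smulLeftCLM_apply_apply hx, smul_eq_mul]
  ring

theorem l2norm_dS_le (ψ : 𝓢(ℝ, ℂ)) : l2norm (dS ψ) ≤ 2 * Real.pi * l2norm (bessel 1 ψ) := by
  have hpi := Real.pi_pos
  have h : l2norm (((2 * Real.pi : ℝ) : ℂ) • 𝓕 (bessel 1 ψ)) = 2 * Real.pi * l2norm (bessel 1 ψ) := by
    rw [l2norm_smul, l2norm_fourier, Complex.norm_real, Real.norm_of_nonneg (by positivity)]
  rw [← l2norm_fourier, ← h]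
  refine l2norm_mono fun t => ?_
  rw [fourier_dS, _root_.smul_apply, fourier_bessel, smul_eq_mul]
  have e : ‖(t : ℂ)‖ ≤ ‖besselSymbol 1 t‖ := by
    simp only [besselSymbol, Complex.norm_real, Real.norm_eq_abs]
    rw [← Real.sqrt_eq_rpow, abs_of_nonneg (Real.sqrt_nonneg _)]
    exact Real.le_sqrt_of_sq_le (by linarith)
  simp only [norm_mul, Complex.norm_I, mul_one, Complex.norm_ofNat, Complex.norm_real]
  rw [Real.norm_of_nonneg hpi.le]
  rw [mul_assoc]
  simp only [Complex.norm_real] at e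
  rw [Real.norm_of_nonneg zero_le_two]
  have := mul_le_mul_of_nonneg_right e (norm_nonneg (𝓕 ψ t))
  nlinarith [Real.two_pi_pos]

theorem l2norm_iterate_dS_le (j : ℕ) (ψ : 𝓢(ℝ, ℂ)) :
    l2norm (dS^[j] ψ) ≤ (2 * Real.pi) ^ j * l2norm (bessel j ψ) := by
  induction j generalizing ψ with
  | zero => simp [bessel_zero]
  | succ j ih =>
    rw [Function.iterate_succ_apply]
    refine (ih _).trans ?_
    rw [← dS_bessel, pow_succ, mul_assoc]
    have := l2norm_dS_le (bessel j ψ)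
    rw [bessel_bessel] at this
    push_cast
    rw [add_comm (j : ℝ)]
    gcongr

/-- In this normalization of the Fourier transform the derivative has symbol `2πix`, which explains
the factor `(2π)⁻²`. -/
theorem bessel_two (ψ : 𝓢(ℝ, ℂ)) :
    bessel 2 ψ = ψ + (((2 * Real.pi) ^ 2 : ℝ) : ℂ)⁻¹ • (- (dS (dS ψ))) := by
  have h : 𝓕 (bessel 2 ψ) = 𝓕 (ψ + (((2 * Real.pi) ^ 2 : ℝ) : ℂ)⁻¹ • (- (dS (dS ψ)))) := by
    ext x
    rw [fourier_bessel, FourierTransform.fourier_add, FourierTransform.fourier_smul,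
      FourierTransform.fourier_neg]
    simp only [_root_.add_apply, _root_.smul_apply, _root_.neg_apply, fourier_dS]
    have hpi : (Real.pi : ℂ) ≠ 0 := Complex.ofReal_ne_zero.2 Real.pi_ne_zero
    simp only [besselSymbol]
    norm_num
    field_simp
    ring_nf
    simp
  have := congrArg (fun φ => (𝓕⁻ φ : 𝓢(ℝ, ℂ))) h
  simpa only [FourierTransform.fourierInv_fourier_eq] using this

/-- For even order `⟨D⟩^{2m}` is a differential operator, obtained by iterating `bessel_two`. -/
theorem exists_l2norm_bessel_nat_le (m : ℕ) : ∃ C : ℝ, 0 ≤ C ∧ ∀ ψ : 𝓢(ℝ, ℂ),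
    l2norm (bessel (2 * m) ψ) ≤ C * ∑ j ∈ Finset.range (2 * m + 1), l2norm (dS^[j] ψ) := by
  induction m with
  | zero => exact ⟨1, zero_le_one, fun ψ => by simp [bessel_zero]⟩
  | succ m ih =>
    obtain ⟨C, hC, h⟩ := ih
    set c : ℝ := ‖(((2 * Real.pi) ^ 2 : ℝ) : ℂ)⁻¹‖ with hc
    refine ⟨C * (1 + c), by positivity, fun ψ => ?_⟩
    have e : bessel (2 * (m + 1 : ℕ)) ψ = bessel (2 * m) ψ +
        (((2 * Real.pi) ^ 2 : ℝ) : ℂ)⁻¹ • ((-1 : ℂ) • bessel (2 * m) (dS (dS ψ))) := by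
      have : (2 * (m + 1 : ℕ) : ℝ) = 2 * m + 2 := by push_cast; ring
      rw [this, ← bessel_bessel, bessel_two, map_add, map_smul, map_neg, neg_one_smul]
    have hS (k : ℕ) (hk : k ≤ 2) :
        ∑ j ∈ Finset.range (2 * m + 1), l2norm (dS^[j] (dS^[k] ψ)) ≤
        ∑ j ∈ Finset.range (2 * (m + 1) + 1), l2norm (dS^[j] ψ) := by
      simp_rw [← Function.iterate_add_apply]
      rw [← Finset.sum_image (s := Finset.range (2 * m + 1)) (g := fun j => j + k)
        (f := fun j => l2norm (dS^[j] ψ)) (by intro a _ b _ h; simpa using h)]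
      refine Finset.sum_le_sum_of_subset_of_nonneg ?_ fun _ _ _ => l2norm_nonneg _
      intro i hi
      simp only [Finset.mem_image, Finset.mem_range] at hi ⊢
      omega
    rw [e]
    refine (l2norm_add_le _ _).trans ?_
    rw [l2norm_smul, l2norm_smul, ← hc, norm_neg, norm_one, one_mul]
    have h1 := (h ψ).trans (mul_le_mul_of_nonneg_left (hS 0 (by norm_num)) hC)
    have h2 := (h (dS (dS ψ))).trans (mul_le_mul_of_nonneg_left (hS 2 le_rfl) hC)
    have hc0 : 0 ≤ c := norm_nonneg _
    nlinarith [mul_le_mul_of_nonneg_left h2 hc0]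

/-- Sobolev norms of real order are traded for `L²`-norms of derivatives, since the latter can be
computed explicitly under substitutions and multiplication by cut-offs. The loss of order is
harmless: the target only has to be reached from some sufficiently regular space. -/
theorem exists_l2norm_bessel_le (s : ℝ) : ∃ (K : ℕ) (C : ℝ), 0 ≤ C ∧ ∀ ψ : 𝓢(ℝ, ℂ),
    l2norm (bessel s ψ) ≤ C * ∑ j ∈ Finset.range K, l2norm (dS^[j] ψ) := by
  obtain ⟨m, hm⟩ := exists_nat_ge s
  obtain ⟨C, hC, h⟩ := exists_l2norm_bessel_nat_le m
  refine ⟨_, C, hC, fun ψ => (l2norm_bessel_mono ?_ ψ).trans (h ψ)⟩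
  have : (0 : ℝ) ≤ m := Nat.cast_nonneg m
  linarith

theorem l2norm_iterate_dS_bessel_neg_le {j k : ℕ} (h : j ≤ k) (f : 𝓢(ℝ, ℂ)) :
    l2norm (dS^[j] (bessel (-k) f)) ≤ (2 * Real.pi) ^ j * l2norm f := by
  refine (l2norm_iterate_dS_le j _).trans ?_
  rw [bessel_bessel]
  gcongr
  have : l2norm f = l2norm (bessel 0 f) := by rw [bessel_zero]
  rw [this]
  refine l2norm_bessel_mono ?_ f
  have : (j : ℝ) ≤ k := by exact_mod_cast h
  linarith

/-! ### Weighted norms on the half-line -/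

/-- Real-valued `L²`-norm of a function with respect to a measure. -/
def normTwo (μ : Measure ℝ) (f : ℝ → ℂ) : ℝ := (eLpNorm f 2 μ).toReal

theorem normTwo_nonneg (μ : Measure ℝ) (f : ℝ → ℂ) : 0 ≤ normTwo μ f := ENNReal.toReal_nonneg

/-- Square integrability of the `G i` cannot be dropped, because `normTwo` assigns the value `0` to
an infinite norm. -/
theorem normTwo_le_sum {μ : Measure ℝ} {ι : Type*} (s : Finset ι) {F : ℝ → ℂ} {G : ι → ℝ → ℂ}
    {C : ℝ} (hC : 0 ≤ C) (hG : ∀ i ∈ s, MemLp (G i) 2 μ)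
    (h : ∀ᵐ t ∂μ, ‖F t‖ ≤ C * ∑ i ∈ s, ‖G i t‖) :
    normTwo μ F ≤ C * ∑ i ∈ s, normTwo μ (G i) := by
  have h1 : eLpNorm F 2 μ ≤ ENNReal.ofReal C * eLpNorm (∑ i ∈ s, fun t => ‖G i t‖) 2 μ := by
    refine eLpNorm_le_mul_eLpNorm_of_ae_le_mul ?_ 2
    filter_upwards [h] with t ht
    rw [Finset.sum_apply, Real.norm_of_nonneg (Finset.sum_nonneg fun _ _ => norm_nonneg _)]
    exact ht
  have h2 : eLpNorm (∑ i ∈ s, fun t => ‖G i t‖) 2 μ ≤ ∑ i ∈ s, eLpNorm (G i) 2 μ := by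
    refine (eLpNorm_sum_le (fun i hi => (hG i hi).1.norm) (by norm_num)).trans ?_
    simp_rw [eLpNorm_norm]
    exact le_rfl
  have hfin : ∀ i ∈ s, eLpNorm (G i) 2 μ ≠ ⊤ := fun i hi => (hG i hi).2.ne
  unfold normTwo
  rw [← ENNReal.toReal_sum hfin, ← ENNReal.toReal_ofReal hC, ← ENNReal.toReal_mul]
  refine ENNReal.toReal_mono (ENNReal.mul_ne_top ENNReal.ofReal_ne_top ?_) (h1.trans ?_)
  · exact (ENNReal.sum_lt_top.2 fun i hi => (hfin i hi).lt_top).ne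
  · gcongr

theorem normTwo_le_mul {μ : Measure ℝ} {F G : ℝ → ℂ} {C : ℝ} (hC : 0 ≤ C) (hG : MemLp G 2 μ)
    (h : ∀ᵐ t ∂μ, ‖F t‖ ≤ C * ‖G t‖) : normTwo μ F ≤ C * normTwo μ G := by
  have := normTwo_le_sum (μ := μ) {()} (G := fun _ => G) hC (fun _ _ => hG) (by simpa using h)
  simpa using this

/-- Lebesgue measure on `(0, ∞)`. -/
abbrev halfMeasure : Measure ℝ := volume.restrict (Set.Ioi 0)

theorem ae_half {p : ℝ → Prop} (h : ∀ t, 0 < t → p t) : ∀ᵐ t ∂halfMeasure, p t :=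
  (ae_restrict_iff' measurableSet_Ioi).2 (Filter.Eventually.of_forall h)

/-- `(1 + t²)^K t^j ψ^{(j)}(t)`. -/
def moment (K j : ℕ) (ψ : 𝓢(ℝ, ℂ)) (t : ℝ) : ℂ :=
  (((1 + t ^ 2) ^ K * t ^ j : ℝ) : ℂ) * (dS^[j] ψ) t

theorem hasTemperateGrowth_momentWeight (K j : ℕ) :
    (fun t : ℝ => (((1 + t ^ 2) ^ K * t ^ j : ℝ) : ℂ)).HasTemperateGrowth := by
  push_cast
  fun_prop

theorem memLp_moment (K j : ℕ) (ψ : 𝓢(ℝ, ℂ)) : MemLp (moment K j ψ) 2 volume := by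
  have := (SchwartzMap.smulLeftCLM ℂ (fun t : ℝ => (((1 + t ^ 2) ^ K * t ^ j : ℝ) : ℂ))
    (dS^[j] ψ)).memLp 2 volume
  refine (memLp_congr_ae (Filter.Eventually.of_forall fun t => ?_)).1 this
  rw [SchwartzMap.smulLeftCLM_apply_apply (hasTemperateGrowth_momentWeight K j)]
  rfl

theorem memLp_moment_half (K j : ℕ) (ψ : 𝓢(ℝ, ℂ)) : MemLp (moment K j ψ) 2 halfMeasure :=
  (memLp_moment K j ψ).restrict _

/-- The norm `∑_{j ≤ K} ‖(1 + t²)^K t^j ψ^{(j)}‖` in `L²(ℝ₊)`, which behaves well under dilations. -/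
def conormal (K : ℕ) (ψ : 𝓢(ℝ, ℂ)) : ℝ :=
  ∑ j ∈ Finset.range (K + 1), normTwo halfMeasure (moment K j ψ)

theorem norm_moment (K j : ℕ) (ψ : 𝓢(ℝ, ℂ)) (t : ℝ) :
    ‖moment K j ψ t‖ = (1 + t ^ 2) ^ K * |t| ^ j * ‖(dS^[j] ψ) t‖ := by
  rw [moment, norm_mul, Complex.norm_real, Real.norm_eq_abs, abs_mul, abs_pow, abs_pow,
    abs_of_pos (by positivity : 0 < 1 + t ^ 2)]

theorem conormal_mono {K K' : ℕ} (h : K ≤ K') (ψ : 𝓢(ℝ, ℂ)) : conormal K ψ ≤ conormal K' ψ := by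
  unfold conormal
  refine (Finset.sum_le_sum (g := fun j => normTwo halfMeasure (moment K' j ψ))
    fun j _ => ?_).trans ?_
  · have := normTwo_le_mul (μ := halfMeasure) zero_le_one (memLp_moment_half K' j ψ)
      (F := moment K j ψ) (ae_half fun t _ => ?_)
    · simpa using this
    rw [one_mul, norm_moment, norm_moment]
    gcongr
    nlinarith [sq_nonneg t]
  · exact Finset.sum_le_sum_of_subset_of_nonneg (Finset.range_mono (by omega))
      fun _ _ _ => normTwo_nonneg _ _

/-- Functionals that are bounded by some `conormal` norm. -/
def Controlled (p : 𝓢(ℝ, ℂ) → ℝ) : Prop :=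
  ∃ (K : ℕ) (C : ℝ), 0 ≤ C ∧ ∀ ψ, p ψ ≤ C * conormal K ψ

theorem Controlled.mono {p q : 𝓢(ℝ, ℂ) → ℝ} (hq : Controlled q) (h : ∀ ψ, p ψ ≤ q ψ) :
    Controlled p := by
  obtain ⟨K, C, hC, hq⟩ := hq
  exact ⟨K, C, hC, fun ψ => (h ψ).trans (hq ψ)⟩

theorem Controlled.add {p q : 𝓢(ℝ, ℂ) → ℝ} (hp : Controlled p) (hq : Controlled q) :
    Controlled fun ψ => p ψ + q ψ := by
  obtain ⟨K, C, hC, hp⟩ := hp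
  obtain ⟨K', C', hC', hq⟩ := hq
  refine ⟨max K K', C + C', by positivity, fun ψ => ?_⟩
  have h1 := conormal_mono (le_max_left K K') ψ
  have h2 := conormal_mono (le_max_right K K') ψ
  have h3 := hp ψ
  have h4 := hq ψ
  rw [add_mul]
  exact add_le_add (h3.trans (by gcongr)) (h4.trans (by gcongr))

theorem Controlled.const_mul {p : 𝓢(ℝ, ℂ) → ℝ} (hp : Controlled p) {c : ℝ} (hc : 0 ≤ c) :
    Controlled fun ψ => c * p ψ := by
  obtain ⟨K, C, hC, hp⟩ := hp
  refine ⟨K, c * C, by positivity, fun ψ => ?_⟩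
  rw [mul_assoc]
  exact mul_le_mul_of_nonneg_left (hp ψ) hc

theorem controlled_zero : Controlled fun _ => 0 :=
  ⟨0, 0, le_rfl, fun ψ => by simp⟩

theorem Controlled.sum {ι : Type*} (s : Finset ι) {p : ι → 𝓢(ℝ, ℂ) → ℝ}
    (hp : ∀ i ∈ s, Controlled (p i)) : Controlled fun ψ => ∑ i ∈ s, p i ψ := by
  classical
  induction s using Finset.induction_on with
  | empty => simpa using controlled_zero
  | insert a s ha ih =>
    simp only [Finset.sum_insert ha]
    exact (hp a (by simp)).add (ih fun i hi => hp i (by simp [hi]))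

theorem controlled_weighted (j K : ℕ) {b : ℝ → ℝ} {C : ℝ} (hC : 0 ≤ C)
    (hb : ∀ t, 0 < t → |b t| ≤ C * ((1 + t ^ 2) ^ K * t ^ j)) :
    Controlled fun ψ => normTwo halfMeasure fun t => (b t : ℂ) * (dS^[j] ψ) t := by
  -- The index has to be at least `j` for the `j`-th moment to occur in the sum, and at least `K`
  -- for its weight to dominate.
  refine ⟨K + j, C, hC, fun ψ => ?_⟩
  have h1 : normTwo halfMeasure (fun t => (b t : ℂ) * (dS^[j] ψ) t) ≤
      C * normTwo halfMeasure (moment (K + j) j ψ) := by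
    refine normTwo_le_mul hC (memLp_moment_half _ _ ψ) (ae_half fun t ht => ?_)
    rw [norm_moment, norm_mul, Complex.norm_real, Real.norm_eq_abs, abs_of_pos ht, ← mul_assoc]
    refine mul_le_mul_of_nonneg_right ((hb t ht).trans ?_) (norm_nonneg _)
    have h3 : (1 + t ^ 2) ^ K ≤ (1 + t ^ 2) ^ (K + j) :=
      pow_le_pow_right₀ (by nlinarith) (by omega)
    gcongr
  refine h1.trans (mul_le_mul_of_nonneg_left ?_ hC)
  exact Finset.single_le_sum (f := fun i => normTwo halfMeasure (moment (K + j) i ψ))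
    (fun _ _ => normTwo_nonneg _ _) (by simp)

/-! ### The substitution `t = e^{-r}` -/

/-- Smooth functions vanishing for large `t`. -/
def IsNear (b : ℝ → ℝ) : Prop := ContDiff ℝ ∞ b ∧ ∃ R : ℝ, ∀ t, R ≤ t → b t = 0

theorem IsNear.id_mul {b : ℝ → ℝ} (hb : IsNear b) : IsNear fun t => t * b t := by
  obtain ⟨h, R, hR⟩ := hb
  exact ⟨contDiff_id.mul h, R, fun t ht => by simp [hR t ht]⟩

theorem IsNear.const_mul {b : ℝ → ℝ} (hb : IsNear b) (c : ℝ) : IsNear fun t => c * b t := by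
  obtain ⟨h, R, hR⟩ := hb
  exact ⟨contDiff_const.mul h, R, fun t ht => by simp [hR t ht]⟩

theorem IsNear.add {b b' : ℝ → ℝ} (hb : IsNear b) (hb' : IsNear b') :
    IsNear fun t => b t + b' t := by
  obtain ⟨h, R, hR⟩ := hb
  obtain ⟨h', R', hR'⟩ := hb'
  exact ⟨h.add h', max R R', fun t ht => by
    simp [hR t (le_of_max_le_left ht), hR' t (le_of_max_le_right ht)]⟩

theorem IsNear.deriv {b : ℝ → ℝ} (hb : IsNear b) : IsNear (deriv b) := by
  obtain ⟨h, R, hR⟩ := hb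
  refine ⟨(contDiff_infty_iff_deriv.1 h).2, R + 1, fun t ht => ?_⟩
  have : b =ᶠ[nhds t] fun _ => 0 := by
    filter_upwards [lt_mem_nhds (show R < t by linarith)] with r hr using hR r hr.le
  rw [this.deriv_eq, deriv_const]

/-- The derivative of `e^{-r/2} b(e^{-r})` is `-e^{-r/2} (eulerShift b)(e^{-r})`. -/
def eulerShift (b : ℝ → ℝ) (t : ℝ) : ℝ := 2⁻¹ * b t + t * deriv b t

theorem IsNear.eulerShift {b : ℝ → ℝ} (hb : IsNear b) : IsNear (eulerShift b) :=
  (hb.const_mul _).add hb.deriv.id_mul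

theorem IsNear.exists_bound {b : ℝ → ℝ} (hb : IsNear b) : ∃ C : ℝ, 0 ≤ C ∧ ∀ t, 0 < t → |b t| ≤ C := by
  obtain ⟨h, R, hR⟩ := hb
  obtain ⟨C, hC⟩ := (isCompact_Icc (a := (0 : ℝ)) (b := R)).exists_bound_of_continuousOn
    h.continuous.continuousOn
  refine ⟨max C 0, le_max_right _ _, fun t ht => ?_⟩
  by_cases htR : t ≤ R
  · exact (hC t ⟨ht.le, htR⟩).trans (le_max_left _ _)
  · rw [hR t (not_le.1 htR).le, abs_zero]
    exact le_max_right _ _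

/-- `e^{-r/2} b(e^{-r}) ψ(e^{-r})`. -/
def nearFun (b : ℝ → ℝ) (ψ : 𝓢(ℝ, ℂ)) (r : ℝ) : ℂ :=
  ((Real.exp (-r / 2) * b (Real.exp (-r)) : ℝ) : ℂ) * ψ (Real.exp (-r))

/-- Under `t = e^{-r}` the derivative in `r` becomes `-t ∂_t`, and the factor `e^{-r/2}` contributes
the `1/2` in `eulerShift`. Both terms are again of the form `nearFun`, so inductions on the order of
differentiation close once `b` and `ψ` are allowed to vary. -/
theorem hasDerivAt_nearFun {b : ℝ → ℝ} (hb : IsNear b) (ψ : 𝓢(ℝ, ℂ)) (r : ℝ) :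
    HasDerivAt (nearFun b ψ)
      (-(nearFun (eulerShift b) ψ r + nearFun (fun t => t * b t) (dS ψ) r)) r := by
  have he : HasDerivAt (fun r : ℝ => Real.exp (-r)) (-Real.exp (-r)) r := by
    simpa using (hasDerivAt_neg r).exp
  have he2 : HasDerivAt (fun r : ℝ => Real.exp (-r / 2)) (-(2⁻¹) * Real.exp (-r / 2)) r := by
    have : HasDerivAt (fun r : ℝ => -r / 2) (-1 / 2) r := (hasDerivAt_neg r).div_const 2
    convert this.exp using 1
    ring
  have hb1 : HasDerivAt b (deriv b (Real.exp (-r))) (Real.exp (-r)) :=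
    (hb.1.differentiable (by simp) _).hasDerivAt
  have h1 := (he2.mul (hb1.comp r he)).ofReal_comp
  have h2 := (ψ.hasDerivAt (Real.exp (-r))).scomp r he
  refine HasDerivAt.congr_deriv (f := nearFun b ψ) (h1.mul h2) ?_
  simp only [nearFun, eulerShift, SchwartzMap.derivCLM_apply, Function.comp, Complex.real_smul,
    Pi.mul_apply]
  push_cast
  ring

theorem deriv_nearFun {b : ℝ → ℝ} (hb : IsNear b) (ψ : 𝓢(ℝ, ℂ)) :
    deriv (nearFun b ψ) =
      -(nearFun (eulerShift b) ψ + nearFun (fun t => t * b t) (dS ψ)) := by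
  ext r
  exact (hasDerivAt_nearFun hb ψ r).deriv

theorem contDiff_nearFun {b : ℝ → ℝ} (hb : IsNear b) (ψ : 𝓢(ℝ, ℂ)) :
    ContDiff ℝ ∞ (nearFun b ψ) := by
  have he : ContDiff ℝ ∞ (fun r : ℝ => Real.exp (-r)) := contDiff_neg.exp
  have he2 : ContDiff ℝ ∞ (fun r : ℝ => Real.exp (-r / 2)) := (contDiff_neg.div_const 2).exp
  exact (Complex.ofRealCLM.contDiff.comp (he2.mul (hb.1.comp he))).mul ((ψ.smooth ⊤).comp he)

/-- For `r → ∞` the factor `e^{-r/2}` beats every power of `r`; for `r → -∞` the function vanishes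
as soon as `e^{-r} ≥ R`. For the remaining negative `r` one has `e^{|r|/2} e^{-r/2} = e^{-r} < R`.
-/
theorem nearFun_bound {b : ℝ → ℝ} (hb : IsNear b) (ψ : 𝓢(ℝ, ℂ)) (k : ℕ) :
    ∃ C : ℝ, ∀ r, ‖r‖ ^ k * ‖nearFun b ψ r‖ ≤ C := by
  obtain ⟨B, hB0, hB⟩ := hb.exists_bound
  obtain ⟨-, R, hR⟩ := hb
  obtain ⟨S, hS⟩ : ∃ S, ∀ t, ‖ψ t‖ ≤ S :=
    ⟨_, fun t => SchwartzMap.norm_le_seminorm ℂ ψ t⟩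
  have hS0 : 0 ≤ S := (norm_nonneg _).trans (hS 0)
  have hm : (0 : ℝ) < max 1 R := lt_max_of_lt_left one_pos
  refine ⟨2 ^ k * k.factorial * max 1 R * B * S, fun r => ?_⟩
  by_cases hr : R ≤ Real.exp (-r)
  · simp only [nearFun, hR _ hr, mul_zero, Complex.ofReal_zero, zero_mul, norm_zero]
    positivity
  · have h1 : |r| ^ k ≤ 2 ^ k * k.factorial * Real.exp (|r| / 2) := by
      have := Real.pow_div_factorial_le_exp (|r| / 2) (by positivity) k
      rw [div_le_iff₀ (by positivity), div_pow, div_le_iff₀ (by positivity)] at this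
      linarith
    have h2 : Real.exp (|r| / 2) * Real.exp (-r / 2) ≤ max 1 R := by
      rw [← Real.exp_add]
      rcases le_total 0 r with h0 | h0
      · rw [abs_of_nonneg h0]
        ring_nf
        simp
      · rw [abs_of_nonpos h0]
        refine le_trans ?_ (le_max_right _ _)
        refine le_trans (le_of_eq ?_) (not_le.1 hr).le
        ring_nf
    rw [nearFun, norm_mul, Complex.norm_real, norm_mul, Real.norm_of_nonneg (Real.exp_pos _).le,
      Real.norm_eq_abs, Real.norm_eq_abs]
    calc |r| ^ k * (Real.exp (-r / 2) * |b (Real.exp (-r))| * ‖ψ (Real.exp (-r))‖)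
        ≤ (2 ^ k * k.factorial * Real.exp (|r| / 2)) * (Real.exp (-r / 2) * B * S) := by
          gcongr
          · exact hB _ (Real.exp_pos _)
          · exact hS _
      _ = 2 ^ k * k.factorial * (Real.exp (|r| / 2) * Real.exp (-r / 2)) * B * S := by ring
      _ ≤ _ := by gcongr

theorem nearFun_decay (n k : ℕ) {b : ℝ → ℝ} (hb : IsNear b) (ψ : 𝓢(ℝ, ℂ)) :
    ∃ C : ℝ, ∀ r, ‖r‖ ^ k * ‖iteratedDeriv n (nearFun b ψ) r‖ ≤ C := by
  induction n generalizing b ψ with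
  | zero => simpa using nearFun_bound hb ψ k
  | succ n ih =>
    obtain ⟨C₁, h₁⟩ := ih hb.eulerShift ψ
    obtain ⟨C₂, h₂⟩ := ih hb.id_mul (dS ψ)
    refine ⟨C₁ + C₂, fun r => ?_⟩
    rw [iteratedDeriv_succ', deriv_nearFun hb, iteratedDeriv_neg, norm_neg]
    have e := iteratedDeriv_add (n := n) (x := r)
      ((contDiff_nearFun hb.eulerShift ψ).of_le (by exact_mod_cast le_top)).contDiffAt
      ((contDiff_nearFun hb.id_mul (dS ψ)).of_le (by exact_mod_cast le_top)).contDiffAt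
    rw [e]
    calc _ ≤ ‖r‖ ^ k * (‖_‖ + ‖_‖) := by gcongr; exact norm_add_le _ _
      _ ≤ _ := by rw [mul_add]; exact add_le_add (h₁ r) (h₂ r)

/-- The map `ψ ↦ e^{-r/2} b(e^{-r}) ψ(e^{-r})` on Schwartz functions. -/
def near (b : ℝ → ℝ) (hb : IsNear b) : 𝓢(ℝ, ℂ) →ₗ[ℂ] 𝓢(ℝ, ℂ) where
  toFun ψ :=
    { toFun := nearFun b ψ
      smooth' := contDiff_nearFun hb ψ
      decay' := fun k n => by
        obtain ⟨C, hC⟩ := nearFun_decay n k hb ψ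
        exact ⟨C, fun r => by rw [norm_iteratedFDeriv_eq_norm_iteratedDeriv]; exact hC r⟩ }
  map_add' φ ψ := by
    ext r
    change nearFun b (φ + ψ) r = nearFun b φ r + nearFun b ψ r
    simp [nearFun, mul_add]
  map_smul' c ψ := by
    ext r
    change nearFun b (c • ψ) r = c * nearFun b ψ r
    simp only [nearFun, _root_.smul_apply, smul_eq_mul]
    ring

theorem near_apply {b : ℝ → ℝ} (hb : IsNear b) (ψ : 𝓢(ℝ, ℂ)) (r : ℝ) :
    near b hb ψ r = ((Real.exp (-r / 2) * b (Real.exp (-r)) : ℝ) : ℂ) * ψ (Real.exp (-r)) := rfl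

theorem dS_near {b : ℝ → ℝ} (hb : IsNear b) (ψ : 𝓢(ℝ, ℂ)) :
    dS (near b hb ψ) =
      -(near _ hb.eulerShift ψ + near _ hb.id_mul (dS ψ)) := by
  ext r
  rw [SchwartzMap.derivCLM_apply]
  exact congrFun (deriv_nearFun hb ψ) r

theorem image_exp_neg : (fun r : ℝ => Real.exp (-r)) '' Set.univ = Set.Ioi 0 := by
  ext t
  simp only [Set.image_univ, Set.mem_range, Set.mem_Ioi]
  refine ⟨fun ⟨r, h⟩ => h ▸ Real.exp_pos _, fun h => ⟨-Real.log t, by simp [Real.exp_log h]⟩⟩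

theorem hasDerivAt_exp_neg (r : ℝ) :
    HasDerivAt (fun r : ℝ => Real.exp (-r)) (-Real.exp (-r)) r := by
  simpa using (hasDerivAt_neg r).exp

theorem injective_exp_neg : Function.Injective fun r : ℝ => Real.exp (-r) := fun a b h => by
  simpa using h

/-- The factor `e^{-r/2}` is the square root of the Jacobian of `t = e^{-r}`. -/
theorem l2norm_near {b : ℝ → ℝ} (hb : IsNear b) (ψ : 𝓢(ℝ, ℂ)) :
    l2norm (near b hb ψ) = normTwo halfMeasure fun t => (b t : ℂ) * ψ t := by
  rw [l2norm_eq, normTwo]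
  congr 1
  rw [eLpNorm_eq_lintegral_rpow_enorm_toReal (by norm_num) (by norm_num),
    eLpNorm_eq_lintegral_rpow_enorm_toReal (by norm_num) (by norm_num)]
  congr 1
  have := lintegral_image_eq_lintegral_abs_deriv_mul (s := Set.univ) MeasurableSet.univ
    (fun r _ => (hasDerivAt_exp_neg r).hasDerivWithinAt) injective_exp_neg.injOn
    (fun t => ‖(b t : ℂ) * ψ t‖ₑ ^ (2 : ENNReal).toReal)
  rw [image_exp_neg, Measure.restrict_univ] at this
  rw [this]
  refine lintegral_congr fun r => ?_
  rw [near_apply, abs_neg, abs_of_pos (Real.exp_pos _)]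
  simp only [ENNReal.toReal_ofNat, ENNReal.rpow_ofNat]
  rw [Complex.ofReal_mul, mul_assoc, enorm_mul, mul_pow]
  congr 1
  rw [← ofReal_norm, Complex.norm_real, Real.norm_of_nonneg (Real.exp_pos _).le,
    ← ENNReal.ofReal_pow (Real.exp_pos _).le, ← Real.exp_nat_mul]
  congr 2
  push_cast
  ring

theorem near_congr {b b' : ℝ → ℝ} (h : b = b') (hb : IsNear b) (hb' : IsNear b') :
    near b hb = near b' hb' := by
  subst h
  rfl

theorem IsNear.pow_mul {b : ℝ → ℝ} (hb : IsNear b) (j : ℕ) : IsNear fun t => t ^ j * b t := by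
  obtain ⟨h, R, hR⟩ := hb
  exact ⟨(contDiff_id.pow j).mul h, R, fun t ht => by simp [hR t ht]⟩

theorem iterate_dS_neg_add (i : ℕ) (φ ψ : 𝓢(ℝ, ℂ)) :
    l2norm (dS^[i] (-(φ + ψ))) ≤ l2norm (dS^[i] φ) + l2norm (dS^[i] ψ) := by
  rw [iterate_map_neg, iterate_map_add, ← neg_one_smul ℂ, l2norm_smul]
  simpa using l2norm_add_le _ _

/-- The statement carries `t^j` together with `ψ^{(j)}` so that it reproduces itself: a derivative
in `r` either changes `b` into `eulerShift b + j b`, or falls on `ψ^{(j)}` and brings exactly the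
additional factor `t`. At the end each `ψ^{(j)}` carries the weight `t^j` present in `conormal`. -/
theorem controlled_iterate_dS_near (i j : ℕ) {b : ℝ → ℝ} (hb : IsNear b) :
    Controlled fun ψ => l2norm (dS^[i] (near _ (hb.pow_mul j) (dS^[j] ψ))) := by
  induction i generalizing b j with
  | zero =>
    obtain ⟨C, hC, h⟩ := hb.exists_bound
    refine (controlled_weighted j 0 (b := fun t => t ^ j * b t) hC fun t ht => ?_).mono
      fun ψ => ?_
    · rw [abs_mul, abs_of_pos (by positivity : 0 < t ^ j), pow_zero, one_mul, mul_comm]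
      exact mul_le_mul_of_nonneg_right (h t ht) (by positivity)
    · exact (l2norm_near _ _).le
  | succ i ih =>
    have hb' : IsNear fun t => eulerShift b t + j * b t := hb.eulerShift.add (hb.const_mul j)
    refine ((ih j hb').add (ih (j + 1) hb)).mono fun ψ => ?_
    rw [Function.iterate_succ_apply, dS_near]
    refine (iterate_dS_neg_add i _ _).trans (le_of_eq ?_)
    rw [Function.iterate_succ_apply' dS j]
    congr 4
    · refine near_congr (funext fun t => ?_) _ _
      have h1 : HasDerivAt b (deriv b t) t := (hb.1.differentiable (by simp) t).hasDerivAt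
      have h2 : deriv (fun t => t ^ j * b t) t = j * t ^ (j - 1) * b t + t ^ j * deriv b t := by
        exact ((hasDerivAt_pow j t).mul h1).deriv
      simp only [eulerShift, h2]
      rcases j with _ | j
      · simp
      · simp only [Nat.add_sub_cancel]
        push_cast
        ring
    · refine near_congr (funext fun t => ?_) _ _
      ring

theorem controlled_bessel_near (s : ℝ) {b : ℝ → ℝ} (hb : IsNear b) :
    Controlled fun ψ => l2norm (bessel s (near b hb ψ)) := by
  obtain ⟨K, C, hC, h⟩ := exists_l2norm_bessel_le s
  refine ((Controlled.sum (Finset.range K)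
    fun i _ => controlled_iterate_dS_near i 0 hb).const_mul hC).mono fun ψ => (h _).trans (le_of_eq ?_)
  have : near b hb = near _ (hb.pow_mul 0) := near_congr (by simp) _ _
  rw [this]
  rfl

/-! ### Multiplication by functions supported away from the origin -/

/-- Smooth functions of temperate growth vanishing to the left of some positive number. -/
def IsFar (b : ℝ → ℝ) : Prop := b.HasTemperateGrowth ∧ ∃ ε : ℝ, 0 < ε ∧ ∀ t, t ≤ ε → b t = 0

theorem hasTemperateGrowth_deriv {b : ℝ → ℝ} (hb : b.HasTemperateGrowth) :
    (deriv b).HasTemperateGrowth := by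
  refine ⟨(contDiff_infty_iff_deriv.1 hb.1).2, fun n => ?_⟩
  obtain ⟨k, C, h⟩ := hb.2 (n + 1)
  refine ⟨k, C, fun t => ?_⟩
  have := h t
  rwa [norm_iteratedFDeriv_eq_norm_iteratedDeriv, iteratedDeriv_succ',
    ← norm_iteratedFDeriv_eq_norm_iteratedDeriv] at this

theorem IsFar.deriv {b : ℝ → ℝ} (hb : IsFar b) : IsFar (deriv b) := by
  obtain ⟨h, ε, hε, h0⟩ := hb
  refine ⟨hasTemperateGrowth_deriv h, ε / 2, by positivity, fun t ht => ?_⟩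
  have : b =ᶠ[nhds t] fun _ => 0 := by
    filter_upwards [gt_mem_nhds (show t < ε by linarith)] with r hr using h0 r hr.le
  rw [this.deriv_eq, deriv_const]

theorem IsFar.ofReal {b : ℝ → ℝ} (hb : IsFar b) : (fun t => (b t : ℂ)).HasTemperateGrowth :=
  Function.Complex.hasTemperateGrowth_ofReal.comp hb.1

/-- Multiplication of Schwartz functions by a real function. -/
def mulS (b : ℝ → ℝ) : 𝓢(ℝ, ℂ) →L[ℂ] 𝓢(ℝ, ℂ) := SchwartzMap.smulLeftCLM ℂ fun t => (b t : ℂ)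

theorem mulS_apply {b : ℝ → ℝ} (hb : (fun t => (b t : ℂ)).HasTemperateGrowth) (ψ : 𝓢(ℝ, ℂ))
    (t : ℝ) : mulS b ψ t = (b t : ℂ) * ψ t :=
  SchwartzMap.smulLeftCLM_apply_apply hb ψ t

theorem dS_mulS {b : ℝ → ℝ} (hb : b.HasTemperateGrowth) (ψ : 𝓢(ℝ, ℂ)) :
    dS (mulS b ψ) = mulS (deriv b) ψ + mulS b (dS ψ) := by
  have h1 := Function.Complex.hasTemperateGrowth_ofReal.comp hb
  have h2 := Function.Complex.hasTemperateGrowth_ofReal.comp (hasTemperateGrowth_deriv hb)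
  ext t
  rw [SchwartzMap.derivCLM_apply, _root_.add_apply, mulS_apply h1, mulS_apply h2,
    SchwartzMap.derivCLM_apply]
  have e : (mulS b ψ : ℝ → ℂ) = fun t => (b t : ℂ) * ψ t := funext fun t => mulS_apply h1 ψ t
  rw [e]
  exact (((hb.1.differentiable (by simp) t).hasDerivAt.ofReal_comp).mul (ψ.hasDerivAt t)).deriv

/-- On the support of `b` one has `t ≥ ε`, so `1 ≤ (t/ε)^j` and the factor `t^j` demanded by
`conormal` can be inserted for free. -/
theorem IsFar.exists_bound {b : ℝ → ℝ} (hb : IsFar b) (j : ℕ) : ∃ (K : ℕ) (C : ℝ), 0 ≤ C ∧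
    ∀ t, 0 < t → |b t| ≤ C * ((1 + t ^ 2) ^ K * t ^ j) := by
  obtain ⟨h, ε, hε, h0⟩ := hb
  obtain ⟨k, C, hC⟩ := h.2 0
  simp only [norm_iteratedFDeriv_zero, Real.norm_eq_abs] at hC
  have hC0 : 0 ≤ C := by simpa using (abs_nonneg _).trans (hC 0)
  refine ⟨k, C * 2 ^ k * (ε⁻¹) ^ j, by positivity, fun t ht => ?_⟩
  rcases le_total t ε with hle | hle
  · rw [h0 t hle, abs_zero]
    positivity
  · have h1 : (1 + |t|) ^ k ≤ 2 ^ k * (1 + t ^ 2) ^ k := by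
      rw [← mul_pow]
      refine pow_le_pow_left₀ (by positivity) ?_ k
      rw [abs_of_pos ht]
      nlinarith [sq_nonneg (t - 1)]
    have h2 : 1 ≤ (ε⁻¹) ^ j * t ^ j := by
      rw [← mul_pow]
      refine one_le_pow₀ ?_
      rw [inv_mul_eq_div, one_le_div hε]
      exact hle
    calc |b t| ≤ C * (1 + |t|) ^ k := hC t
      _ ≤ C * (2 ^ k * (1 + t ^ 2) ^ k) * 1 := by rw [mul_one]; gcongr
      _ ≤ C * (2 ^ k * (1 + t ^ 2) ^ k) * ((ε⁻¹) ^ j * t ^ j) := by gcongr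
      _ = _ := by ring

theorem l2norm_mulS_far {b : ℝ → ℝ} (hb : IsFar b) (ψ : 𝓢(ℝ, ℂ)) :
    l2norm (mulS b ψ) = normTwo halfMeasure fun t => (b t : ℂ) * ψ t := by
  have e : (mulS b ψ : ℝ → ℂ) = (Set.Ioi (0 : ℝ)).indicator fun t => (b t : ℂ) * ψ t := by
    ext t
    rw [mulS_apply hb.ofReal]
    by_cases ht : t ∈ Set.Ioi (0 : ℝ)
    · rw [Set.indicator_of_mem ht]
    · obtain ⟨-, ε, hε, h0⟩ := hb
      rw [Set.indicator_of_notMem ht, h0 t (by simp at ht; linarith)]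
      simp
  rw [l2norm_eq, normTwo, e, eLpNorm_indicator_eq_eLpNorm_restrict measurableSet_Ioi]

theorem controlled_iterate_dS_far (i j : ℕ) {b : ℝ → ℝ} (hb : IsFar b) :
    Controlled fun ψ => l2norm (dS^[i] (mulS b (dS^[j] ψ))) := by
  induction i generalizing b j with
  | zero =>
    obtain ⟨K, C, hC, h⟩ := hb.exists_bound j
    exact (controlled_weighted j K hC h).mono fun ψ => (l2norm_mulS_far hb _).le
  | succ i ih =>
    refine ((ih j hb.deriv).add (ih (j + 1) hb)).mono fun ψ => ?_
    rw [Function.iterate_succ_apply, dS_mulS hb.1, iterate_map_add, Function.iterate_succ_apply' dS j]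
    exact l2norm_add_le _ _

theorem controlled_bessel_far (s : ℝ) {b : ℝ → ℝ} (hb : IsFar b) :
    Controlled fun ψ => l2norm (bessel s (mulS b ψ)) := by
  obtain ⟨K, C, hC, h⟩ := exists_l2norm_bessel_le s
  exact ((Controlled.sum (Finset.range K)
    fun i _ => controlled_iterate_dS_far i 0 hb).const_mul hC).mono fun ψ => h _

/-! ### Dilations -/

theorem dilSchwartz_apply {r : ℝ} (hr : 0 < r) (ψ : 𝓢(ℝ, ℂ)) (t : ℝ) :
    dilSchwartz r hr ψ t = ((r ^ (1 / 2 : ℝ) : ℝ) : ℂ) * ψ (r * t) := rfl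

theorem dS_dilSchwartz {r : ℝ} (hr : 0 < r) (ψ : 𝓢(ℝ, ℂ)) :
    dS (dilSchwartz r hr ψ) = (r : ℂ) • dilSchwartz r hr (dS ψ) := by
  ext t
  rw [SchwartzMap.derivCLM_apply, _root_.smul_apply, dilSchwartz_apply, SchwartzMap.derivCLM_apply]
  have e : (dilSchwartz r hr ψ : ℝ → ℂ) = fun t => ((r ^ (1 / 2 : ℝ) : ℝ) : ℂ) * ψ (r * t) := rfl
  have h1 : HasDerivAt (fun t : ℝ => r * t) r t := by simpa using (hasDerivAt_id t).const_mul r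
  have h2 := ((ψ.hasDerivAt (r * t)).scomp t h1).const_mul (((r ^ (1 / 2 : ℝ) : ℝ) : ℂ))
  rw [e]
  refine h2.deriv.trans ?_
  simp only [Complex.real_smul, smul_eq_mul]
  ring

theorem iterate_dS_dilSchwartz {r : ℝ} (hr : 0 < r) (j : ℕ) (ψ : 𝓢(ℝ, ℂ)) :
    dS^[j] (dilSchwartz r hr ψ) = (r : ℂ) ^ j • dilSchwartz r hr (dS^[j] ψ) := by
  induction j with
  | zero => simp
  | succ j ih =>
    rw [Function.iterate_succ_apply', ih, map_smul, dS_dilSchwartz, smul_smul, pow_succ,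
      Function.iterate_succ_apply' dS j]

theorem normTwo_dil {r : ℝ} (hr : 0 < r) (F : ℝ → ℂ) :
    normTwo halfMeasure (fun t => ((r ^ (1 / 2 : ℝ) : ℝ) : ℂ) * F (r * t)) =
      normTwo halfMeasure F := by
  unfold normTwo
  congr 1
  rw [eLpNorm_eq_lintegral_rpow_enorm_toReal (by norm_num) (by norm_num),
    eLpNorm_eq_lintegral_rpow_enorm_toReal (by norm_num) (by norm_num)]
  congr 1
  have him : (fun t : ℝ => r * t) '' Set.Ioi 0 = Set.Ioi 0 := by
    rw [Set.image_const_mul_Ioi_zero hr]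
  have := lintegral_image_eq_lintegral_abs_deriv_mul (s := Set.Ioi (0 : ℝ)) measurableSet_Ioi
    (f := fun t : ℝ => r * t) (f' := fun _ => r)
    (fun t _ => by simpa using ((hasDerivAt_id t).const_mul r).hasDerivWithinAt)
    (fun a _ b _ h => by simpa [hr.ne'] using h)
    (fun t => ‖F t‖ₑ ^ (2 : ENNReal).toReal)
  rw [him] at this
  rw [this]
  refine lintegral_congr fun t => ?_
  rw [abs_of_pos hr]
  simp only [ENNReal.toReal_ofNat, ENNReal.rpow_ofNat]
  rw [enorm_mul, mul_pow]
  congr 1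
  rw [← ofReal_norm, Complex.norm_real, Real.norm_of_nonneg (by positivity),
    ← ENNReal.ofReal_pow (by positivity), ← Real.rpow_natCast, ← Real.rpow_mul hr.le]
  norm_num

/-- Dilations commute with `t^j ∂_t^j` and are unitary on `L²(ℝ₊)`; only the weight is affected,
through `1 + t² ≤ max(1, r⁻²) (1 + (r t)²)`. -/
theorem conormal_dilSchwartz {r : ℝ} (hr : 0 < r) (K : ℕ) (ψ : 𝓢(ℝ, ℂ)) :
    conormal K (dilSchwartz r hr ψ) ≤ max 1 (r⁻¹ ^ 2) ^ K * conormal K ψ := by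
  unfold conormal
  rw [Finset.mul_sum]
  refine Finset.sum_le_sum fun j _ => ?_
  have hm : (1 : ℝ) ≤ max 1 (r⁻¹ ^ 2) := le_max_left _ _
  rw [← normTwo_dil hr (moment K j ψ)]
  refine normTwo_le_mul (by positivity) ?_ (ae_half fun t _ => ?_)
  · have h1 := (dilSchwartz r hr (SchwartzMap.smulLeftCLM ℂ
      (fun t : ℝ => (((1 + t ^ 2) ^ K * t ^ j : ℝ) : ℂ)) (dS^[j] ψ))).memLp 2 volume
    refine (memLp_congr_ae (Filter.Eventually.of_forall fun t => ?_)).1 (h1.restrict (Set.Ioi 0))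
    rw [dilSchwartz_apply, SchwartzMap.smulLeftCLM_apply_apply (hasTemperateGrowth_momentWeight K j)]
    rfl
  · rw [norm_moment, iterate_dS_dilSchwartz, _root_.smul_apply, dilSchwartz_apply, norm_mul,
      norm_moment, norm_smul, norm_mul, norm_pow, Complex.norm_real, Complex.norm_real,
      Real.norm_of_nonneg hr.le, abs_mul, abs_of_pos hr, mul_pow]
    have h1 : (1 + t ^ 2) ^ K ≤ max 1 (r⁻¹ ^ 2) ^ K * (1 + (r * t) ^ 2) ^ K := by
      rw [← mul_pow]
      refine pow_le_pow_left₀ (by positivity) ?_ K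
      have h2 : t ^ 2 = r⁻¹ ^ 2 * (r * t) ^ 2 := by field_simp
      have h3 : r⁻¹ ^ 2 * (r * t) ^ 2 ≤ max 1 (r⁻¹ ^ 2) * (r * t) ^ 2 := by
        gcongr
        exact le_max_right _ _
      nlinarith
    calc _ = (1 + t ^ 2) ^ K * (r ^ j * |t| ^ j * (‖r ^ (1 / 2 : ℝ)‖ * ‖(dS^[j] ψ) (r * t)‖)) := by
          ring
      _ ≤ (max 1 (r⁻¹ ^ 2) ^ K * (1 + (r * t) ^ 2) ^ K) *
          (r ^ j * |t| ^ j * (‖r ^ (1 / 2 : ℝ)‖ * ‖(dS^[j] ψ) (r * t)‖)) := by gcongr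
      _ = _ := by rw [Real.norm_eq_abs]; ring

/-- This contraction property is the source of all bounds that are uniform in the quotient
`⟨ξ,μ⟩/⟨ξ⟩ ≥ 1`. -/
theorem conormal_dilSchwartz_le {r : ℝ} (hr : 0 < r) (h1 : 1 ≤ r) (K : ℕ) (ψ : 𝓢(ℝ, ℂ)) :
    conormal K (dilSchwartz r hr ψ) ≤ conormal K ψ := by
  have := conormal_dilSchwartz hr K ψ
  rwa [max_eq_left, one_pow, one_mul] at this
  exact pow_le_one₀ (by positivity) (inv_le_one_of_one_le₀ h1)

/-! ### Japanese brackets -/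

theorem hasTemperateGrowth_japanese (δ : ℝ) : (japanese δ).HasTemperateGrowth :=
  Function.hasTemperateGrowth_one_add_norm_sq_rpow ℝ (δ / 2)

theorem hasTemperateGrowth_ofReal_japanese (δ : ℝ) :
    (fun t => (japanese δ t : ℂ)).HasTemperateGrowth :=
  Function.Complex.hasTemperateGrowth_ofReal.comp (hasTemperateGrowth_japanese δ)

theorem japanese_pos (δ t : ℝ) : 0 < japanese δ t := by unfold japanese; positivity

theorem japanese_mono {δ δ' : ℝ} (h : δ ≤ δ') (t : ℝ) : japanese δ t ≤ japanese δ' t :=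
  Real.rpow_le_rpow_of_exponent_le (by nlinarith [sq_nonneg ‖t‖]) (by linarith)

theorem japanese_add (δ δ' t : ℝ) : japanese (δ + δ') t = japanese δ t * japanese δ' t := by
  unfold japanese
  rw [← Real.rpow_add (by positivity), add_div]

theorem japanese_two_mul (K : ℕ) (t : ℝ) : japanese (2 * K) t = (1 + t ^ 2) ^ K := by
  unfold japanese
  rw [mul_div_cancel_left₀ _ two_ne_zero, Real.rpow_natCast, Real.norm_eq_abs, sq_abs]

theorem abs_pow_le_japanese (a : ℕ) (t : ℝ) : |t| ^ a ≤ japanese a t := by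
  unfold japanese
  have h : |t| ^ a = ((|t| ^ 2 : ℝ)) ^ ((a : ℝ) / 2) := by
    rw [← Real.rpow_natCast, ← Real.rpow_natCast, ← Real.rpow_mul (abs_nonneg t)]
    congr 1
    push_cast
    ring
  rw [h, Real.norm_eq_abs]
  exact Real.rpow_le_rpow (by positivity) (by linarith) (by positivity)

theorem hasDerivAt_japanese (δ t : ℝ) : HasDerivAt (japanese δ) (δ * (t * japanese (δ - 2) t)) t := by
  have h1 : HasDerivAt (fun t : ℝ => 1 + t ^ 2) (2 * t) t := by
    simpa using (hasDerivAt_pow 2 t).const_add 1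
  have h2 := h1.rpow_const (p := δ / 2) (Or.inl (by positivity))
  have e : japanese δ = fun t : ℝ => (1 + t ^ 2) ^ (δ / 2) := by
    ext t
    simp [japanese]
  rw [e]
  refine h2.congr_deriv ?_
  simp only [japanese, Real.norm_eq_abs, sq_abs]
  rw [show (δ - 2) / 2 = δ / 2 - 1 by ring]
  ring

/-- The powers `t^a` are included because `⟨t⟩^δ` has derivative `δ t ⟨t⟩^{δ-2}`; the enlarged
family is closed under differentiation and the total order `a + δ` never increases. For `a = 0` the
truncated `a - 1` is harmless, since its coefficient is `0`. -/
theorem iteratedDeriv_pow_mul_japanese_le (i a : ℕ) (δ : ℝ) : ∃ C : ℝ, 0 ≤ C ∧ ∀ t,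
    |iteratedDeriv i (fun t => t ^ a * japanese δ t) t| ≤ C * japanese (a + δ) t := by
  induction i generalizing a δ with
  | zero =>
    refine ⟨1, zero_le_one, fun t => ?_⟩
    rw [iteratedDeriv_zero, abs_mul, abs_pow, abs_of_pos (japanese_pos δ t), japanese_add, one_mul]
    exact mul_le_mul_of_nonneg_right (abs_pow_le_japanese a t) (japanese_pos δ t).le
  | succ i ih =>
    obtain ⟨C₁, h₁, H₁⟩ := ih (a - 1) δ
    obtain ⟨C₂, h₂, H₂⟩ := ih (a + 1) (δ - 2)
    refine ⟨a * C₁ + |δ| * C₂, by positivity, fun t => ?_⟩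
    have e : deriv (fun t => t ^ a * japanese δ t) =
        (fun t => (a : ℝ) * (t ^ (a - 1) * japanese δ t)) +
          fun t => δ * (t ^ (a + 1) * japanese (δ - 2) t) := by
      ext t
      refine ((hasDerivAt_pow a t).mul (hasDerivAt_japanese δ t)).deriv.trans ?_
      simp only [Pi.add_apply]
      ring
    have hc (a : ℕ) (δ : ℝ) : ContDiff ℝ i fun t : ℝ => t ^ a * japanese δ t :=
      ((contDiff_id.pow a).mul (contDiff_japanese δ)).of_le (by exact_mod_cast le_top)
    rw [iteratedDeriv_succ', e, iteratedDeriv_add (contDiff_const.mul (hc _ _)).contDiffAt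
      (contDiff_const.mul (hc _ _)).contDiffAt, iteratedDeriv_const_mul_field,
      iteratedDeriv_const_mul_field]
    refine (abs_add_le _ _).trans ?_
    rw [abs_mul, abs_mul, Nat.abs_cast, add_mul]
    have m1 : japanese ((a - 1 : ℕ) + δ) t ≤ japanese (a + δ) t := by
      refine japanese_mono ?_ t
      have : ((a - 1 : ℕ) : ℝ) ≤ a := by exact_mod_cast Nat.sub_le a 1
      linarith
    have m2 : japanese ((a + 1 : ℕ) + (δ - 2)) t ≤ japanese (a + δ) t := by
      refine japanese_mono ?_ t
      push_cast
      linarith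
    have n1 := (H₁ t).trans (mul_le_mul_of_nonneg_left m1 h₁)
    have n2 := (H₂ t).trans (mul_le_mul_of_nonneg_left m2 h₂)
    rw [mul_assoc, mul_assoc]
    gcongr

theorem iteratedDeriv_japanese_le (i : ℕ) (δ : ℝ) : ∃ C : ℝ, 0 ≤ C ∧ ∀ t,
    |iteratedDeriv i (japanese δ) t| ≤ C * japanese δ t := by
  simpa using iteratedDeriv_pow_mul_japanese_le i 0 δ

theorem iterate_dS_apply (j : ℕ) (ψ : 𝓢(ℝ, ℂ)) (t : ℝ) : (dS^[j] ψ) t = iteratedDeriv j ψ t := by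
  induction j generalizing ψ with
  | zero => simp
  | succ j ih =>
    rw [Function.iterate_succ_apply, ih, iteratedDeriv_succ']
    rfl

theorem norm_iterate_dS_mulS_le {b : ℝ → ℝ} (hb : b.HasTemperateGrowth) (j : ℕ) (ψ : 𝓢(ℝ, ℂ))
    (t : ℝ) : ‖(dS^[j] (mulS b ψ)) t‖ ≤
      ∑ i ∈ Finset.range (j + 1), (j.choose i) * |iteratedDeriv i b t| * ‖(dS^[j - i] ψ) t‖ := by
  have hb' := Function.Complex.hasTemperateGrowth_ofReal.comp hb
  have e : (mulS b ψ : ℝ → ℂ) = fun t => b t • ψ t := funext fun t => mulS_apply hb' ψ t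
  rw [iterate_dS_apply, e, ← norm_iteratedFDeriv_eq_norm_iteratedDeriv]
  refine (norm_iteratedFDeriv_smul_le (n := j) (N := ∞) hb.1 (ψ.smooth ⊤) t
    (by exact_mod_cast le_top)).trans (le_of_eq (Finset.sum_congr rfl fun i _ => ?_))
  rw [norm_iteratedFDeriv_eq_norm_iteratedDeriv, norm_iteratedFDeriv_eq_norm_iteratedDeriv,
    iterate_dS_apply, Real.norm_eq_abs]

/-- Of the weight `⟨t⟩^{-3K}`, a factor `⟨t⟩^{-2K}` cancels `(1 + t²)^K` and a factor `⟨t⟩^{-K}`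
absorbs `t^j`, `j ≤ K`; the order `-K` absorbs the at most `K` derivatives. This is the origin of
the pair `K`, `3 * K` in all later Sobolev spaces. -/
theorem exists_conormal_weighted_le (K : ℕ) : ∃ C : ℝ, 0 ≤ C ∧ ∀ f : 𝓢(ℝ, ℂ),
    conormal K (mulS (japanese (-(3 * K))) (bessel (-K) f)) ≤ C * l2norm f := by
  have key (j : ℕ) (hj : j ≤ K) : ∃ C : ℝ, 0 ≤ C ∧ ∀ g : 𝓢(ℝ, ℂ), ∀ t,
      ‖moment K j (mulS (japanese (-(3 * K))) g) t‖ ≤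
        C * ∑ i ∈ Finset.range (j + 1), ‖(dS^[j - i] g) t‖ := by
    choose B hB0 hB using fun i => iteratedDeriv_japanese_le i (-(3 * K))
    refine ⟨∑ i ∈ Finset.range (j + 1), (j.choose i) * B i,
      Finset.sum_nonneg fun i _ => mul_nonneg (Nat.cast_nonneg _) (hB0 i), fun g t => ?_⟩
    rw [norm_moment, Finset.mul_sum]
    have hw : (1 + t ^ 2) ^ K * |t| ^ j * japanese (-(3 * K)) t ≤ 1 := by
      have h1 : |t| ^ j ≤ japanese K t :=
        (abs_pow_le_japanese j t).trans (japanese_mono (by exact_mod_cast hj) t)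
      have h2 : japanese (2 * K) t * japanese K t * japanese (-(3 * K)) t = 1 := by
        rw [← japanese_add, ← japanese_add]
        ring_nf
        simp [japanese]
      rw [← japanese_two_mul, ← h2]
      have := japanese_pos (-(3 * K)) t
      have := japanese_pos (2 * K) t
      gcongr
    have h0 : 0 ≤ (1 + t ^ 2) ^ K * |t| ^ j := by positivity
    refine (mul_le_mul_of_nonneg_left (norm_iterate_dS_mulS_le (hasTemperateGrowth_japanese _) j g t)
      h0).trans ?_
    rw [Finset.mul_sum]
    refine Finset.sum_le_sum fun i hi => ?_
    calc _ ≤ (1 + t ^ 2) ^ K * |t| ^ j *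
          ((j.choose i) * (B i * japanese (-(3 * K)) t) * ‖(dS^[j - i] g) t‖) := by
          gcongr
          exact hB i t
      _ = ((j.choose i) * B i * ‖(dS^[j - i] g) t‖) *
          ((1 + t ^ 2) ^ K * |t| ^ j * japanese (-(3 * K)) t) := by ring
      _ ≤ ((j.choose i) * B i * ‖(dS^[j - i] g) t‖) * 1 := by
          have := hB0 i
          gcongr
      _ ≤ _ := by
          rw [mul_one]
          gcongr
          exact Finset.single_le_sum (f := fun i => (j.choose i : ℝ) * B i)
            (fun i _ => mul_nonneg (Nat.cast_nonneg _) (hB0 i)) hi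
  have key2 (j : ℕ) (hj : j ≤ K) : ∃ C : ℝ, 0 ≤ C ∧ ∀ f : 𝓢(ℝ, ℂ),
      normTwo halfMeasure (moment K j (mulS (japanese (-(3 * K))) (bessel (-K) f))) ≤
        C * l2norm f := by
    obtain ⟨C, hC, h⟩ := key j hj
    refine ⟨C * ∑ i ∈ Finset.range (j + 1), (2 * Real.pi) ^ (j - i),
      mul_nonneg hC (Finset.sum_nonneg fun _ _ => by positivity), fun f => ?_⟩
    refine (normTwo_le_sum (μ := halfMeasure) (Finset.range (j + 1)) hC
      (fun i _ => ((dS^[j - i] (bessel (-K) f)).memLp 2 volume).restrict _)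
      (Filter.Eventually.of_forall fun t => h _ t)).trans ?_
    rw [mul_assoc, Finset.sum_mul]
    gcongr with i hi
    refine le_trans ?_ (l2norm_iterate_dS_bessel_neg_le (by omega : j - i ≤ K) f)
    rw [l2norm_eq]
    exact ENNReal.toReal_mono (SchwartzMap.eLpNorm_lt_top _ 2 volume).ne
      (eLpNorm_mono_measure _ Measure.restrict_le_self)
  choose! C hC0 hC using key2
  refine ⟨∑ j ∈ Finset.range (K + 1), C j, Finset.sum_nonneg fun j hj => hC0 j ?_, fun f => ?_⟩
  · simpa [Nat.lt_succ_iff] using hj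
  · rw [Finset.sum_mul]
    exact Finset.sum_le_sum fun j hj => hC j (by simpa [Nat.lt_succ_iff] using hj) f

/-! ### Density of test functions on the half-line -/

theorem tendsto_normTwo_zero {μ : Measure ℝ} {F : ℕ → ℝ → ℂ} {g : ℝ → ℝ} (hg : MemLp g 2 μ)
    (hF : ∀ n, AEStronglyMeasurable (F n) μ) (hb : ∀ n, ∀ᵐ t ∂μ, ‖F n t‖ ≤ g t)
    (h0 : ∀ᵐ t ∂μ, Filter.Tendsto (fun n => F n t) Filter.atTop (nhds 0)) :
    Filter.Tendsto (fun n => normTwo μ (F n)) Filter.atTop (nhds 0) := by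
  have h1 : Filter.Tendsto (fun n => ∫⁻ t, ‖F n t‖ₑ ^ 2 ∂μ) Filter.atTop
      (nhds (∫⁻ _, 0 ∂μ)) := by
    refine tendsto_lintegral_of_dominated_convergence' (fun t => ‖g t‖ₑ ^ 2)
      (fun n => (hF n).enorm.pow_const 2) (fun n => ?_) ?_ ?_
    · filter_upwards [hb n] with t ht
      have : ‖F n t‖ₑ ≤ ‖g t‖ₑ := by
        rw [enorm_le_iff_norm_le]
        exact ht.trans (le_abs_self _)
      gcongr
    · have := (eLpNorm_lt_top_iff_lintegral_rpow_enorm_lt_top (by norm_num) (by norm_num)).1 hg.2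
      simpa using this.ne
    · filter_upwards [h0] with t ht
      have := (ENNReal.continuous_pow 2).continuousAt.tendsto.comp ht.enorm
      simpa [Function.comp_def] using this
  rw [lintegral_zero] at h1
  have h2 : Filter.Tendsto (fun n => eLpNorm (F n) 2 μ) Filter.atTop (nhds 0) := by
    have h3 := (ENNReal.continuous_rpow_const (y := (1 / 2 : ℝ))).continuousAt.tendsto.comp h1
    have e (n : ℕ) : eLpNorm (F n) 2 μ = (∫⁻ t, ‖F n t‖ₑ ^ 2 ∂μ) ^ (1 / 2 : ℝ) := by
      rw [eLpNorm_eq_lintegral_rpow_enorm_toReal (by norm_num) (by norm_num)]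
      simp
    simp_rw [e]
    simpa [Function.comp_def] using h3
  have := (ENNReal.tendsto_toReal ENNReal.zero_ne_top).comp h2
  simpa [Function.comp_def, normTwo] using this

/-! ### Scale-invariantly bounded cut-off functions exhausting the half-line. -/

theorem cutoff_of_le {t : ℝ} (h : t ≤ 1) : cutoff t = 1 :=
  Real.smoothTransition.one_of_one_le (by linarith)

theorem cutoff_of_ge {t : ℝ} (h : 2 ≤ t) : cutoff t = 0 :=
  Real.smoothTransition.zero_of_nonpos (by linarith)

theorem isNear_cutoff : IsNear cutoff := ⟨contDiff_cutoff, 2, fun _ => cutoff_of_ge⟩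

/-- Families of smooth functions on `ℝ₊` that are bounded uniformly in the scale-invariant sense. -/
def ScaleBounded {ι : Type*} (m : ι → ℝ → ℝ) : Prop :=
  (∀ n, ContDiff ℝ ∞ (m n)) ∧ ∀ i : ℕ, ∃ C : ℝ, ∀ n t, 0 < t →
    t ^ i * |iteratedDeriv i (m n) t| ≤ C

theorem IsNear.iteratedDeriv {b : ℝ → ℝ} (hb : IsNear b) (i : ℕ) : IsNear (iteratedDeriv i b) := by
  induction i with
  | zero => simpa using hb
  | succ i ih =>
    rw [iteratedDeriv_succ]
    exact ih.deriv

theorem IsNear.scaleBounded {b : ℝ → ℝ} (hb : IsNear b) {ι : Type*} {a : ι → ℝ}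
    (ha : ∀ n, 0 < a n) : ScaleBounded fun n t => b (a n * t) := by
  refine ⟨fun n => hb.1.comp (contDiff_const.mul contDiff_id), fun i => ?_⟩
  obtain ⟨C, -, h⟩ := ((hb.iteratedDeriv i).pow_mul i).exists_bound
  refine ⟨C, fun n t ht => ?_⟩
  rw [iteratedDeriv_comp_const_mul (hb.1.of_le (by exact_mod_cast le_top))]
  refine le_trans (le_of_eq ?_) (h (a n * t) (mul_pos (ha n) ht))
  have := ha n
  simp only [abs_mul, abs_pow, abs_of_pos ht, abs_of_pos (ha n)]
  ring

theorem ScaleBounded.one_sub {ι : Type*} {m : ι → ℝ → ℝ} (hm : ScaleBounded m) :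
    ScaleBounded fun n t => 1 - m n t := by
  refine ⟨fun n => contDiff_const.sub (hm.1 n), fun i => ?_⟩
  obtain ⟨C, h⟩ := hm.2 i
  rcases Nat.eq_zero_or_pos i with rfl | hi
  · refine ⟨1 + C, fun n t ht => ?_⟩
    have := h n t ht
    simp only [pow_zero, iteratedDeriv_zero, one_mul] at this ⊢
    refine (abs_sub _ _).trans ?_
    rw [abs_one]
    linarith
  · refine ⟨C, fun n t ht => ?_⟩
    rw [iteratedDeriv_const_sub hi, iteratedDeriv_neg, abs_neg]
    exact h n t ht

theorem ScaleBounded.mul {ι : Type*} {m m' : ι → ℝ → ℝ} (hm : ScaleBounded m)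
    (hm' : ScaleBounded m') : ScaleBounded fun n t => m n t * m' n t := by
  refine ⟨fun n => (hm.1 n).mul (hm'.1 n), fun i => ?_⟩
  choose C h using hm.2
  choose C' h' using hm'.2
  refine ⟨∑ l ∈ Finset.range (i + 1), (i.choose l) * C l * C' (i - l), fun n t ht => ?_⟩
  rw [← Real.norm_eq_abs, ← norm_iteratedFDeriv_eq_norm_iteratedDeriv]
  refine (mul_le_mul_of_nonneg_left (norm_iteratedFDeriv_mul_le (n := i) (N := ∞) (hm.1 n) (hm'.1 n) t
    (by exact_mod_cast le_top)) (by positivity)).trans ?_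
  rw [Finset.mul_sum]
  refine Finset.sum_le_sum fun l hl => ?_
  have hl' : i = l + (i - l) := by simp at hl; omega
  rw [norm_iteratedFDeriv_eq_norm_iteratedDeriv, norm_iteratedFDeriv_eq_norm_iteratedDeriv,
    Real.norm_eq_abs, Real.norm_eq_abs]
  have h1 := h l n t ht
  have h2 := h' (i - l) n t ht
  calc _ = (i.choose l) * (t ^ l * |iteratedDeriv l (m n) t|) *
        (t ^ (i - l) * |iteratedDeriv (i - l) (m' n) t|) := by
        rw [show t ^ i = t ^ l * t ^ (i - l) by rw [← pow_add, ← hl']]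
        ring
    _ ≤ _ := by
        have h3 : 0 ≤ t ^ l * |iteratedDeriv l (m n) t| := by positivity
        have h4 : 0 ≤ C l := h3.trans h1
        gcongr

/-- Cut-off functions exhausting `(0, ∞)`. -/
def exhaust (n : ℕ) (t : ℝ) : ℝ := (1 - cutoff ((n + 1 : ℝ) * t)) * cutoff ((n + 1 : ℝ)⁻¹ * t)

theorem scaleBounded_one_sub_exhaust : ScaleBounded fun n t => 1 - exhaust n t :=
  ((isNear_cutoff.scaleBounded (a := fun n : ℕ => (n + 1 : ℝ)) fun n => by positivity).one_sub.mul
    (isNear_cutoff.scaleBounded (a := fun n : ℕ => (n + 1 : ℝ)⁻¹) fun n => by positivity)).one_sub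

theorem contDiff_exhaust (n : ℕ) : ContDiff ℝ ∞ (exhaust n) :=
  (contDiff_const.sub (contDiff_cutoff.comp (contDiff_const.mul contDiff_id))).mul
    (contDiff_cutoff.comp (contDiff_const.mul contDiff_id))

theorem exhaust_eq_zero {n : ℕ} {t : ℝ} (h : t ∉ Set.Icc ((n + 1 : ℝ)⁻¹) (2 * (n + 1))) :
    exhaust n t = 0 := by
  have hn : (0 : ℝ) < n + 1 := by positivity
  rw [Set.mem_Icc, not_and_or, not_le, not_le] at h
  unfold exhaust
  rcases h with h | h
  · rw [cutoff_of_le, sub_self, zero_mul]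
    rw [← le_div_iff₀' hn, one_div]
    exact h.le
  · rw [cutoff_of_ge (t := (n + 1 : ℝ)⁻¹ * t), mul_zero]
    rw [inv_mul_eq_div, le_div_iff₀ hn]
    exact h.le

theorem hasTemperateGrowth_exhaust (n : ℕ) : (exhaust n).HasTemperateGrowth :=
  (HasCompactSupport.intro isCompact_Icc fun _ h => exhaust_eq_zero h).hasTemperateGrowth
    (contDiff_exhaust n)

theorem eventually_exhaust {t : ℝ} (ht : 0 < t) :
    ∀ᶠ n : ℕ in Filter.atTop, ∀ᶠ r in nhds t, exhaust n r = 1 := by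
  -- On the neighbourhood `(t/2, 2t)` the bound `n ≥ 4/t` gives `(n+1) r ≥ 2`, and `n ≥ 2t` gives
  -- `r/(n+1) ≤ 1`, so both cut-offs are constant there. A whole neighbourhood is required in order
  -- to differentiate.
  obtain ⟨N, hN⟩ := exists_nat_ge (max (4 / t) (2 * t))
  filter_upwards [Filter.eventually_ge_atTop N] with n hn
  have hn' : max (4 / t) (2 * t) ≤ n := hN.trans (by exact_mod_cast hn)
  have h1 : 4 / t ≤ n := (le_max_left _ _).trans hn'
  have h2 : 2 * t ≤ n := (le_max_right _ _).trans hn'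
  rw [div_le_iff₀ ht] at h1
  filter_upwards [Ioo_mem_nhds (show t / 2 < t by linarith) (show t < 2 * t by linarith)] with r hr
  have hn0 : (0 : ℝ) < n + 1 := by positivity
  unfold exhaust
  rw [cutoff_of_ge, cutoff_of_le, sub_zero, one_mul]
  · rw [inv_mul_eq_div, div_le_one hn0]
    linarith [hr.2]
  · nlinarith [hr.1]

theorem eventually_iteratedDeriv_exhaust {t : ℝ} (ht : 0 < t) (i : ℕ) :
    ∀ᶠ n : ℕ in Filter.atTop, iteratedDeriv i (fun t => 1 - exhaust n t) t = 0 := by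
  filter_upwards [eventually_exhaust ht] with n hn
  have : (fun t => 1 - exhaust n t) =ᶠ[nhds t] fun _ => 0 := by
    filter_upwards [hn] with r hr
    rw [hr, sub_self]
  rw [this.iteratedDeriv_eq]
  simp

/-- By the Leibniz rule `t^j` splits into `t^i`, which compensates the growth of the `i`-th
derivative of the cut-off uniformly in `n`, and `t^{j-i}`, which completes a moment of `ψ`.
Pointwise the terms are eventually zero, so dominated convergence applies. With derivatives not
weighted by powers of `t` the cut-off near `0` would not be admissible. -/
theorem tendsto_conormal_exhaust (K : ℕ) (ψ : 𝓢(ℝ, ℂ)) :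
    Filter.Tendsto (fun n => conormal K (mulS (fun t => 1 - exhaust n t) ψ)) Filter.atTop
      (nhds 0) := by
  unfold conormal
  rw [← Finset.sum_const_zero (s := Finset.range (K + 1))]
  refine tendsto_finsetSum _ fun j hj => ?_
  have hT (n : ℕ) : (fun t => 1 - exhaust n t).HasTemperateGrowth :=
    (Function.HasTemperateGrowth.const 1).sub (hasTemperateGrowth_exhaust n)
  choose C hC using scaleBounded_one_sub_exhaust.2
  have hpt (n : ℕ) (t : ℝ) (ht : 0 < t) :
      ‖moment K j (mulS (fun t => 1 - exhaust n t) ψ) t‖ ≤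
        ∑ i ∈ Finset.range (j + 1), (j.choose i) *
          (t ^ i * |iteratedDeriv i (fun t => 1 - exhaust n t) t|) * ‖moment K (j - i) ψ t‖ := by
    rw [norm_moment]
    refine (mul_le_mul_of_nonneg_left (norm_iterate_dS_mulS_le (hT n) j ψ t)
      (by positivity)).trans (le_of_eq ?_)
    rw [Finset.mul_sum]
    refine Finset.sum_congr rfl fun i hi => ?_
    have hi' : j = i + (j - i) := by simp at hi; omega
    rw [norm_moment, abs_of_pos ht, show t ^ j = t ^ i * t ^ (j - i) by rw [← pow_add, ← hi']]
    ring
  refine tendsto_normTwo_zero (g := fun t => ∑ i ∈ Finset.range (j + 1), ((j.choose i) * C i) *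
    ‖moment K (j - i) ψ t‖) ?_ (fun n => (memLp_moment_half _ _ _).1)
    (fun n => ae_half fun t ht => (hpt n t ht).trans ?_) (ae_half fun t ht => ?_)
  · refine memLp_finsetSum _ fun i _ => ?_
    exact (memLp_moment_half K (j - i) ψ).norm.const_mul _
  · refine Finset.sum_le_sum fun i _ => ?_
    have := hC i n t ht
    gcongr
  · have : ∀ᶠ n : ℕ in Filter.atTop, ∀ i ∈ Finset.range (j + 1),
        iteratedDeriv i (fun t => 1 - exhaust n t) t = 0 :=
      (Filter.eventually_all_finset _).2 fun i _ => eventually_iteratedDeriv_exhaust ht i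
    refine tendsto_const_nhds.congr' ?_
    filter_upwards [this] with n hn
    have h := hpt n t ht
    rw [Finset.sum_eq_zero fun i hi => by rw [hn i hi]; simp] at h
    exact (norm_le_zero_iff.1 h).symm

theorem toSchwartz_apply {Ω : TopologicalSpace.Opens ℝ} (φ : 𝓓(Ω, ℂ)) (t : ℝ) :
    toSchwartz φ t = φ t := rfl

/-- The product of a Schwartz function and a function of the exhausting family, as a test function. -/
def exhaustTest (n : ℕ) (ψ : 𝓢(ℝ, ℂ)) : Test :=
  mkTest (fun t => (exhaust n t : ℂ) * ψ t)
    ((Complex.ofRealCLM.contDiff.comp (contDiff_exhaust n)).mul (ψ.smooth ⊤)).contDiffOn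
    ⟨Set.Icc ((n + 1 : ℝ)⁻¹) (2 * (n + 1)), isCompact_Icc, fun t ht =>
      lt_of_lt_of_le (by positivity : (0 : ℝ) < (n + 1 : ℝ)⁻¹) ht.1,
      fun t ht => by rw [exhaust_eq_zero ht]; simp⟩

theorem mulS_one_sub_exhaust (n : ℕ) (ψ : 𝓢(ℝ, ℂ)) :
    mulS (fun t => 1 - exhaust n t) ψ = ψ - toSchwartz (exhaustTest n ψ) := by
  have hT : (fun t => 1 - exhaust n t).HasTemperateGrowth :=
    (Function.HasTemperateGrowth.const 1).sub (hasTemperateGrowth_exhaust n)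
  ext t
  rw [mulS_apply (Function.Complex.hasTemperateGrowth_ofReal.comp hT)]
  change _ = ψ t - (exhaust n t : ℂ) * ψ t
  push_cast
  ring

/-- Test functions on `ℝ₊` are dense in `𝓢(ℝ)` for the `conormal` seminorms. Thus a distribution on
`ℝ₊` has at most one controlled extension to `𝓢(ℝ)`, and identities between such extensions may be
checked on test functions. -/
theorem eq_zero_of_controlled {G : 𝓢(ℝ, ℂ) →ₗ[ℂ] ℂ} (hG : Controlled fun ψ => ‖G ψ‖)
    (h0 : ∀ φ : Test, G (toSchwartz φ) = 0) : G = 0 := by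
  obtain ⟨K, C, -, hC⟩ := hG
  ext ψ
  have h1 (n : ℕ) : ‖G ψ‖ ≤ C * conormal K (mulS (fun t => 1 - exhaust n t) ψ) := by
    refine le_trans (le_of_eq ?_) (hC _)
    simp only [mulS_one_sub_exhaust, map_sub, h0, sub_zero]
  have h2 := ge_of_tendsto' ((tendsto_conormal_exhaust K ψ).const_mul C) h1
  rw [mul_zero] at h2
  simpa using h2

theorem conormal_eq_zero {ψ : 𝓢(ℝ, ℂ)} (h : ∀ t, 0 < t → ψ t = 0) (K : ℕ) : conormal K ψ = 0 := by
  have hd (j : ℕ) (t : ℝ) (ht : 0 < t) : (dS^[j] ψ) t = 0 := by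
    rw [iterate_dS_apply]
    have : ψ =ᶠ[nhds t] fun _ => 0 := by
      filter_upwards [lt_mem_nhds ht] with r hr using h r hr
    rw [this.iteratedDeriv_eq]
    simp
  refine Finset.sum_eq_zero fun j _ => ?_
  have : moment K j ψ =ᵐ[halfMeasure] 0 :=
    ae_half fun t ht => by simp [moment, hd j t ht]
  rw [normTwo, eLpNorm_congr_ae this]
  simp

/-! ### The bilinear pairing on `L²` -/

/-- The bilinear pairing `∫ f g` on `L²(ℝ)`. -/
def pair : L2 →L[ℂ] L2 →L[ℂ] ℂ := (ContinuousLinearMap.mul ℂ ℂ).lpPairing volume 2 2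

/-- The embedding of Schwartz functions into `L²(ℝ)`. -/
abbrev toL2 : 𝓢(ℝ, ℂ) →L[ℂ] L2 := SchwartzMap.toLpCLM ℂ ℂ 2 volume

theorem pair_apply (f g : L2) : pair f g = ∫ t, f t * g t :=
  (ContinuousLinearMap.mul ℂ ℂ).lpPairing_eq_integral f g

theorem pair_toL2 (f : L2) (ψ : 𝓢(ℝ, ℂ)) : pair f (toL2 ψ) = ∫ t, f t * ψ t := by
  rw [pair_apply]
  refine integral_congr_ae ?_
  filter_upwards [ψ.coeFn_toLp 2 volume] with t ht
  rw [SchwartzMap.toLpCLM_apply, ht]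

theorem pair_toL2_toL2 (φ ψ : 𝓢(ℝ, ℂ)) : pair (toL2 φ) (toL2 ψ) = ∫ t, φ t * ψ t := by
  rw [pair_toL2]
  refine integral_congr_ae ?_
  filter_upwards [φ.coeFn_toLp 2 volume] with t ht
  rw [SchwartzMap.toLpCLM_apply, ht]

theorem denseRange_toL2 : DenseRange toL2 :=
  SchwartzMap.denseRange_toLpCLM (by norm_num)

/-- The weight and the Bessel potential are both symmetric for the bilinear pairing, so they move
onto `ψ` in reverse order. -/
theorem sobolev_apply (s δ : ℝ) (f : L2) (ψ : 𝓢(ℝ, ℂ)) :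
    sobolev s δ f ψ = pair f (toL2 (bessel (-s) (mulS (japanese (-δ)) ψ))) := by
  rw [pair_toL2]
  simp only [sobolev, ContinuousLinearMap.comp_apply, TemperedDistribution.smulLeftCLM_apply_apply,
    TemperedDistribution.besselPotential, TemperedDistribution.fourierMultiplierCLM_apply_apply,
    Lp.toTemperedDistributionCLM_apply, Lp.toTemperedDistribution_apply, smul_eq_mul]
  rw [← transpose_bessel]
  simp_rw [mul_comm (f _)]
  rfl

theorem mulS_japanese_zero (ψ : 𝓢(ℝ, ℂ)) : mulS (japanese (-0)) ψ = ψ := by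
  ext t
  rw [mulS_apply (hasTemperateGrowth_ofReal_japanese _)]
  simp [japanese]

theorem sobolev_zero_apply (s : ℝ) (f : L2) (ψ : 𝓢(ℝ, ℂ)) :
    sobolev s 0 f ψ = pair f (toL2 (bessel (-s) ψ)) := by
  rw [sobolev_apply, mulS_japanese_zero]

theorem sobolev_toL2 (s δ : ℝ) (h ψ : 𝓢(ℝ, ℂ)) :
    sobolev s δ (toL2 h) ψ = ∫ t, mulS (japanese (-δ)) (bessel (-s) h) t * ψ t := by
  rw [sobolev_apply, pair_toL2_toL2, ← integral_bessel_mul_eq]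
  congr 1
  ext t
  rw [mulS_apply (hasTemperateGrowth_ofReal_japanese _),
    mulS_apply (hasTemperateGrowth_ofReal_japanese _)]
  ring

theorem continuous_sobolev_apply (s δ : ℝ) (ψ : 𝓢(ℝ, ℂ)) :
    Continuous fun f : L2 => sobolev s δ f ψ := by
  simp_rw [sobolev_apply]
  fun_prop

theorem inner_star (f g : L2) : inner ℂ (star f) g = pair f g := by
  rw [pair_apply, L2.inner_def]
  refine integral_congr_ae ?_
  filter_upwards [Lp.coeFn_star f] with t ht
  rw [ht]
  simp [mul_comm]

theorem norm_star_L2 (f : L2) : ‖star f‖ = ‖f‖ := by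
  rw [Lp.norm_def, Lp.norm_def, eLpNorm_congr_ae (Lp.coeFn_star f), eLpNorm_star]

theorem ext_pair {f g : L2} (h : ∀ k : L2, pair f k = pair g k) : f = g := by
  have : star f = star g := ext_inner_right ℂ fun k => by rw [inner_star, inner_star, h]
  exact star_injective this

/-- The transpose for the bilinear pairing is the Hilbert space adjoint conjugated by complex
conjugation. Linearity follows from nondegeneracy of the pairing. -/
theorem exists_transpose (A : L2 →L[ℂ] L2) : ∃ B : L2 →L[ℂ] L2, ‖B‖ ≤ ‖A‖ ∧
    ∀ f g, pair (B f) g = pair f (A g) := by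
  have key (f g : L2) :
      pair (star (ContinuousLinearMap.adjoint A (star f))) g = pair f (A g) := by
    rw [← inner_star, star_star, ContinuousLinearMap.adjoint_inner_left, inner_star]
  refine ⟨LinearMap.mkContinuous
    { toFun := fun f => star (ContinuousLinearMap.adjoint A (star f))
      map_add' := fun f g => ext_pair fun k => by simp [key]
      map_smul' := fun c f => ext_pair fun k => by simp [key] } ‖A‖ fun f => ?_, ?_, key⟩
  · simp only [LinearMap.coe_mk, AddHom.coe_mk]
    rw [norm_star_L2]
    refine ((ContinuousLinearMap.adjoint A).le_opNorm _).trans ?_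
    rw [norm_star_L2, LinearIsometryEquiv.norm_map]
  · exact LinearMap.mkContinuous_norm_le _ (norm_nonneg _) _

theorem exists_extension {B : 𝓢(ℝ, ℂ) →ₗ[ℂ] 𝓢(ℝ, ℂ)} {C : ℝ} (hC : 0 ≤ C)
    (h : ∀ f, l2norm (B f) ≤ C * l2norm f) : ∃ A : L2 →L[ℂ] L2, ‖A‖ ≤ C ∧
    ∀ f, A (toL2 f) = toL2 (B f) := by
  set F : 𝓢(ℝ, ℂ) →ₗ[ℂ] L2 := toL2.toLinearMap ∘ₗ B
  have hd : DenseRange toL2.toLinearMap := denseRange_toL2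
  have hF : ∀ f, ‖F f‖ ≤ C * ‖toL2.toLinearMap f‖ := h
  refine ⟨F.extendOfNorm toL2.toLinearMap, ContinuousLinearMap.opNorm_le_bound _ hC fun f =>
    LinearMap.norm_extendOfNorm_apply_le hd C hF f, fun f => ?_⟩
  exact LinearMap.extendOfNorm_eq hd ⟨C, hF⟩ f

/-- Controlled operators are, after dilation by `r ≥ 1`, uniformly bounded from weighted Sobolev
spaces of high order to `L²`. -/
theorem exists_uniform_extension {B : 𝓢(ℝ, ℂ) →ₗ[ℂ] 𝓢(ℝ, ℂ)}
    (hB : Controlled fun ψ => l2norm (B ψ)) : ∃ K₀ : ℕ, ∀ K, K₀ ≤ K → ∃ C : ℝ, 0 ≤ C ∧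
    ∀ (r : ℝ) (hr : 0 < r), 1 ≤ r → ∃ A : L2 →L[ℂ] L2, ‖A‖ ≤ C ∧ ∀ f, A (toL2 f) =
      toL2 (B (dilSchwartz r hr (mulS (japanese (-(3 * K))) (bessel (-K) f)))) := by
  obtain ⟨K₀, C₀, hC₀, h₀⟩ := hB
  refine ⟨K₀, fun K hK => ?_⟩
  obtain ⟨C₁, hC₁, h₁⟩ := exists_conormal_weighted_le K
  refine ⟨C₀ * C₁, by positivity, fun r hr h1 => ?_⟩
  refine exists_extension (B := B ∘ₗ (dilSchwartz r hr).toLinearMap ∘ₗ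
    (mulS (japanese (-(3 * K)))).toLinearMap ∘ₗ (bessel (-K)).toLinearMap) (by positivity)
    fun f => ?_
  refine (h₀ _).trans ?_
  rw [mul_assoc]
  refine mul_le_mul_of_nonneg_left ?_ hC₀
  -- The dilation is removed by contractivity before passing to the weighted Sobolev norm, so that
  -- the constant does not depend on `r`.
  exact ((conormal_mono hK _).trans (conormal_dilSchwartz_le hr h1 K _)).trans (h₁ f)

/-! ### Transposes of dilations and of the substitution `t = e^{-r}`. -/

theorem integral_dilSchwartz {r : ℝ} (hr : 0 < r) (φ ψ : 𝓢(ℝ, ℂ)) :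
    ∫ t, φ t * dilSchwartz r⁻¹ (inv_pos.2 hr) ψ t = ∫ t, dilSchwartz r hr φ t * ψ t := by
  have h := Measure.integral_comp_mul_left
    (fun t => φ t * dilSchwartz r⁻¹ (inv_pos.2 hr) ψ t) r
  simp only [dilSchwartz_apply] at h ⊢
  have hr' : (r : ℂ) ≠ 0 := Complex.ofReal_ne_zero.2 hr.ne'
  rw [abs_of_pos (inv_pos.2 hr)] at h
  have h2 : (∫ t, φ t * (((r⁻¹ ^ (1 / 2 : ℝ) : ℝ) : ℂ) * ψ (r⁻¹ * t))) =
      r • ∫ t, φ (r * t) * (((r⁻¹ ^ (1 / 2 : ℝ) : ℝ) : ℂ) * ψ (r⁻¹ * (r * t))) := by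
    rw [h, smul_smul, mul_inv_cancel₀ hr.ne', one_smul]
  rw [h2, ← integral_smul]
  congr 1
  ext t
  have h3 : r * r⁻¹ ^ (1 / 2 : ℝ) = r ^ (1 / 2 : ℝ) := by
    rw [Real.inv_rpow hr.le, ← Real.rpow_neg hr.le]
    nth_rw 1 [← Real.rpow_one r]
    rw [← Real.rpow_add hr]
    norm_num
  rw [← h3, inv_mul_cancel_left₀ hr.ne', Complex.real_smul]
  push_cast
  ring

theorem toSchwartz_dilTest {r : ℝ} (hr : 0 < r) (φ : Test) :
    toSchwartz (dilTest r hr φ) = dilSchwartz r hr (toSchwartz φ) := rfl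

theorem toSchwartz_mulTest_apply {m : ℝ → ℝ} (hm : ContDiffOn ℝ ∞ m (Set.Ioi 0)) (φ : Test)
    (t : ℝ) : toSchwartz (mulTest m hm φ) t = (m t : ℂ) * φ t := rfl

theorem integral_near_mul {b : ℝ → ℝ} (hb : IsNear b) (φ : 𝓢(ℝ, ℂ)) (g : ℝ → ℂ) :
    ∫ r, near b hb φ r * g r =
      ∫ t in Set.Ioi 0, φ t * (((b t * t ^ (-(1 / 2 : ℝ)) : ℝ) : ℂ) * g (-Real.log t)) := by
  have := integral_image_eq_integral_abs_deriv_smul (s := Set.univ) MeasurableSet.univ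
    (fun r _ => (hasDerivAt_exp_neg r).hasDerivWithinAt) injective_exp_neg.injOn
    (fun t => φ t * (((b t * t ^ (-(1 / 2 : ℝ)) : ℝ) : ℂ) * g (-Real.log t)))
  rw [image_exp_neg, Measure.restrict_univ] at this
  rw [this]
  congr 1
  ext r
  rw [near_apply, abs_neg, abs_of_pos (Real.exp_pos _), Real.log_exp, neg_neg, Complex.real_smul,
    ← Real.exp_mul]
  have h : Real.exp (-r / 2) = Real.exp (-r) * Real.exp (-r * -(1 / 2)) := by
    rw [← Real.exp_add]
    congr 1
    ring
  rw [h]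
  push_cast
  ring

/-! ### Dilations and lifts -/

theorem dilTest_apply {r : ℝ} (hr : 0 < r) (φ : Test) (t : ℝ) :
    dilTest r hr φ t = ((r ^ (1 / 2 : ℝ) : ℝ) : ℂ) * φ (r * t) := rfl

theorem dilTest_dilTest {a b c : ℝ} (ha : 0 < a) (hb : 0 < b) (hc : 0 < c) (h : a * b = c)
    (φ : Test) : dilTest a ha (dilTest b hb φ) = dilTest c hc φ := by
  subst h
  ext t
  rw [dilTest_apply, dilTest_apply, dilTest_apply, Real.mul_rpow ha.le hb.le]
  push_cast
  rw [show b * (a * t) = a * b * t by ring]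
  ring

theorem dilTest_one (h : (0 : ℝ) < 1⁻¹) (φ : Test) : dilTest 1⁻¹ h φ = φ := by
  ext t
  rw [dilTest_apply]
  simp

theorem dilSchwartz_one (h : (0 : ℝ) < 1) (ψ : 𝓢(ℝ, ℂ)) : dilSchwartz 1 h ψ = ψ := by
  ext t
  rw [dilSchwartz_apply]
  simp

/-- The quotient of a Hilbert space by a closed subspace is isometric to the orthogonal complement,
which yields a linear extension operator from `ℝ₊` to `ℝ` of norm at most `1`. -/
theorem exists_liftPlus (s δ : ℝ) : ∃ σ : HPlus s δ →L[ℂ] L2, (∀ v, ‖σ v‖ ≤ ‖v‖) ∧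
    ∀ v φ, hPlusDist s δ v φ = sobolev s δ (σ v) (toSchwartz φ) := by
  have : CompleteSpace (hNull s δ) := (isClosed_hNull s δ).completeSpace_coe
  set e := (hNull s δ).quotientEquivOrthogonal
  let σ : (L2 ⧸ hNull s δ) →L[ℂ] L2 := (hNull s δ)ᗮ.subtypeL ∘L
    (e.toContinuousLinearEquiv : (L2 ⧸ hNull s δ) →L[ℂ] (hNull s δ)ᗮ)
  refine ⟨σ, fun v => (e.norm_map v).le, fun v φ => ?_⟩
  have hv : v = (hNull s δ).mkQ (σ v) := by
    have h := (hNull s δ).quotientEquivOrthogonal_symm_eq_mk (e v : L2) (e v).2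
    exact (e.symm_apply_apply v).symm.trans h
  conv_lhs => rw [hv]
  rfl

/-! ### From Sobolev spaces to cone Sobolev spaces -/

/-- The compatibility with dilations of a map of target spaces that is needed to pass from strongly
to weakly parameter-dependent symbols: `κ_{r'}⁻¹ J κ_r` is uniformly bounded for `0 < r' ≤ r`, or
for `0 < r' = r` in case of boldface twisting. -/
structure IsTargetTwist {E F : Type*} [NormedAddCommGroup E] [NormedSpace ℂ E] [KappaSpace E]
    [NormedAddCommGroup F] [NormedSpace ℂ F] [KappaSpace F] (k : Twist) (J : E →L[ℂ] F) :
    Prop where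
  dil : ∀ r u v, KappaSpace.dil r u v → KappaSpace.dil r (J u) (J v)
  twist : ∃ C : ℝ, 0 ≤ C ∧ ∀ r' r : ℝ, 0 < r' → r' ≤ r → (k = .bold → r' = r) → ∀ w z : E,
    KappaSpace.dil r w z → ∃ w' : F, KappaSpace.dil r' w' (J z) ∧ ‖w'‖ ≤ C * ‖w‖

/-- The compatibility with dilations of a map of source spaces that is needed to pass from strongly
to weakly parameter-dependent symbols: `κ_r⁻¹ I κ_{r'}` is uniformly bounded for `0 < r' ≤ r`, or
for `0 < r' = r` in case of boldface twisting. -/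
structure IsSourceTwist {E F : Type*} [NormedAddCommGroup E] [NormedSpace ℂ E] [KappaSpace E]
    [NormedAddCommGroup F] [NormedSpace ℂ F] [KappaSpace F] (k : Twist) (I : E →L[ℂ] F) :
    Prop where
  dil : ∀ r u v, KappaSpace.dil r u v → KappaSpace.dil r (I u) (I v)
  twist : ∃ C : ℝ, 0 ≤ C ∧ ∀ r' r : ℝ, 0 < r' → r' ≤ r → (k = .bold → r' = r) → ∀ u v : E,
    KappaSpace.dil r' u v → ∃ u' : F, KappaSpace.dil r u' (I v) ∧ ‖u'‖ ≤ C * ‖u‖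

/-- `ω(a t) ⟨t⟩^δ`. -/
def nearWeight (a δ t : ℝ) : ℝ := cutoff (a * t) * japanese δ t

/-- `(1 - ω(a t)) ⟨t⟩^δ`. -/
def farWeight (a δ t : ℝ) : ℝ := (1 - cutoff (a * t)) * japanese δ t

theorem isNear_nearWeight {a : ℝ} (ha : 0 < a) (δ : ℝ) : IsNear (nearWeight a δ) := by
  refine ⟨(contDiff_cutoff.comp (contDiff_const.mul contDiff_id)).mul (contDiff_japanese δ), 2 / a,
    fun t ht => ?_⟩
  rw [nearWeight, cutoff_of_ge, zero_mul]
  rwa [div_le_iff₀' ha] at ht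

/-- The function `cutoff` equals `1` on the whole negative axis, so it is not compactly supported,
but its derivatives of positive order are. -/
theorem hasTemperateGrowth_cutoff : cutoff.HasTemperateGrowth := by
  have hsupp (i : ℕ) {t : ℝ} (ht : t ∉ Set.Icc (0 : ℝ) 3) : iteratedDeriv (i + 1) cutoff t = 0 := by
    rw [Set.mem_Icc, not_and_or, not_le, not_le] at ht
    rw [iteratedDeriv_succ']
    have : deriv cutoff =ᶠ[nhds t] fun _ => 0 := by
      rcases ht with ht | ht
      · have h : ∀ᶠ r in nhds t, cutoff =ᶠ[nhds r] fun _ => 1 := by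
          filter_upwards [gt_mem_nhds ht] with r hr
          filter_upwards [gt_mem_nhds hr] with x hx using cutoff_of_le (by linarith)
        filter_upwards [h] with r hr
        rw [hr.deriv_eq, deriv_const]
      · have h : ∀ᶠ r in nhds t, cutoff =ᶠ[nhds r] fun _ => 0 := by
          filter_upwards [lt_mem_nhds ht] with r hr
          filter_upwards [lt_mem_nhds hr] with x hx using cutoff_of_ge (by linarith)
        filter_upwards [h] with r hr
        rw [hr.deriv_eq, deriv_const]
    rw [this.iteratedDeriv_eq]
    simp
  refine ⟨contDiff_cutoff, fun n => ?_⟩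
  rcases n with _ | n
  · refine ⟨0, 1, fun t => ?_⟩
    simp only [norm_iteratedFDeriv_zero, pow_zero, mul_one, Real.norm_eq_abs]
    rw [cutoff, abs_of_nonneg (Real.smoothTransition.nonneg _)]
    exact Real.smoothTransition.le_one _
  · obtain ⟨C, hC⟩ := (isCompact_Icc (a := (0 : ℝ)) (b := 3)).exists_bound_of_continuousOn
      (contDiff_cutoff.continuous_iteratedDeriv (n + 1) (by exact_mod_cast le_top)).continuousOn
    refine ⟨0, C, fun t => ?_⟩
    rw [norm_iteratedFDeriv_eq_norm_iteratedDeriv, pow_zero, mul_one]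
    by_cases ht : t ∈ Set.Icc (0 : ℝ) 3
    · exact hC t ht
    · rw [hsupp n ht, norm_zero]
      exact (norm_nonneg _).trans (hC 0 (by simp))

theorem isFar_farWeight {a : ℝ} (ha : 0 < a) (δ : ℝ) : IsFar (farWeight a δ) := by
  have h1 : (fun t : ℝ => cutoff (a * t)).HasTemperateGrowth :=
    hasTemperateGrowth_cutoff.comp ((Function.HasTemperateGrowth.const a).mul .id)
  refine ⟨((Function.HasTemperateGrowth.const 1).sub h1).mul (hasTemperateGrowth_japanese δ),
    1 / a, by positivity, fun t ht => ?_⟩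
  rw [farWeight, cutoff_of_le, sub_self, zero_mul]
  rwa [le_div_iff₀' ha] at ht

theorem integral_bessel_bessel (s : ℝ) (φ ψ : 𝓢(ℝ, ℂ)) :
    pair (toL2 (bessel s φ)) (toL2 (bessel (-s) ψ)) = ∫ t, φ t * ψ t := by
  rw [pair_toL2_toL2, integral_bessel_mul_eq, bessel_bessel, add_neg_cancel, bessel_zero]

/-- The factor `e^{-r/2}` in `near` is adapted to `γ = 0`: the weight `t^{1/2}` of the cone space
times the `t⁻¹` of the substitution is the `t^{-1/2}` produced by `integral_near_mul`. -/
theorem integral_near_eq (δ : ℝ) (Φ : 𝓢(ℝ, ℂ)) (φ : TestR) :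
    ∫ r, near _ (isNear_nearWeight one_pos δ) Φ r * toSchwartz φ r =
      ∫ t, Φ t * toSchwartz (mulTest _ (contDiffOn_near 0 δ) (thetaTest φ)) t := by
  rw [integral_near_mul]
  have h0 : ∀ t, t ∉ Set.Ioi (0 : ℝ) →
      Φ t * toSchwartz (mulTest _ (contDiffOn_near 0 δ) (thetaTest φ)) t = 0 := fun t ht => by
    rw [toSchwartz_mulTest_apply]
    change _ * (_ * (if 0 < t then ((t⁻¹ : ℝ) : ℂ) * φ (-Real.log t) else 0)) = 0
    rw [if_neg (by simpa using ht), mul_zero, mul_zero]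
  rw [← setIntegral_eq_integral_of_forall_compl_eq_zero h0]
  refine setIntegral_congr_fun measurableSet_Ioi fun t ht => ?_
  rw [toSchwartz_mulTest_apply]
  change Φ t * (_ * φ (-Real.log t)) =
    Φ t * (_ * (if 0 < t then ((t⁻¹ : ℝ) : ℂ) * φ (-Real.log t) else 0))
  rw [if_pos (by simpa using ht), ← mul_assoc (_ : ℂ) ((t⁻¹ : ℝ) : ℂ), ← Complex.ofReal_mul]
  have : t ^ (-(1 / 2 : ℝ)) = t ^ (1 / 2 - 0 : ℝ) * t⁻¹ := by
    rw [← Real.rpow_neg_one, ← Real.rpow_add ht]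
    norm_num
  rw [this, nearWeight, one_mul]
  push_cast
  ring

theorem integral_far_eq (δ : ℝ) (Φ : 𝓢(ℝ, ℂ)) (φ : Test) :
    ∫ t, mulS (farWeight 1 δ) Φ t * toSchwartz φ t =
      ∫ t, Φ t * toSchwartz (mulTest _ (contDiffOn_far δ) φ) t := by
  congr 1
  ext t
  rw [mulS_apply (isFar_farWeight one_pos δ).ofReal, toSchwartz_mulTest_apply, toSchwartz_apply,
    farWeight, one_mul]
  ring

/-- The restriction of elements of `H^{s,δ}(ℝ)` to `ℝ₊`. -/
def mkPlus (s δ : ℝ) : L2 →ₗ[ℂ] HPlus s δ := (hNull s δ).mkQ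

theorem norm_mkPlus_le (s δ : ℝ) (f : L2) : ‖mkPlus s δ f‖ ≤ ‖f‖ :=
  Submodule.Quotient.norm_mk_le (hNull s δ) f

theorem exists_toCone (s δ : ℝ) {A₁ A₂ : L2 →L[ℂ] L2} {C₁ C₂ : ℝ} (hA₁ : ‖A₁‖ ≤ C₁)
    (hA₂ : ‖A₂‖ ≤ C₂) (W : L2 →ₗ[ℂ] Dist)
    (hW₁ : ∀ f (φ : TestR), sobolev s 0 (A₁ f) (toSchwartz φ) =
      W f (mulTest _ (contDiffOn_near 0 δ) (thetaTest φ)))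
    (hW₂ : ∀ f (φ : Test), sobolev s 0 (A₂ f) (toSchwartz φ) =
      W f (mulTest _ (contDiffOn_far δ) φ)) :
    ∃ T : L2 →L[ℂ] Cone s 0 δ, (∀ f, ‖T f‖ ≤ (C₁ + C₂) * ‖f‖) ∧
      ∀ f φ, coneDist s 0 δ (T f) φ = W f φ := by
  let Q : L2 →ₗ[ℂ] WithLp 1 (L2 × HPlus s 0) :=
    (WithLp.linearEquiv 1 ℂ (L2 × HPlus s 0)).symm.toLinearMap ∘ₗ
      A₁.toLinearMap.prod (mkPlus s 0 ∘ₗ A₂.toLinearMap)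
  let T₀ : L2 →ₗ[ℂ] coneSpace s 0 δ :=
    (W.prod Q).codRestrict (coneSpace s 0 δ) fun f => ⟨hW₁ f, hW₂ f⟩
  have hn (f : L2) : ‖conePair s 0 δ (T₀ f)‖ ≤ (C₁ + C₂) * ‖f‖ := by
    have e : conePair s 0 δ (T₀ f) = WithLp.toLp 1 (A₁ f, mkPlus s 0 (A₂ f)) := rfl
    rw [e, WithLp.prod_norm_eq_of_L1, add_mul]
    refine add_le_add (A₁.le_of_opNorm_le hA₁ f) ?_
    exact (norm_mkPlus_le s 0 (A₂ f)).trans (A₂.le_of_opNorm_le hA₂ f)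
  exact ⟨LinearMap.mkContinuous (E := L2) (F := Cone s 0 δ) T₀ (C₁ + C₂) hn, hn, fun f φ => rfl⟩

theorem eq_of_eq_toL2 {g h : L2 → ℂ} (hg : Continuous g) (hh : Continuous h)
    (H : ∀ ψ, g (toL2 ψ) = h (toL2 ψ)) (f : L2) : g f = h f :=
  congrFun (denseRange_toL2.equalizer hg hh (funext H)) f

/-- The map is `κ_r` followed by restriction to `ℝ₊`. Its two cone components are the bounded
extensions of explicit operators on Schwartz functions; that they belong to the right distribution
is checked on Schwartz functions and extended by density. -/
theorem exists_coneMap (s δ : ℝ) : ∃ (K : ℕ) (C : ℝ), 0 ≤ C ∧ ∀ (r : ℝ) (hr : 0 < r), 1 ≤ r →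
    ∃ T : L2 →L[ℂ] Cone s 0 δ, (∀ f, ‖T f‖ ≤ C * ‖f‖) ∧ ∀ f φ, coneDist s 0 δ (T f) φ =
      sobolev K (3 * K) f (toSchwartz (dilTest r⁻¹ (inv_pos.2 hr) φ)) := by
  obtain ⟨K₁, h₁⟩ := exists_uniform_extension
    (B := (bessel s).toLinearMap ∘ₗ near _ (isNear_nearWeight one_pos δ))
    (controlled_bessel_near s (isNear_nearWeight one_pos δ))
  obtain ⟨K₂, h₂⟩ := exists_uniform_extension
    (B := (bessel s).toLinearMap ∘ₗ (mulS (farWeight 1 δ)).toLinearMap)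
    (controlled_bessel_far s (isFar_farWeight one_pos δ))
  obtain ⟨C₁, hC₁, h₁⟩ := h₁ (max K₁ K₂) (le_max_left _ _)
  obtain ⟨C₂, hC₂, h₂⟩ := h₂ (max K₁ K₂) (le_max_right _ _)
  generalize max K₁ K₂ = K at *
  refine ⟨K, C₁ + C₂, by positivity, fun r hr h1 => ?_⟩
  obtain ⟨A₁, hA₁, e₁⟩ := h₁ r hr h1
  obtain ⟨A₂, hA₂, e₂⟩ := h₂ r hr h1
  let W : L2 →ₗ[ℂ] Dist := (dilTest r⁻¹ (inv_pos.2 hr)).lcomp ℂ ℂ ∘ₗ restrict ∘ₗ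
    (sobolev K (3 * K)).toLinearMap
  refine exists_toCone s δ hA₁ hA₂ W (fun f φ => ?_) (fun f φ => ?_)
  · refine eq_of_eq_toL2 ((continuous_sobolev_apply s 0 _).comp A₁.continuous)
      (continuous_sobolev_apply K (3 * K) _) (fun ψ => ?_) f
    change _ = sobolev K (3 * K) _ (toSchwartz (dilTest r⁻¹ _ _))
    rw [toSchwartz_dilTest, sobolev_toL2, integral_dilSchwartz hr, Function.comp_apply, e₁,
      sobolev_zero_apply, ← integral_near_eq δ]
    exact integral_bessel_bessel s _ _
  · refine eq_of_eq_toL2 ((continuous_sobolev_apply s 0 _).comp A₂.continuous)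
      (continuous_sobolev_apply K (3 * K) _) (fun ψ => ?_) f
    change _ = sobolev K (3 * K) _ (toSchwartz (dilTest r⁻¹ _ _))
    rw [toSchwartz_dilTest, sobolev_toL2, integral_dilSchwartz hr, Function.comp_apply, e₂,
      sobolev_zero_apply, ← integral_far_eq δ]
    exact integral_bessel_bessel s _ _

theorem exists_targetEmbedding (s δ : ℝ) : ∃ (k ε : ℝ) (J : HPlus k ε →L[ℂ] Cone s 0 δ),
    IsTargetTwist .plain J ∧ ∀ w, TargetSpace.toDist (J w) = TargetSpace.toDist w := by
  obtain ⟨K, C, hC, h⟩ := exists_coneMap s δ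
  obtain ⟨σ, hσ, eσ⟩ := exists_liftPlus K (3 * K)
  choose T hT eT using h
  have hJ (w : HPlus K (3 * K)) (φ : Test) :
      coneDist s 0 δ (T 1 one_pos le_rfl (σ w)) φ = hPlusDist K (3 * K) w φ := by
    rw [eT, dilTest_one, eσ]
  refine ⟨K, 3 * K, T 1 one_pos le_rfl ∘L σ, ⟨?_, C, hC, ?_⟩,
    fun w => LinearMap.ext fun φ => hJ w φ⟩
  · rintro r u v ⟨hr, h⟩
    refine ⟨hr, fun φ => ?_⟩
    exact (hJ v φ).trans ((h φ).trans (hJ u _).symm)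
  · rintro r' r hr' hle - w z ⟨hr, h⟩
    -- On distributions `κ_{r'}⁻¹ κ_r = κ_{r/r'}` with `r/r' ≥ 1`, so the uniform bound of the
    -- family `T` applies.
    refine ⟨T (r / r') (by positivity) ((one_le_div hr').2 hle) (σ w), ⟨hr', fun φ => ?_⟩, ?_⟩
    · refine (hJ z φ).trans ?_
      rw [h φ, eT, ← eσ]
      congr 1
      refine (dilTest_dilTest _ _ _ ?_ φ).symm
      field_simp
    · exact (hT _ _ _ _).trans (mul_le_mul_of_nonneg_left (hσ w) hC)

/-! ### From cone Sobolev spaces to Sobolev spaces -/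

theorem Controlled.comp_dilSchwartz {p : 𝓢(ℝ, ℂ) → ℝ} (hp : Controlled p) {r : ℝ} (hr : 0 < r) :
    Controlled fun ψ => p (dilSchwartz r hr ψ) := by
  obtain ⟨K, C, hC, h⟩ := hp
  refine ⟨K, C * max 1 (r⁻¹ ^ 2) ^ K, by positivity, fun ψ => (h _).trans ?_⟩
  rw [mul_assoc]
  exact mul_le_mul_of_nonneg_left (conormal_dilSchwartz hr K ψ) hC

theorem eq_of_controlled {G G' : 𝓢(ℝ, ℂ) →ₗ[ℂ] ℂ} (hG : Controlled fun ψ => ‖G ψ‖)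
    (hG' : Controlled fun ψ => ‖G' ψ‖) (h : ∀ φ : Test, G (toSchwartz φ) = G' (toSchwartz φ)) :
    G = G' :=
  sub_eq_zero.1 (eq_zero_of_controlled ((hG.add hG').mono fun _ => norm_sub_le _ _)
    fun φ => by rw [LinearMap.sub_apply, h, sub_self])

theorem controlled_integral (φ : Test) : Controlled fun ψ => ‖∫ t, φ t * ψ t‖ := by
  have h1 : Controlled fun ψ : 𝓢(ℝ, ℂ) => normTwo halfMeasure ψ :=
    (controlled_weighted 0 0 (b := fun _ => 1) zero_le_one fun t _ => by simp).mono fun ψ => by simp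
  refine (h1.const_mul (normTwo_nonneg halfMeasure φ)).mono fun ψ => ?_
  have hφ : MemLp φ 2 halfMeasure := ((toSchwartz φ).memLp 2 volume).restrict _
  have hψ : MemLp ψ 2 halfMeasure := (ψ.memLp 2 volume).restrict _
  have h0 : ∀ t, t ∉ Set.Ioi (0 : ℝ) → φ t * ψ t = 0 := fun t ht => by
    rw [test_zero φ fun h => ht (φ.tsupport_subset h), zero_mul]
  rw [← setIntegral_eq_integral_of_forall_compl_eq_zero h0]
  have h2 : ‖∫ t in Set.Ioi 0, φ t * ψ t‖ₑ ≤ eLpNorm φ 2 halfMeasure * eLpNorm ψ 2 halfMeasure := by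
    refine (enorm_integral_le_lintegral_enorm _).trans ?_
    rw [← eLpNorm_one_eq_lintegral_enorm]
    have := eLpNorm_smul_le_mul_eLpNorm (p := 2) (q := 2) (r := 1) (f := (ψ : ℝ → ℂ))
      (φ := (φ : ℝ → ℂ)) hψ.1 hφ.1
    exact this
  have h3 := ENNReal.toReal_mono (ENNReal.mul_ne_top hφ.2.ne hψ.2.ne) h2
  rw [ENNReal.toReal_mul, toReal_enorm] at h3
  exact h3

theorem contDiffOn_nearInv (δ : ℝ) : ContDiffOn ℝ ∞
    (fun t : ℝ => cutoff (2⁻¹ * t) * t ^ (-(1 / 2 : ℝ)) * japanese (-δ) t) (Set.Ioi 0) :=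
  ((contDiff_cutoff.comp (contDiff_const.mul contDiff_id)).contDiffOn.mul
    (contDiffOn_id.rpow_const_of_ne fun _ ht => ne_of_gt ht)).mul (contDiff_japanese _).contDiffOn

theorem contDiffOn_farInv (δ : ℝ) : ContDiffOn ℝ ∞
    (fun t : ℝ => (1 - cutoff (2 * t)) * japanese (-δ) t) (Set.Ioi 0) :=
  ((contDiff_const.sub (contDiff_cutoff.comp (contDiff_const.mul contDiff_id))).mul
    (contDiff_japanese _)).contDiffOn

/-- The function `ω(t/2)` equals `1` on the support of `ω`, and `1 - ω(2t)` equals `1` on that of `1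
- ω`. Hence an element of the cone space is recovered from its two components by multiplying them
with these wider cut-offs. -/
theorem cutoff_partition (t : ℝ) :
    cutoff t * cutoff (2⁻¹ * t) + (1 - cutoff t) * (1 - cutoff (2 * t)) = 1 := by
  rcases le_total t 1 with h | h
  · rw [cutoff_of_le h, cutoff_of_le (t := 2⁻¹ * t) (by linarith)]
    ring
  · rw [cutoff_of_ge (t := 2 * t) (by linarith)]
    rcases le_total t 2 with h' | h'
    · rw [cutoff_of_le (t := 2⁻¹ * t) (by linarith)]
      ring
    · rw [cutoff_of_ge h']
      ring

theorem near_add_far (δ : ℝ) (φ : Test) :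
    mulTest _ (contDiffOn_near 0 δ) (mulTest _ (contDiffOn_nearInv δ) φ) +
      mulTest _ (contDiffOn_far δ) (mulTest _ (contDiffOn_farInv δ) φ) = φ := by
  ext t
  change ((cutoff t * t ^ (1 / 2 - 0 : ℝ) * japanese δ t : ℝ) : ℂ) *
      (((cutoff (2⁻¹ * t) * t ^ (-(1 / 2 : ℝ)) * japanese (-δ) t : ℝ) : ℂ) * φ t) +
    (((1 - cutoff t) * japanese δ t : ℝ) : ℂ) *
      ((((1 - cutoff (2 * t)) * japanese (-δ) t : ℝ) : ℂ) * φ t) = φ t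
  by_cases ht : 0 < t
  · have a1 := japanese_neg_mul δ t
    have a2 : t ^ (1 / 2 - 0 : ℝ) * t ^ (-(1 / 2 : ℝ)) = 1 := by
      rw [← Real.rpow_add ht]; simp
    have a3 : cutoff t * t ^ (1 / 2 - 0 : ℝ) * japanese δ t *
        (cutoff (2⁻¹ * t) * t ^ (-(1 / 2 : ℝ)) * japanese (-δ) t) +
        (1 - cutoff t) * japanese δ t * ((1 - cutoff (2 * t)) * japanese (-δ) t) = 1 := by
      linear_combination cutoff_partition t + cutoff t * cutoff (2⁻¹ * t) * a2 * (japanese δ t *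
        japanese (-δ) t) + (cutoff t * cutoff (2⁻¹ * t) + (1 - cutoff t) * (1 - cutoff (2 * t))) * a1
    rw [← mul_assoc, ← mul_assoc, ← add_mul, ← Complex.ofReal_mul, ← Complex.ofReal_mul,
      ← Complex.ofReal_add, a3, Complex.ofReal_one, one_mul]
  · rw [test_zero φ fun h => ht (φ.tsupport_subset h)]
    simp

theorem near_toSchwartz (δ : ℝ) (hb : IsNear (nearWeight 2⁻¹ (-δ)))
    (φ : Test) : near _ hb (toSchwartz φ) =
      toSchwartz (thetaInvTest (mulTest _ (contDiffOn_nearInv δ) φ)) := by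
  ext r
  rw [near_apply]
  change _ * φ _ = ((Real.exp (-r) : ℝ) : ℂ) * (((cutoff (2⁻¹ * Real.exp (-r)) *
    Real.exp (-r) ^ (-(1 / 2 : ℝ)) * japanese (-δ) (Real.exp (-r)) : ℝ) : ℂ) * φ (Real.exp (-r)))
  have h : Real.exp (-r / 2) = Real.exp (-r) * Real.exp (-r * -(1 / 2)) := by
    rw [← Real.exp_add]
    congr 1
    ring
  rw [← Real.exp_mul, h, nearWeight]
  push_cast
  ring

theorem mulS_farWeight_toSchwartz (δ : ℝ) (φ : Test) :
    mulS (farWeight 2 (-δ)) (toSchwartz φ) = toSchwartz (mulTest _ (contDiffOn_farInv δ) φ) := by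
  ext t
  rw [mulS_apply (isFar_farWeight two_pos _).ofReal]
  rfl

/-- The functional on `𝓢(ℝ)` obtained from elements of `H^s(ℝ)` near `0` (after the substitution
`t = e^{-r}`) and away from `0`. -/
def glue (s δ : ℝ) (U V : L2) : 𝓢(ℝ, ℂ) →ₗ[ℂ] ℂ :=
  (sobolev s 0 U).toLinearMap ∘ₗ near _ (isNear_nearWeight (inv_pos.2 two_pos) (-δ)) +
    (sobolev s 0 V).toLinearMap ∘ₗ (mulS (farWeight 2 (-δ))).toLinearMap

theorem glue_apply (s δ : ℝ) (U V : L2) (ψ : 𝓢(ℝ, ℂ)) : glue s δ U V ψ =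
    pair U (toL2 (bessel (-s) (near _ (isNear_nearWeight (inv_pos.2 two_pos) (-δ)) ψ))) +
    pair V (toL2 (bessel (-s) (mulS (farWeight 2 (-δ)) ψ))) := by
  rw [← sobolev_zero_apply, ← sobolev_zero_apply]
  rfl

theorem controlled_glue (s δ : ℝ) (U V : L2) : Controlled fun ψ => ‖glue s δ U V ψ‖ := by
  refine (((controlled_bessel_near (-s) (isNear_nearWeight (inv_pos.2 two_pos) (-δ))).const_mul
    (norm_nonneg (pair U))).add ((controlled_bessel_far (-s)
      (isFar_farWeight two_pos (-δ))).const_mul (norm_nonneg (pair V)))).mono fun ψ => ?_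
  rw [glue_apply]
  exact (norm_add_le _ _).trans
    (add_le_add (ContinuousLinearMap.le_opNorm _ _) (ContinuousLinearMap.le_opNorm _ _))

/-- The `conormal` norms involve only the values on `ℝ₊`, so a controlled functional is supported in
`[0,∞)`; this puts the glued functionals into `hZero`. -/
theorem eq_zero_of_controlled_dil {G : 𝓢(ℝ, ℂ) →ₗ[ℂ] ℂ} (hG : Controlled fun ψ => ‖G ψ‖) {r : ℝ}
    (hr : 0 < r) {ψ : 𝓢(ℝ, ℂ)} (hψ : tsupport ψ ⊆ Set.Iio 0) : G (dilSchwartz r hr ψ) = 0 := by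
  obtain ⟨K, C, -, h⟩ := hG.comp_dilSchwartz hr
  have h2 : conormal K ψ = 0 := conormal_eq_zero (fun t ht => by
    refine image_eq_zero_of_notMem_tsupport fun h => ?_
    exact absurd (hψ h) (not_lt.2 ht.le)) K
  have h3 := h ψ
  rw [h2, mul_zero] at h3
  exact norm_le_zero_iff.1 h3

theorem mulS_bessel_bessel_mulS (k ε : ℝ) (ψ : 𝓢(ℝ, ℂ)) :
    mulS (japanese (-ε)) (bessel (-k) (bessel (-(-k)) (mulS (japanese (-(-ε))) ψ))) = ψ := by
  rw [bessel_bessel, add_neg_cancel, bessel_zero]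
  ext t
  rw [mulS_apply (hasTemperateGrowth_ofReal_japanese _),
    mulS_apply (hasTemperateGrowth_ofReal_japanese _), ← mul_assoc, ← Complex.ofReal_mul,
    japanese_neg_mul, Complex.ofReal_one, one_mul]

/-- Dual to `exists_coneMap`: `B₁` and `B₂` are transposes of the operators from
`exists_uniform_extension`, and transposition replaces `H^{K,3K}` by its dual `H^{-K,-3K}`. -/
theorem exists_glueMap (s δ : ℝ) : ∃ (K : ℕ) (C : ℝ), 0 ≤ C ∧ ∀ (r : ℝ) (hr : 0 < r), 1 ≤ r →
    ∃ B₁ B₂ : L2 →L[ℂ] L2, ‖B₁‖ ≤ C ∧ ‖B₂‖ ≤ C ∧ ∀ U V ψ,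
      sobolev (-K) (-(3 * K)) (B₁ U + B₂ V) ψ = glue s δ U V (dilSchwartz r hr ψ) := by
  obtain ⟨K₁, h₁⟩ := exists_uniform_extension (B := (bessel (-s)).toLinearMap ∘ₗ
    near _ (isNear_nearWeight (inv_pos.2 two_pos) (-δ))) (controlled_bessel_near (-s) _)
  obtain ⟨K₂, h₂⟩ := exists_uniform_extension
    (B := (bessel (-s)).toLinearMap ∘ₗ (mulS (farWeight 2 (-δ))).toLinearMap)
    (controlled_bessel_far (-s) (isFar_farWeight two_pos (-δ)))
  obtain ⟨C₁, hC₁, h₁⟩ := h₁ (max K₁ K₂) (le_max_left _ _)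
  obtain ⟨C₂, hC₂, h₂⟩ := h₂ (max K₁ K₂) (le_max_right _ _)
  generalize max K₁ K₂ = K at *
  refine ⟨K, C₁ + C₂, by positivity, fun r hr h1 => ?_⟩
  obtain ⟨A₁, hA₁, e₁⟩ := h₁ r hr h1
  obtain ⟨A₂, hA₂, e₂⟩ := h₂ r hr h1
  obtain ⟨B₁, hB₁, t₁⟩ := exists_transpose A₁
  obtain ⟨B₂, hB₂, t₂⟩ := exists_transpose A₂
  refine ⟨B₁, B₂, by linarith, by linarith, fun U V ψ => ?_⟩
  rw [sobolev_apply, map_add, add_apply, t₁, t₂, e₁, e₂,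
    mulS_bessel_bessel_mulS, glue_apply]
  rfl

theorem exists_toHZero {E : Type*} [NormedAddCommGroup E] [NormedSpace ℂ E] {k ε C : ℝ}
    (B : E →L[ℂ] L2) (hC : ∀ u, ‖B u‖ ≤ C * ‖u‖) (hB : ∀ u, B u ∈ hZero k ε) :
    ∃ T : E →L[ℂ] HZero k ε, (∀ u, ‖T u‖ ≤ C * ‖u‖) ∧
      ∀ u ψ, hZeroDist k ε (T u) ψ = sobolev k ε (B u) ψ :=
  ⟨B.codRestrict (hZero k ε) hB, hC, fun _ _ => rfl⟩

/-- The pair of components of an element of the cone Sobolev space. -/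
def coneComponents (s δ : ℝ) : Cone s 0 δ →ₗᵢ[ℂ] WithLp 1 (L2 × HPlus s 0) where
  toLinearMap := conePair s 0 δ
  norm_map' _ := rfl

theorem coneComponents_near (s δ : ℝ) (u : Cone s 0 δ) (φ : TestR) :
    sobolev s 0 (coneComponents s δ u).fst (toSchwartz φ) =
      coneDist s 0 δ u (mulTest _ (contDiffOn_near 0 δ) (thetaTest φ)) := u.2.1 φ

theorem coneComponents_far (s δ : ℝ) (u : Cone s 0 δ) (φ : Test) :
    hPlusDist s 0 (coneComponents s δ u).snd φ =
      coneDist s 0 δ u (mulTest _ (contDiffOn_far δ) φ) := u.2.2 φ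

/-- The two components of an element of the cone Sobolev space, as bounded maps. -/
theorem exists_coneComponents (s δ : ℝ) : ∃ P₁ P₂ : Cone s 0 δ →L[ℂ] L2,
    (∀ u, ‖P₁ u‖ + ‖P₂ u‖ ≤ ‖u‖) ∧
    ∀ u φ, glue s δ (P₁ u) (P₂ u) (toSchwartz φ) = coneDist s 0 δ u φ := by
  obtain ⟨σ, hσ, eσ⟩ := exists_liftPlus s 0
  let P := (coneComponents s δ).toContinuousLinearMap
  refine ⟨WithLp.fstL 1 ℂ L2 (HPlus s 0) ∘L P, σ ∘L WithLp.sndL 1 ℂ L2 (HPlus s 0) ∘L P,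
    fun u => ?_, fun u φ => ?_⟩
  · rw [← (coneComponents s δ).norm_map u, WithLp.prod_norm_eq_of_L1]
    exact add_le_add_right (hσ _) _
  · change sobolev s 0 (coneComponents s δ u).fst (near _ _ (toSchwartz φ)) +
      sobolev s 0 (σ (coneComponents s δ u).snd) (mulS (farWeight 2 (-δ)) (toSchwartz φ)) = _
    rw [near_toSchwartz, mulS_farWeight_toSchwartz, ← eσ, coneComponents_near, coneComponents_far,
      thetaTest_thetaInvTest, ← map_add, near_add_far]

/-- Here `G u` is the controlled extension of `u` to `𝓢(ℝ)`, and `T` is `κ_r⁻¹` applied to it. A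
single `G` serves all `r ≥ 1`, which allows the maps `T` for different `r` to be compared. -/
theorem exists_coneExtension (s δ : ℝ) : ∃ (K : ℕ) (C : ℝ) (G : Cone s 0 δ → 𝓢(ℝ, ℂ) →ₗ[ℂ] ℂ),
    0 ≤ C ∧ (∀ u, Controlled fun ψ => ‖G u ψ‖) ∧
    (∀ u φ, G u (toSchwartz φ) = coneDist s 0 δ u φ) ∧
    ∀ (r : ℝ) (hr : 0 < r), 1 ≤ r → ∃ T : Cone s 0 δ →L[ℂ] HZero (-K) (-(3 * K)),
      (∀ u, ‖T u‖ ≤ C * ‖u‖) ∧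
      ∀ u ψ, hZeroDist (-K) (-(3 * K)) (T u) ψ = G u (dilSchwartz r hr ψ) := by
  obtain ⟨K, C, hC, h⟩ := exists_glueMap s δ
  obtain ⟨P₁, P₂, hP, eP⟩ := exists_coneComponents s δ
  refine ⟨K, C, fun u => glue s δ (P₁ u) (P₂ u), hC, fun u => controlled_glue s δ _ _, eP,
    fun r hr h1 => ?_⟩
  obtain ⟨B₁, B₂, hB₁, hB₂, e⟩ := h r hr h1
  have hn (u : Cone s 0 δ) : ‖(B₁ ∘L P₁ + B₂ ∘L P₂) u‖ ≤ C * ‖u‖ := by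
    refine (norm_add_le _ _).trans ((add_le_add (B₁.le_of_opNorm_le hB₁ _)
      (B₂.le_of_opNorm_le hB₂ _)).trans ?_)
    rw [← mul_add]
    exact mul_le_mul_of_nonneg_left (hP u) hC
  have hz (u : Cone s 0 δ) : (B₁ ∘L P₁ + B₂ ∘L P₂) u ∈ hZero (-K) (-(3 * K)) := fun ψ hψ =>
    (e _ _ ψ).trans (eq_zero_of_controlled_dil (controlled_glue s δ _ _) hr hψ)
  obtain ⟨T, hT, eT⟩ := exists_toHZero (B₁ ∘L P₁ + B₂ ∘L P₂) hn hz
  exact ⟨T, hT, fun u ψ => (eT u ψ).trans (e _ _ ψ)⟩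

/-- Compatibility with dilations and with test functions is known only on `C_c^∞(ℝ₊)`. It carries
over to `𝓢(ℝ)` because both sides are controlled functionals. -/
theorem exists_sourceEmbedding (s δ : ℝ) : ∃ (k ε : ℝ) (I : Cone s 0 δ →L[ℂ] HZero k ε),
    IsSourceTwist .plain I ∧
      ∀ φ u, SourceSpace.isTest φ u → SourceSpace.isTest φ (I u) := by
  obtain ⟨K, C, G, hC, hG, hGt, h⟩ := exists_coneExtension s δ
  choose T hT eT using h
  have hI (u : Cone s 0 δ) (ψ : 𝓢(ℝ, ℂ)) :
      hZeroDist (-K) (-(3 * K)) (T 1 one_pos le_rfl u) ψ = G u ψ := by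
    rw [eT, dilSchwartz_one]
  have hdil (r : ℝ) (hr : 0 < r) (u v : Cone s 0 δ)
      (huv : ∀ φ : Test, coneDist s 0 δ v φ = coneDist s 0 δ u (dilTest r⁻¹ (inv_pos.2 hr) φ))
      (ψ : 𝓢(ℝ, ℂ)) : G v ψ = G u (dilSchwartz r⁻¹ (inv_pos.2 hr) ψ) := by
    have := eq_of_controlled (G := G v)
      (G' := G u ∘ₗ (dilSchwartz r⁻¹ (inv_pos.2 hr)).toLinearMap) (hG v)
      ((hG u).comp_dilSchwartz _) fun φ => by
        rw [hGt, huv, ← hGt]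
        rfl
    rw [this]
    rfl
  refine ⟨-K, -(3 * K), T 1 one_pos le_rfl, ⟨?_, C, hC, ?_⟩, ?_⟩
  · rintro r u v ⟨hr, huv⟩
    refine ⟨hr, fun ψ => ?_⟩
    rw [hI, hI]
    exact hdil r hr u v huv ψ
  · rintro r' r hr' hle - u v ⟨hr'', huv⟩
    have hr : 0 < r := hr'.trans_le hle
    -- With `v = κ_{r'} u` this element is `κ_r⁻¹ I v = κ_{r/r'}⁻¹ I u`.
    refine ⟨T (r / r') (by positivity) ((one_le_div hr').2 hle) u, ⟨hr, fun ψ => ?_⟩, hT _ _ _ _⟩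
    rw [hI, eT, hdil r' hr' u v huv]
    congr 1
    ext t
    simp only [dilSchwartz_apply]
    rw [← mul_assoc, ← Complex.ofReal_mul, ← Real.mul_rpow (by positivity) (by positivity),
      ← mul_assoc]
    congr 4 <;> field_simp
  · intro φ u hu ψ
    rw [hI]
    have := eq_of_controlled (G := G u)
      (G' := (pair (toL2 (toSchwartz φ))).toLinearMap ∘ₗ toL2.toLinearMap) (hG u)
      ((controlled_integral φ).mono fun ψ => (congrArg norm (pair_toL2_toL2 _ ψ)).le) fun ψ => by
        rw [hGt, hu ψ]
        change _ = pair (toL2 (toSchwartz φ)) (toL2 (toSchwartz ψ))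
        rw [pair_toL2_toL2]
        rfl
    rw [this]
    exact pair_toL2_toL2 _ _

/-! ### Iterated partial derivatives -/

theorem uniqueDiffOn_fullDomain (n : ℕ) : UniqueDiffOn ℝ (fullDomain n) := by
  have h : fullDomain n = Set.univ ×ˢ (Set.univ ×ˢ Set.Ici (0 : ℝ)) := by
    ext p
    simp [fullDomain]
  rw [h]
  exact uniqueDiffOn_univ.prod (uniqueDiffOn_univ.prod (uniqueDiffOn_Ici 0))

theorem uniqueDiffOn_strongDomain (n : ℕ) : UniqueDiffOn ℝ (strongDomain n) :=
  (uniqueDiffOn_fullDomain n).inter (t := {p : Phase n | p.2 ≠ 0})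
    (isOpen_ne.preimage continuous_snd)

theorem uniqueDiffOn_weakDomain (n : ℕ) : UniqueDiffOn ℝ (weakDomain n) :=
  (uniqueDiffOn_fullDomain n).inter (t := {p : Phase n | p.2.1 ≠ 0})
    (isOpen_ne.preimage (continuous_fst.comp continuous_snd))

section Partials

variable {n : ℕ} {F G : Type*} [NormedAddCommGroup F] [NormedSpace ℝ F] [NormedAddCommGroup G]
  [NormedSpace ℝ G] {D : Set (Phase n)} {a b : Phase n → F}

theorem contDiffOn_partials (hD : UniqueDiffOn ℝ D) (ha : ContDiffOn ℝ ∞ a D) :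
    ∀ l, ContDiffOn ℝ ∞ (partials D l a) D
  | [] => ha
  | _ :: l => ((contDiffOn_partials hD ha l).fderivWithin hD (m := ∞) (by simp)).clm_apply
      contDiffOn_const

theorem differentiableOn_partials (hD : UniqueDiffOn ℝ D) (ha : ContDiffOn ℝ ∞ a D)
    (l : List (Direction n)) : DifferentiableOn ℝ (partials D l a) D :=
  (contDiffOn_partials hD ha l).differentiableOn (by simp)

theorem partials_congr (h : Set.EqOn a b D) : ∀ l, Set.EqOn (partials D l a) (partials D l b) D
  | [] => h
  | e :: l => fun p hp => by
    have ih := partials_congr h l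
    change fderivWithin ℝ _ D p e.vec = fderivWithin ℝ _ D p e.vec
    rw [fderivWithin_congr ih (ih hp)]

theorem partials_append (l l' : List (Direction n)) :
    partials D (l ++ l') a = partials D l (partials D l' a) := by
  induction l with
  | nil => rfl
  | cons e l ih => simp only [List.cons_append, partials, ih]

theorem partials_clm (hD : UniqueDiffOn ℝ D) (ha : ContDiffOn ℝ ∞ a D) (Φ : F →L[ℝ] G) :
    ∀ l, Set.EqOn (partials D l fun p => Φ (a p)) (fun p => Φ (partials D l a p)) D
  | [] => fun _ _ => rfl
  | e :: l => fun p hp => by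
    have ih := partials_clm hD ha Φ l
    change fderivWithin ℝ _ D p e.vec = Φ (fderivWithin ℝ _ D p e.vec)
    rw [fderivWithin_congr ih (ih hp)]
    have := (Φ.hasFDerivAt.comp_hasFDerivWithinAt p
      (differentiableOn_partials hD ha l p hp).hasFDerivWithinAt).fderivWithin (hD p hp)
    rw [Function.comp_def] at this
    rw [this]
    rfl

theorem partials_add (hD : UniqueDiffOn ℝ D) (ha : ContDiffOn ℝ ∞ a D) (hb : ContDiffOn ℝ ∞ b D) :
    ∀ l, Set.EqOn (partials D l (a + b)) (partials D l a + partials D l b) D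
  | [] => fun _ _ => rfl
  | e :: l => fun p hp => by
    have ih := partials_add hD ha hb l
    change fderivWithin ℝ (partials D l (a + b)) D p e.vec =
      fderivWithin ℝ (partials D l a) D p e.vec + fderivWithin ℝ (partials D l b) D p e.vec
    rw [fderivWithin_congr ih (ih hp), fderivWithin_add (hD p hp)
      (differentiableOn_partials hD ha l p hp) (differentiableOn_partials hD hb l p hp)]
    rfl

theorem partials_zero (l : List (Direction n)) : partials D l (0 : Phase n → F) = 0 := by
  induction l with
  | nil => rfl
  | cons e l ih =>
    simp only [partials, ih]
    ext p
    have : fderivWithin ℝ (0 : Phase n → F) D p = 0 := by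
      simp
    rw [this]
    rfl

theorem partials_subset {D' : Set (Phase n)} (hD : UniqueDiffOn ℝ D) (hD' : UniqueDiffOn ℝ D')
    (hs : D' ⊆ D) (ha : ContDiffOn ℝ ∞ a D) :
    ∀ l, Set.EqOn (partials D' l a) (partials D l a) D'
  | [] => fun _ _ => rfl
  | e :: l => fun p hp => by
    have ih := partials_subset hD hD' hs ha l
    change fderivWithin ℝ _ D' p e.vec = fderivWithin ℝ _ D p e.vec
    rw [fderivWithin_congr ih (ih hp), fderivWithin_subset hs (hD' p hp)
      (differentiableOn_partials hD ha l p (hs hp))]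

theorem fderivWithin_smul_fst [NormedSpace ℂ F] [IsScalarTower ℝ ℂ F]
    (hD : UniqueDiffOn ℝ D) (hb : ContDiffOn ℝ ∞ b D) {γ : EuclideanSpace ℝ (Fin n) → ℝ}
    (hγ : ContDiff ℝ ∞ γ) (e : Direction n) {p : Phase n} (hp : p ∈ D) :
    fderivWithin ℝ (fun p => ((γ p.2.1 : ℝ) : ℂ) • b p) D p e.vec =
      ((γ p.2.1 : ℝ) : ℂ) • fderivWithin ℝ b D p e.vec +
        ((fderiv ℝ γ p.2.1 e.vec.2.1 : ℝ) : ℂ) • b p := by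
  have h1 : HasFDerivAt (fun p : Phase n => p.2.1)
      ((ContinuousLinearMap.fst ℝ _ _).comp (ContinuousLinearMap.snd ℝ _ _)) p :=
    hasFDerivAt_fst.comp p hasFDerivAt_snd
  have h2 := Complex.ofRealCLM.hasFDerivAt.comp p
    ((hγ.differentiable (by simp) p.2.1).hasFDerivAt.comp p h1)
  have h3 := h2.hasFDerivWithinAt.smul
    (hb.differentiableOn (by simp) p hp).hasFDerivWithinAt
  have h4 := h3.fderivWithin (hD p hp)
  have h5 : (fun p : Phase n => ((γ p.2.1 : ℝ) : ℂ) • b p) =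
    ((⇑Complex.ofRealCLM ∘ γ ∘ fun p : Phase n => p.2.1) • b) := rfl
  rw [h5, h4]
  rfl

end Partials

/-! ### Spaces with a linear group action -/

/-- The dilations `κ_r` are linear. -/
class LinearKappaSpace (E : Type*) [NormedAddCommGroup E] [NormedSpace ℂ E] [KappaSpace E] :
    Prop where
  dil_zero : ∀ {r : ℝ}, 0 < r → KappaSpace.dil r (0 : E) 0
  dil_add : ∀ {r : ℝ} {u v u' v' : E}, KappaSpace.dil r u v → KappaSpace.dil r u' v' →
    KappaSpace.dil r (u + u') (v + v')
  dil_smul : ∀ {r : ℝ} {u v : E} (c : ℂ), KappaSpace.dil r u v → KappaSpace.dil r (c • u) (c • v)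


open LinearKappaSpace

instance (s δ : ℝ) : LinearKappaSpace (HPlus s δ) where
  dil_zero hr := ⟨hr, fun φ => by rw [map_zero]; rfl⟩
  dil_add := by
    rintro r u v u' v' ⟨hr, h⟩ ⟨_, h'⟩
    refine ⟨hr, fun φ => ?_⟩
    rw [map_add, map_add]
    exact congrArg₂ (· + ·) (h φ) (h' φ)
  dil_smul := by
    rintro r u v c ⟨hr, h⟩
    refine ⟨hr, fun φ => ?_⟩
    rw [map_smul, map_smul]
    exact congrArg (c • ·) (h φ)

theorem coneDist_add (s γ δ : ℝ) (u v : Cone s γ δ) :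
    coneDist s γ δ (u + v) = coneDist s γ δ u + coneDist s γ δ v := rfl

theorem coneDist_smul (s γ δ : ℝ) (c : ℂ) (u : Cone s γ δ) :
    coneDist s γ δ (c • u) = c • coneDist s γ δ u := rfl

theorem coneDist_zero (s γ δ : ℝ) : coneDist s γ δ 0 = 0 := rfl

instance (s γ δ : ℝ) : LinearKappaSpace (Cone s γ δ) where
  dil_zero hr := ⟨hr, fun φ => by rw [coneDist_zero]; rfl⟩
  dil_add := by
    rintro r u v u' v' ⟨hr, h⟩ ⟨_, h'⟩
    refine ⟨hr, fun φ => ?_⟩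
    rw [coneDist_add, coneDist_add]
    exact congrArg₂ (· + ·) (h φ) (h' φ)
  dil_smul := by
    rintro r u v c ⟨hr, h⟩
    refine ⟨hr, fun φ => ?_⟩
    rw [coneDist_smul, coneDist_smul]
    exact congrArg (c • ·) (h φ)

instance (E : Type*) [NormedAddCommGroup E] [NormedSpace ℂ E] [KappaSpace E] [LinearKappaSpace E]
    (L M : ℕ) : LinearKappaSpace (Block E L M) where
  dil_zero hr := ⟨hr, fun _ => dil_zero hr, rfl⟩
  dil_add h h' := ⟨h.1, fun i => dil_add (h.2.1 i) (h'.2.1 i), congrArg₂ (· + ·) h.2.2 h'.2.2⟩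
  dil_smul c h := ⟨h.1, fun i => dil_smul c (h.2.1 i), congrArg (c • ·) h.2.2⟩

/-- The embedding into the distributions is linear. -/
class LinearTargetSpace (E : Type*) [NormedAddCommGroup E] [TargetSpace E] : Prop where
  toDist_zero : TargetSpace.toDist (0 : E) = 0
  toDist_add : ∀ u v : E, TargetSpace.toDist (u + v) = TargetSpace.toDist u + TargetSpace.toDist v

instance (s δ : ℝ) : LinearTargetSpace (HPlus s δ) where
  toDist_zero := map_zero (hPlusDist s δ)
  toDist_add := map_add (hPlusDist s δ)

instance (s γ δ : ℝ) : LinearTargetSpace (Cone s γ δ) where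
  toDist_zero := rfl
  toDist_add _ _ := rfl

/-! ### Calculus of twisted operator norms. -/

section Twisted

variable {E₀ E₁ : Type*} [NormedAddCommGroup E₀] [NormedSpace ℂ E₀] [KappaSpace E₀]
  [NormedAddCommGroup E₁] [NormedSpace ℂ E₁] [KappaSpace E₁] {r₀ r₁ C C' : ℝ} {T T' : E₀ →L[ℂ] E₁}

theorem TwistedNormLE.mono (h : TwistedNormLE r₀ r₁ T C) (hC : C ≤ C') :
    TwistedNormLE r₀ r₁ T C' := fun u v huv => by
  obtain ⟨w, hw, hn⟩ := h u v huv
  exact ⟨w, hw, hn.trans (mul_le_mul_of_nonneg_right hC (norm_nonneg u))⟩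

theorem TwistedNormLE.add [LinearKappaSpace E₁] (h : TwistedNormLE r₀ r₁ T C)
    (h' : TwistedNormLE r₀ r₁ T' C') : TwistedNormLE r₀ r₁ (T + T') (C + C') := fun u v huv => by
  obtain ⟨w, hw, hn⟩ := h u v huv
  obtain ⟨w', hw', hn'⟩ := h' u v huv
  refine ⟨w + w', dil_add hw hw', (norm_add_le _ _).trans ?_⟩
  rw [add_mul]
  exact add_le_add hn hn'

theorem TwistedNormLE.smul [LinearKappaSpace E₁] (h : TwistedNormLE r₀ r₁ T C) (c : ℂ) :
    TwistedNormLE r₀ r₁ (c • T) (‖c‖ * C) := fun u v huv => by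
  obtain ⟨w, hw, hn⟩ := h u v huv
  refine ⟨c • w, dil_smul c hw, ?_⟩
  rw [norm_smul, mul_assoc]
  exact mul_le_mul_of_nonneg_left hn (norm_nonneg c)

theorem twistedNormLE_zero [LinearKappaSpace E₁] (hr : 0 < r₁) (hC : 0 ≤ C) :
    TwistedNormLE r₀ r₁ (0 : E₀ →L[ℂ] E₁) C := fun u _ _ =>
  ⟨0, dil_zero hr, by rw [norm_zero]; positivity⟩

end Twisted

open LinearTargetSpace

/-! ### Symbol estimates -/

section Estimates

variable {n : ℕ} {E₀ E₁ F₀ F₁ : Type*}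
  [NormedAddCommGroup E₀] [NormedSpace ℂ E₀] [KappaSpace E₀]
  [NormedAddCommGroup E₁] [NormedSpace ℂ E₁] [KappaSpace E₁]
  [NormedAddCommGroup F₀] [NormedSpace ℂ F₀] [KappaSpace F₀]
  [NormedAddCommGroup F₁] [NormedSpace ℂ F₁] [KappaSpace F₁]
  {D D' : Set (Phase n)} {r₀ r₁ r₀' r₁' : Phase n → ℝ} {w w' : ℕ → ℕ → Phase n → ℝ}
  {a b : Phase n → E₀ →L[ℂ] E₁}

theorem SymbolEstimates.mono (h : SymbolEstimates D r₀ r₁ w a)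
    (hw : ∀ k j, ∀ p ∈ D, 0 ≤ w k j p ∧ w k j p ≤ w' k j p) : SymbolEstimates D r₀ r₁ w' a := by
  refine ⟨h.1, fun l => ?_⟩
  obtain ⟨C, hC⟩ := h.2 l
  refine ⟨|C|, fun p hp => (hC p hp).mono ?_⟩
  obtain ⟨h0, h1⟩ := hw (l.countP Direction.isXi) (l.countP Direction.isMu) p hp
  exact mul_le_mul (le_abs_self C) h1 h0 (abs_nonneg C)

theorem SymbolEstimates.add [LinearKappaSpace E₁] (hD : UniqueDiffOn ℝ D)
    (ha : SymbolEstimates D r₀ r₁ w a) (hb : SymbolEstimates D r₀ r₁ w b) :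
    SymbolEstimates D r₀ r₁ w (a + b) := by
  refine ⟨ha.1.add hb.1, fun l => ?_⟩
  obtain ⟨C, hC⟩ := ha.2 l
  obtain ⟨C', hC'⟩ := hb.2 l
  refine ⟨C + C', fun p hp => ?_⟩
  rw [partials_add hD ha.1 hb.1 l hp, add_mul]
  exact (hC p hp).add (hC' p hp)

theorem symbolEstimates_zero [LinearKappaSpace E₁] (hr : ∀ p ∈ D, 0 < r₁ p) :
    SymbolEstimates D r₀ r₁ w (0 : Phase n → E₀ →L[ℂ] E₁) := by
  refine ⟨contDiffOn_const, fun l => ⟨0, fun p hp => ?_⟩⟩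
  rw [partials_zero, zero_mul]
  exact twistedNormLE_zero (hr p hp) le_rfl

theorem SymbolEstimates.sum [LinearKappaSpace E₁] (hD : UniqueDiffOn ℝ D)
    (hr : ∀ p ∈ D, 0 < r₁ p) {ι : Type*} (s : Finset ι) {f : ι → Phase n → E₀ →L[ℂ] E₁}
    (hf : ∀ i ∈ s, SymbolEstimates D r₀ r₁ w (f i)) :
    SymbolEstimates D r₀ r₁ w (∑ i ∈ s, f i) :=
  Finset.sum_induction f _ (fun _ _ h h' => h.add hD h') (symbolEstimates_zero hr) hf

/-- As `I` and `J` are constant, they commute with all derivatives, and the twisted operator factors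
as `(κ_{r₁'}⁻¹ J κ_{r₁}) (κ_{r₁}⁻¹ ∂a κ_{r₀}) (κ_{r₀}⁻¹ I κ_{r₀'})`. -/
theorem SymbolEstimates.comp (hD : UniqueDiffOn ℝ D) (hD' : UniqueDiffOn ℝ D') (hs : D' ⊆ D)
    (ha : SymbolEstimates D r₀ r₁ w a) (I : F₀ →L[ℂ] E₀) (J : E₁ →L[ℂ] F₁) {C₀ C₁ : ℝ}
    (hC₁ : 0 ≤ C₁)
    (hI : ∀ p ∈ D', ∀ u v, KappaSpace.dil (r₀' p) u v →
      ∃ u', KappaSpace.dil (r₀ p) u' (I v) ∧ ‖u'‖ ≤ C₀ * ‖u‖)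
    (hJ : ∀ p ∈ D', ∀ u v, KappaSpace.dil (r₁ p) u v →
      ∃ u', KappaSpace.dil (r₁' p) u' (J v) ∧ ‖u'‖ ≤ C₁ * ‖u‖)
    (hw : ∀ k j, ∀ p ∈ D', 0 ≤ w k j p ∧ w k j p ≤ w' k j p) :
    SymbolEstimates D' r₀' r₁' w' (fun p => J ∘L a p ∘L I) := by
  let Φ : (E₀ →L[ℂ] E₁) →L[ℝ] (F₀ →L[ℂ] F₁) :=
    ((ContinuousLinearMap.compL ℂ F₀ E₁ F₁ J) ∘L
      ((ContinuousLinearMap.compL ℂ F₀ E₀ E₁).flip I)).restrictScalars ℝ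
  refine ⟨Φ.contDiff.comp_contDiffOn (ha.1.mono hs), fun l => ?_⟩
  obtain ⟨C, hC⟩ := ha.2 l
  refine ⟨C₁ * (|C| * |C₀|), fun p hp u v huv => ?_⟩
  have e : partials D' l (fun p => J ∘L a p ∘L I) p = J ∘L partials D l a p ∘L I := by
    rw [← partials_subset hD hD' hs ha.1 l hp]
    exact partials_clm hD' (ha.1.mono hs) Φ l hp
  obtain ⟨u', hu', hn⟩ := hI p hp u v huv
  obtain ⟨z, hz, hnz⟩ := hC p (hs hp) u' (I v) hu'
  obtain ⟨z', hz', hnz'⟩ := hJ p hp z _ hz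
  refine ⟨z', by rw [e]; exact hz', hnz'.trans ?_⟩
  obtain ⟨h0, h1⟩ := hw (l.countP Direction.isXi) (l.countP Direction.isMu) p hp
  generalize w (l.countP Direction.isXi) (l.countP Direction.isMu) p = x at *
  generalize w' (l.countP Direction.isXi) (l.countP Direction.isMu) p = y at *
  have h2 : ‖z‖ ≤ |C| * y * (|C₀| * ‖u‖) := by
    refine hnz.trans (mul_le_mul ?_ (hn.trans ?_) (norm_nonneg _)
      (mul_nonneg (abs_nonneg _) (h0.trans h1)))
    · exact mul_le_mul (le_abs_self C) h1 h0 (abs_nonneg C)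
    · exact mul_le_mul_of_nonneg_right (le_abs_self C₀) (norm_nonneg u)
  calc C₁ * ‖z‖ ≤ C₁ * (|C| * y * (|C₀| * ‖u‖)) := mul_le_mul_of_nonneg_left h2 hC₁
    _ = _ := by ring

end Estimates

/-! ### The weights -/

section Weights

variable {n : ℕ} (p : Phase n)

theorem one_le_brXi : 1 ≤ brXi p := by
  rw [brXi, Real.one_le_sqrt]
  linarith [sq_nonneg ‖p.2.1‖]

theorem brXi_le_brXiMu : brXi p ≤ brXiMu p :=
  Real.sqrt_le_sqrt (by linarith [sq_nonneg p.2.2])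

theorem brXi_pos : 0 < brXi p := zero_lt_one.trans_le (one_le_brXi p)

theorem brXiMu_pos : 0 < brXiMu p := (brXi_pos p).trans_le (brXi_le_brXiMu p)

theorem one_le_brXiMu : 1 ≤ brXiMu p := (one_le_brXi p).trans (brXi_le_brXiMu p)

theorem absXi_le_absXiMu : absXi p ≤ absXiMu p := by
  rw [absXi, absXiMu]
  exact Real.le_sqrt_of_sq_le (by linarith [sq_nonneg p.2.2])

theorem absXi_pos {p : Phase n} (hp : p ∈ weakDomain n) : 0 < absXi p := norm_pos_iff.2 hp.2

theorem absXiMu_pos {p : Phase n} (hp : p ∈ strongDomain n) : 0 < absXiMu p := by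
  refine Real.sqrt_pos.2 ?_
  by_cases h : p.2.1 = 0
  · have : p.2.2 ≠ 0 := fun h' => hp.2 (Prod.ext h h')
    positivity
  · have := norm_pos_iff.2 h
    positivity

theorem Twist.bracket_pos (k : Twist) : 0 < k.bracket p := by
  cases k
  · exact brXiMu_pos p
  · exact brXi_pos p

theorem Twist.bracket_le (k : Twist) : k.bracket p ≤ brXiMu p := by
  cases k
  · exact le_rfl
  · exact brXi_le_brXiMu p

theorem Twist.bracket_eq {k : Twist} (hk : k = .bold) : k.bracket p = brXiMu p := by
  subst hk
  rfl

theorem Twist.modulus_pos (k : Twist) {p : Phase n} (hp : p ∈ weakDomain n) : 0 < k.modulus p := by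
  cases k
  · exact absXiMu_pos (weakDomain_subset n hp)
  · exact absXi_pos hp

theorem Twist.modulus_le (k : Twist) : k.modulus p ≤ absXiMu p := by
  cases k
  · exact le_rfl
  · exact absXi_le_absXiMu p

theorem Twist.modulus_eq {k : Twist} (hk : k = .bold) : k.modulus p = absXiMu p := by
  subst hk
  rfl

end Weights

/-- Applied with `x = ⟨ξ⟩`, `y = ⟨ξ,μ⟩` (or the moduli), `f = ν - k` and `e = d - ν - j`; the
condition `f ≤ 0` for all `k` is what `ν ≤ 0` provides. -/
theorem rpow_le_rpow_mul_rpow {x y c e f : ℝ} (hx : 0 < x) (hxy : x ≤ y) (hf : f ≤ 0)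
    (h : c = f + e) : y ^ c ≤ x ^ f * y ^ e := by
  rw [h, Real.rpow_add (hx.trans_le hxy)]
  exact mul_le_mul_of_nonneg_right (Real.rpow_le_rpow_of_nonpos hx hxy hf)
    (Real.rpow_nonneg (hx.le.trans hxy) _)

/-! ### Multiplication by compactly supported functions of `ξ` -/

section CompactSupport

variable {n : ℕ} {E₀ E₁ : Type*} [NormedAddCommGroup E₀] [NormedSpace ℂ E₀] [KappaSpace E₀]
  [NormedAddCommGroup E₁] [NormedSpace ℂ E₁] [KappaSpace E₁] [LinearKappaSpace E₁]
  {r₀ r₁ : Phase n → ℝ}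

theorem exists_rpow_brXi_bound {γ : EuclideanSpace ℝ (Fin n) → ℝ} (hγ : Continuous γ)
    (hc : HasCompactSupport γ) (τ : ℝ) :
    ∃ C : ℝ, 0 ≤ C ∧ ∀ p : Phase n, |γ p.2.1| ≤ C * brXi p ^ τ := by
  have h1 : Continuous fun y : EuclideanSpace ℝ (Fin n) => γ y * √(1 + ‖y‖ ^ 2) ^ (-τ) := by
    refine hγ.mul (Continuous.rpow_const (by fun_prop) fun y => Or.inl ?_)
    positivity
  obtain ⟨C, hC⟩ := h1.bounded_above_of_compact_support hc.mul_right
  refine ⟨|C|, abs_nonneg C, fun p => ?_⟩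
  have h2 := (hC p.2.1).trans (le_abs_self C)
  have h3 : 0 < brXi p ^ τ := Real.rpow_pos_of_pos (brXi_pos p) τ
  rw [Real.norm_eq_abs, abs_mul, abs_of_nonneg (Real.rpow_nonneg (Real.sqrt_nonneg _) _)] at h2
  change |γ p.2.1| * brXi p ^ (-τ) ≤ _ at h2
  rwa [Real.rpow_neg (brXi_pos p).le, ← div_eq_mul_inv, div_le_iff₀ h3] at h2

/-- On the support of `γ` every power of `⟨ξ⟩` is bounded above and below, so `τ` is arbitrary and
no gain from `ξ`-derivatives is needed; only `μ`-derivatives have to be counted. The product rule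
yields terms of the same type with `γ` or `b` differentiated. -/
theorem partials_compact_mul_le (l : List (Direction n)) :
    ∀ {γ : EuclideanSpace ℝ (Fin n) → ℝ} {b : Phase n → E₀ →L[ℂ] E₁} {d : ℝ} (τ : ℝ),
      ContDiff ℝ ∞ γ → HasCompactSupport γ →
      SymbolEstimates (fullDomain n) r₀ r₁ (fun _ j p => brXiMu p ^ (d - j)) b →
      ∃ C : ℝ, ∀ p ∈ fullDomain n, TwistedNormLE (r₀ p) (r₁ p)
        (partials (fullDomain n) l (fun p => ((γ p.2.1 : ℝ) : ℂ) • b p) p)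
        (C * (brXi p ^ τ * brXiMu p ^ (d - l.countP Direction.isMu))) := by
  -- The last entry of the list is the innermost derivative; peeling it off changes `γ` and `b` and
  -- leaves the outer derivatives to the induction hypothesis.
  induction l using List.reverseRecOn with
  | nil =>
    intro γ b d τ hγ hc hb
    obtain ⟨C, hC⟩ := hb.2 []
    obtain ⟨C', hC', h'⟩ := exists_rpow_brXi_bound hγ.continuous hc τ
    refine ⟨C' * |C|, fun p hp => (((hC p hp).smul _)).mono ?_⟩
    have h1 : 0 ≤ brXiMu p ^ (d - (0 : ℕ)) := Real.rpow_nonneg (brXiMu_pos p).le _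
    rw [Complex.norm_real, Real.norm_eq_abs]
    simp only [List.countP_nil]
    calc |γ p.2.1| * (C * brXiMu p ^ (d - (0 : ℕ)))
        ≤ |γ p.2.1| * (|C| * brXiMu p ^ (d - (0 : ℕ))) := by
          gcongr
          exact le_abs_self C
      _ ≤ C' * brXi p ^ τ * (|C| * brXiMu p ^ (d - (0 : ℕ))) :=
          mul_le_mul_of_nonneg_right (h' p) (by positivity)
      _ = _ := by ring
  | append_singleton l e ih =>
    intro γ b d τ hγ hc hb
    set m : ℕ := [e].countP Direction.isMu with hm
    have hD := uniqueDiffOn_fullDomain n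
    have hb' : SymbolEstimates (fullDomain n) r₀ r₁ (fun _ j p => brXiMu p ^ (d - m - j))
        (partials (fullDomain n) [e] b) := by
      refine ⟨contDiffOn_partials hD hb.1 _, fun l' => ?_⟩
      obtain ⟨C, hC⟩ := hb.2 (l' ++ [e])
      refine ⟨C, fun p hp => ?_⟩
      have := hC p hp
      simp only [partials_append] at this
      rw [List.countP_append] at this
      simp only [sub_sub, ← Nat.cast_add, add_comm m]
      exact this
    let γ' : EuclideanSpace ℝ (Fin n) → ℝ := fun y => fderiv ℝ γ y e.vec.2.1
    have hγ' : ContDiff ℝ ∞ γ' := (hγ.fderiv_right (m := ∞) (by simp)).clm_apply contDiff_const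
    have hc' : HasCompactSupport γ' := (hc.fderiv (𝕜 := ℝ)).comp_left
      (g := fun T : EuclideanSpace ℝ (Fin n) →L[ℝ] ℝ => T e.vec.2.1) rfl
    obtain ⟨C, hC⟩ := ih τ hγ hc hb'
    have hsplit : Set.EqOn (partials (fullDomain n) [e] fun p => ((γ p.2.1 : ℝ) : ℂ) • b p)
        ((fun p => ((γ p.2.1 : ℝ) : ℂ) • partials (fullDomain n) [e] b p) +
          fun p => ((γ' p.2.1 : ℝ) : ℂ) • b p) (fullDomain n) := fun p hp =>
      fderivWithin_smul_fst hD hb.1 hγ e hp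
    have hsm (γ : EuclideanSpace ℝ (Fin n) → ℝ) (hγ : ContDiff ℝ ∞ γ) :
        ContDiff ℝ ∞ fun p : Phase n => ((γ p.2.1 : ℝ) : ℂ) :=
      Complex.ofRealCLM.contDiff.comp (hγ.comp (contDiff_fst.comp contDiff_snd))
    have hadd := partials_add hD ((hsm γ hγ).contDiffOn.smul hb'.1)
      ((hsm γ' hγ').contDiffOn.smul hb.1) l
    have h2 : ∃ C' : ℝ, ∀ p ∈ fullDomain n, TwistedNormLE (r₀ p) (r₁ p)
        (partials (fullDomain n) l (fun p => ((γ' p.2.1 : ℝ) : ℂ) • b p) p)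
        (C' * (brXi p ^ τ * brXiMu p ^ (d - (l ++ [e]).countP Direction.isMu))) := by
      -- For an `x`- or `μ`-direction `γ'` vanishes identically and any bound will do. Otherwise the
      -- direction is a `ξ_i`, which does not count as a `μ`-derivative, so `b` keeps its order.
      by_cases he : e.vec.2.1 = 0
      · obtain ⟨C', hC'⟩ := ih τ hγ' hc' hb'
        refine ⟨C', fun p hp => ?_⟩
        have h0 (y) : γ' y = 0 := by simp only [γ', he, map_zero]
        have := hC' p hp
        simp only [h0, Complex.ofReal_zero, zero_smul] at this ⊢
        rwa [sub_sub, ← Nat.cast_add, add_comm m, hm, ← List.countP_append] at this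
      · have hm0 : m = 0 := by
          cases e
          · exact absurd rfl he
          · rfl
          · exact absurd rfl he
        rw [List.countP_append, ← hm, hm0, add_zero]
        exact ih τ hγ' hc' hb
    obtain ⟨C', hC'⟩ := h2
    refine ⟨C + C', fun p hp => ?_⟩
    rw [partials_append, partials_congr hsplit l hp]
    refine (congrArg (TwistedNormLE (r₀ p) (r₁ p) · _) (hadd hp)).mpr ?_
    rw [add_mul]
    refine TwistedNormLE.add ?_ (hC' p hp)
    have := hC p hp
    rwa [sub_sub, ← Nat.cast_add, add_comm m, hm, ← List.countP_append] at this

theorem SymbolEstimates.compact_mul {γ : EuclideanSpace ℝ (Fin n) → ℝ}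
    {b : Phase n → E₀ →L[ℂ] E₁} {d : ℝ} (hγ : ContDiff ℝ ∞ γ) (hc : HasCompactSupport γ)
    (hb : SymbolEstimates (fullDomain n) r₀ r₁ (fun _ j p => brXiMu p ^ (d - j)) b) (τ : ℝ) :
    SymbolEstimates (fullDomain n) r₀ r₁ (fun k j p => brXi p ^ (τ - k) * brXiMu p ^ (d - j))
      (fun p => ((γ p.2.1 : ℝ) : ℂ) • b p) :=
  ⟨(Complex.ofRealCLM.contDiff.comp
    (hγ.comp (contDiff_fst.comp contDiff_snd))).contDiffOn.smul hb.1,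
    fun l => partials_compact_mul_le l (τ - l.countP Direction.isXi) hγ hc hb⟩

end CompactSupport

/-! ### Direct sums with finite-dimensional spaces -/

theorem exists_block_le {E F : Type*} [NormedAddCommGroup E] [NormedAddCommGroup F] [KappaSpace F]
    {r : ℝ} (hr : 0 < r) {C : ℝ} {L M : ℕ} (u : Block E L M)
    (v : Block F L M) (hv : v.2 = u.2)
    (h : ∀ i, ∃ w : F, KappaSpace.dil r w (v.1 i) ∧ ‖w‖ ≤ C * ‖u.1 i‖) :
    ∃ w : Block F L M, KappaSpace.dil r w v ∧ ‖w‖ ≤ max C 1 * ‖u‖ := by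
  choose w hw hn using h
  refine ⟨(w, u.2), ⟨hr, hw, hv⟩, ?_⟩
  have h1 : 0 ≤ max C 1 := zero_le_one.trans (le_max_right _ _)
  refine max_le ((pi_norm_le_iff_of_nonneg (by positivity)).2 fun i => (hn i).trans ?_) ?_
  · exact mul_le_mul (le_max_left _ _) ((norm_le_pi_norm u.1 i).trans (norm_fst_le u))
      (norm_nonneg _) h1
  · exact (norm_snd_le u).trans (le_mul_of_one_le_left (norm_nonneg u) (le_max_right _ _))

section Blocks

variable {E F : Type*} [NormedAddCommGroup E] [NormedSpace ℂ E] [KappaSpace E]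
  [NormedAddCommGroup F] [NormedSpace ℂ F] [KappaSpace F]

/-- The operator `u ⊕ z ↦ I u ⊕ z`. -/
def blockMap (I : E →L[ℂ] F) (L M : ℕ) : Block E L M →L[ℂ] Block F L M :=
  (ContinuousLinearMap.piMap fun _ => I).prodMap (ContinuousLinearMap.id ℂ _)

theorem IsTargetTwist.block {k : Twist} {J : E →L[ℂ] F} (hJ : IsTargetTwist k J) (L M : ℕ) :
    IsTargetTwist k (blockMap J L M) := by
  obtain ⟨C, -, hC⟩ := hJ.twist
  exact ⟨fun r u v h => ⟨h.1, fun i => hJ.dil r _ _ (h.2.1 i), h.2.2⟩, max C 1,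
    zero_le_one.trans (le_max_right _ _), fun r' r hr' hle hk u v h =>
      exists_block_le hr' u (blockMap J L M v) h.2.2 fun i => hC r' r hr' hle hk _ _ (h.2.1 i)⟩

theorem IsSourceTwist.block {k : Twist} {I : E →L[ℂ] F} (hI : IsSourceTwist k I) (L M : ℕ) :
    IsSourceTwist k (blockMap I L M) := by
  obtain ⟨C, -, hC⟩ := hI.twist
  exact ⟨fun r u v h => ⟨h.1, fun i => hI.dil r _ _ (h.2.1 i), h.2.2⟩, max C 1,
    zero_le_one.trans (le_max_right _ _), fun r' r hr' hle hk u v h =>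
      exists_block_le (hr'.trans_le hle) u (blockMap I L M v) h.2.2
        fun i => hC r' r hr' hle hk _ _ (h.2.1 i)⟩

theorem isTargetTwist_id : IsTargetTwist .bold (ContinuousLinearMap.id ℂ E) :=
  ⟨fun _ _ _ h => h, 1, zero_le_one, fun _ _ _ _ hk w _ h => ⟨w, by rw [hk rfl]; exact h, by simp⟩⟩

theorem isSourceTwist_id : IsSourceTwist .bold (ContinuousLinearMap.id ℂ E) :=
  ⟨fun _ _ _ h => h, 1, zero_le_one,
    fun _ _ _ _ hk w _ h => ⟨w, by rw [← hk rfl]; exact h, by simp⟩⟩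

end Blocks

/-! ### From strongly to weakly parameter-dependent symbols -/

section Passage

variable {n : ℕ} {E₀ E₁ F₀ F₁ : Type*}
  [NormedAddCommGroup E₀] [NormedSpace ℂ E₀] [KappaSpace E₀]
  [NormedAddCommGroup E₁] [NormedSpace ℂ E₁] [KappaSpace E₁]
  [NormedAddCommGroup F₀] [NormedSpace ℂ F₀] [KappaSpace F₀]
  [NormedAddCommGroup F₁] [NormedSpace ℂ F₁] [KappaSpace F₁]
  {k₀ k₁ : Twist} {I : F₀ →L[ℂ] E₀} {J : E₁ →L[ℂ] F₁} {d ν : ℝ} {a : Phase n → E₀ →L[ℂ] E₁}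

theorem StrongSymbol.comp_estimates (hI : IsSourceTwist k₀ I) (hJ : IsTargetTwist k₁ J)
    (ha : StrongSymbol d a) {w : ℕ → ℕ → Phase n → ℝ}
    (hw : ∀ (k j : ℕ) (p : Phase n), brXiMu p ^ (d - k - j) ≤ w k j p) :
    SymbolEstimates (fullDomain n) k₀.bracket k₁.bracket w (fun p => J ∘L a p ∘L I) := by
  obtain ⟨C₀, -, h₀⟩ := hI.twist
  obtain ⟨C₁, hC₁, h₁⟩ := hJ.twist
  have hD := uniqueDiffOn_fullDomain n
  refine SymbolEstimates.comp hD hD subset_rfl ha I J hC₁ (C₀ := C₀)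
    (fun p _ => h₀ _ _ (k₀.bracket_pos p) (k₀.bracket_le p) (Twist.bracket_eq p))
    (fun p _ => h₁ _ _ (k₁.bracket_pos p) (k₁.bracket_le p) (Twist.bracket_eq p))
    fun k j p _ => ⟨Real.rpow_nonneg (brXiMu_pos p).le _, hw k j p⟩

theorem StrongSymbol.comp_weakSymbol (hI : IsSourceTwist k₀ I) (hJ : IsTargetTwist k₁ J)
    (hν : ν ≤ 0) (ha : StrongSymbol d a) : WeakSymbol k₀ k₁ d ν (fun p => J ∘L a p ∘L I) :=
  ha.comp_estimates hI hJ fun k j p =>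
    rpow_le_rpow_mul_rpow (brXi_pos p) (brXi_le_brXiMu p)
      (by linarith [(Nat.cast_nonneg k : (0 : ℝ) ≤ k)]) (by ring)

theorem StrongHomogeneous.comp_weakHomogeneous (hI : IsSourceTwist k₀ I) (hJ : IsTargetTwist k₁ J)
    (hν : ν ≤ 0) (ha : StrongHomogeneous d a) :
    WeakHomogeneous k₀ k₁ d ν (fun p => J ∘L a p ∘L I) := by
  refine ⟨fun p hp r hr u v huv => ?_, ?_⟩
  · have h := hJ.dil _ _ _ (ha.1 p (weakDomain_subset n hp) r hr _ _ (hI.dil _ _ _ huv))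
    rw [map_smul] at h
    exact h
  · obtain ⟨C₀, -, h₀⟩ := hI.twist
    obtain ⟨C₁, hC₁, h₁⟩ := hJ.twist
    refine SymbolEstimates.comp (uniqueDiffOn_strongDomain n) (uniqueDiffOn_weakDomain n)
      (weakDomain_subset n) ha.2 I J hC₁ (C₀ := C₀)
      (fun p hp => h₀ _ _ (k₀.modulus_pos hp) (k₀.modulus_le p) (Twist.modulus_eq p))
      (fun p hp => h₁ _ _ (k₁.modulus_pos hp) (k₁.modulus_le p) (Twist.modulus_eq p))
      fun k j p hp => ⟨Real.rpow_nonneg (absXiMu_pos (weakDomain_subset n hp)).le _, ?_⟩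
    exact rpow_le_rpow_mul_rpow (absXi_pos hp) (absXi_le_absXiMu p)
      (by linarith [(Nat.cast_nonneg k : (0 : ℝ) ≤ k)]) (by ring)

theorem exists_excision {F : Type*} [NormedAddCommGroup F] [NormedSpace ℝ F] [HasContDiffBump F]
    {ε : ℝ} (hε : 0 < ε) : ∃ χ : F → ℝ, IsExcision χ ∧ ∀ y, ε ≤ ‖y‖ → χ y = 1 := by
  let f : ContDiffBump (0 : F) := ⟨ε / 2, ε, half_pos hε, half_lt_self hε⟩
  have h1 : ∀ y, ε ≤ ‖y‖ → 1 - f y = 1 := fun y hy => by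
    rw [f.zero_of_le_dist (by simpa using hy), sub_zero]
  refine ⟨fun y => 1 - f y, ⟨contDiff_const.sub f.contDiff, ?_, ε, h1⟩, h1⟩
  filter_upwards [f.eventuallyEq_one] with y hy
  rw [hy]
  simp

theorem IsExcision.hasCompactSupport {F : Type*} [NormedAddCommGroup F] [NormedSpace ℝ F]
    [FiniteDimensional ℝ F] {χ : F → ℝ} (hχ : IsExcision χ) :
    HasCompactSupport fun y => 1 - χ y := by
  obtain ⟨-, -, R, hR⟩ := hχ
  have := FiniteDimensional.proper ℝ F
  refine HasCompactSupport.intro (isCompact_closedBall 0 R) fun y hy => ?_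
  rw [hR y (by simpa using (not_le.1 (fun h => hy (by simpa using h))).le), sub_self]

theorem StrongSymbol.mono {d' : ℝ} (ha : StrongSymbol d a) (h : d ≤ d') : StrongSymbol d' a :=
  SymbolEstimates.mono ha fun _ _ p _ => ⟨Real.rpow_nonneg (brXiMu_pos p).le _,
    Real.rpow_le_rpow_of_exponent_le (one_le_brXiMu p) (by linarith)⟩

theorem StrongSymbol.neg [LinearKappaSpace E₁] (ha : StrongSymbol d a) : StrongSymbol d (-a) := by
  have := SymbolEstimates.comp (uniqueDiffOn_fullDomain n) (uniqueDiffOn_fullDomain n) subset_rfl ha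
    (ContinuousLinearMap.id ℂ E₀) (-ContinuousLinearMap.id ℂ E₁) zero_le_one (C₀ := 1)
    (fun p _ u v h => ⟨u, h, by simp⟩)
    (fun p _ u v h => ⟨(-1 : ℂ) • u, by simpa using dil_smul (-1) h, by simp⟩)
    fun _ _ p _ => ⟨Real.rpow_nonneg (brXiMu_pos p).le _, le_rfl⟩
  have e : -a = fun p => (-ContinuousLinearMap.id ℂ E₁) ∘L a p ∘L ContinuousLinearMap.id ℂ E₀ := by
    ext p u
    simp
  rw [e]
  exact this

/-- The terms of the expansion of a classical symbol, cut off near the origin, are symbols. -/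
theorem strongSymbol_term [LinearKappaSpace E₁] {h : ℕ → Phase n → E₀ →L[ℂ] E₁}
    {χ : EuclideanSpace ℝ (Fin n) × ℝ → ℝ}
    (hr : ∀ N : ℕ, StrongSymbol (d - N)
      (fun p => a p - ∑ j ∈ Finset.range N, ((χ p.2 : ℝ) : ℂ) • h j p)) (j : ℕ) :
    StrongSymbol (d - j) (fun p => ((χ p.2 : ℝ) : ℂ) • h j p) := by
  -- The `j`-th term is the difference of two consecutive remainders, of orders `d - j` and `d - j -
  -- 1`.
  have h1 := SymbolEstimates.add (uniqueDiffOn_fullDomain n) (hr j)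
    ((hr (j + 1)).mono (d' := d - j) (by push_cast; linarith)).neg
  have e : (fun p => ((χ p.2 : ℝ) : ℂ) • h j p) =
      (fun p => a p - ∑ j ∈ Finset.range j, ((χ p.2 : ℝ) : ℂ) • h j p) +
      -(fun p => a p - ∑ j ∈ Finset.range (j + 1), ((χ p.2 : ℝ) : ℂ) • h j p) := by
    funext p
    simp only [Pi.add_apply, Pi.neg_apply, Finset.sum_range_succ]
    abel
  rw [e]
  exact h1

/-- The composed homogeneous components serve as the weak expansion. The remainder differs from the
composed strong remainder by the terms `(1 - χ'(ξ)) χ(ξ,μ) h_j`, which are compactly supported in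
`ξ` and hence of order `ν - N` in `ξ` for every `N`. -/
theorem StrongClassical.comp_weakClassical [LinearKappaSpace E₁] [LinearKappaSpace F₁]
    (hI : IsSourceTwist k₀ I) (hJ : IsTargetTwist k₁ J) (hν : ν ≤ 0) (ha : StrongClassical d a) :
    WeakClassical k₀ k₁ d ν (fun p => J ∘L a p ∘L I) := by
  obtain ⟨ha, h, hh, hr⟩ := ha
  have hN (N : ℕ) : ν - N ≤ 0 := by linarith [(Nat.cast_nonneg N : (0 : ℝ) ≤ N)]
  refine ⟨ha.comp_weakSymbol hI hJ hν, fun j p => J ∘L h j p ∘L I,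
    fun j => (hh j).comp_weakHomogeneous hI hJ (hN j), fun χ' hχ' N => ?_⟩
  obtain ⟨ε, hε, hball⟩ := Metric.eventually_nhds_iff.1 hχ'.2.1
  -- Since `χ'` vanishes for `|ξ| < ε`, choosing `χ = 1` outside the `ε`-ball makes `χ' χ = χ'`.
  obtain ⟨χ, hχ, hχ1⟩ := exists_excision (F := EuclideanSpace ℝ (Fin n) × ℝ) hε
  have hmul (p : Phase n) : χ' p.2.1 * χ p.2 = χ' p.2.1 := by
    rcases lt_or_ge ‖p.2.1‖ ε with hp | hp
    · rw [hball (by simpa using hp), zero_mul]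
    · rw [hχ1 p.2 (hp.trans (norm_fst_le p.2)), mul_one]
  have hcut : ContDiff ℝ ∞ fun y => 1 - χ' y := contDiff_const.sub hχ'.1
  have hterm (j : ℕ) : WeakSymbol k₀ k₁ (d - N) (ν - N) (fun p =>
      ((1 - χ' p.2.1 : ℝ) : ℂ) • (J ∘L (((χ p.2 : ℝ) : ℂ) • h j p) ∘L I)) := by
    -- All decay from `j` and from `ξ`-derivatives is given up: `d - j - k - m ≤ d - ν - m`. The
    -- compact support restores the power `⟨ξ⟩^{ν-N-k}`, and `d - ν` equals `(d - N) - (ν - N)`, as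
    -- the remainder requires.
    have h1 := (strongSymbol_term (hr χ hχ) j).comp_estimates hI hJ
      (w := fun _ j p => brXiMu p ^ (d - ν - j)) fun k m p =>
        Real.rpow_le_rpow_of_exponent_le (one_le_brXiMu p) (by
          linarith [(Nat.cast_nonneg k : (0 : ℝ) ≤ k), (Nat.cast_nonneg j : (0 : ℝ) ≤ j)])
    have h2 := h1.compact_mul hcut hχ'.hasCompactSupport (ν - N)
    unfold WeakSymbol
    rwa [show d - N - (ν - N) = d - ν by ring]
  have hsum := SymbolEstimates.add (uniqueDiffOn_fullDomain n)
    ((hr χ hχ N).comp_weakSymbol hI hJ (hN N))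
    (SymbolEstimates.sum (uniqueDiffOn_fullDomain n) (fun p _ => k₁.bracket_pos p)
      (Finset.range N) fun j _ => hterm j)
  have e : (fun p => J ∘L a p ∘L I - ∑ j ∈ Finset.range N,
      ((χ' p.2.1 : ℝ) : ℂ) • (J ∘L h j p ∘L I)) =
      (fun p => J ∘L (a p - ∑ j ∈ Finset.range N, ((χ p.2 : ℝ) : ℂ) • h j p) ∘L I) +
      ∑ j ∈ Finset.range N, fun p =>
        ((1 - χ' p.2.1 : ℝ) : ℂ) • (J ∘L (((χ p.2 : ℝ) : ℂ) • h j p) ∘L I) := by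
    ext1 p
    ext1 u
    simp only [Pi.add_apply, Finset.sum_apply, sub_apply, add_apply, sum_apply, smul_apply,
      ContinuousLinearMap.comp_apply, map_sub, map_sum, map_smul]
    rw [sub_add, ← Finset.sum_sub_distrib]
    congr 1
    refine Finset.sum_congr rfl fun j _ => ?_
    rw [smul_smul, ← sub_smul]
    congr 1
    rw [← Complex.ofReal_mul, ← Complex.ofReal_sub, sub_mul, one_mul, hmul, sub_sub_cancel]
  rw [e]
  exact hsum

end Passage

/-! ### Sums of weakly parameter-dependent symbols -/

section Sums

variable {n : ℕ} {E₀ E₁ : Type*} [NormedAddCommGroup E₀] [NormedSpace ℂ E₀] [KappaSpace E₀]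
  [NormedAddCommGroup E₁] [NormedSpace ℂ E₁] [KappaSpace E₁] [LinearKappaSpace E₁]
  {k₀ k₁ : Twist} {d ν : ℝ} {a b : Phase n → E₀ →L[ℂ] E₁}

theorem KappaHomogeneous.add {D : Set (Phase n)} (ha : KappaHomogeneous D d a)
    (hb : KappaHomogeneous D d b) : KappaHomogeneous D d (a + b) := fun p hp r hr u v huv => by
  simp only [Pi.add_apply, add_apply, smul_add]
  exact dil_add (ha p hp r hr u v huv) (hb p hp r hr u v huv)

theorem WeakClassical.add (ha : WeakClassical k₀ k₁ d ν a) (hb : WeakClassical k₀ k₁ d ν b) :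
    WeakClassical k₀ k₁ d ν (a + b) := by
  obtain ⟨ha, h, hh, hr⟩ := ha
  obtain ⟨hb, h', hh', hr'⟩ := hb
  have hD := uniqueDiffOn_fullDomain n
  refine ⟨SymbolEstimates.add hD ha hb, fun j => h j + h' j, fun j => ⟨(hh j).1.add (hh' j).1,
    (hh j).2.add (uniqueDiffOn_weakDomain n) (hh' j).2⟩, fun χ hχ N => ?_⟩
  have e : (fun p => (a + b) p - ∑ j ∈ Finset.range N, ((χ p.2.1 : ℝ) : ℂ) • (h j + h' j) p) =
      (fun p => a p - ∑ j ∈ Finset.range N, ((χ p.2.1 : ℝ) : ℂ) • h j p) +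
      fun p => b p - ∑ j ∈ Finset.range N, ((χ p.2.1 : ℝ) : ℂ) • h' j p := by
    funext p
    simp only [Pi.add_apply, smul_add, Finset.sum_add_distrib]
    abel
  rw [e]
  exact SymbolEstimates.add hD (hr χ hχ N) (hr' χ hχ N)

theorem strongClassical_zero (d : ℝ) : StrongClassical d (0 : Phase n → E₀ →L[ℂ] E₁) := by
  refine ⟨symbolEstimates_zero fun p _ => brXiMu_pos p, fun _ => 0, fun j => ⟨?_, ?_⟩,
    fun χ _ N => ?_⟩
  · intro p hp r hr u v huv
    simpa using dil_zero hr
  · exact symbolEstimates_zero fun p hp => absXiMu_pos hp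
  · have e : (fun p : Phase n => (0 : Phase n → E₀ →L[ℂ] E₁) p -
        ∑ j ∈ Finset.range N, ((χ p.2 : ℝ) : ℂ) • (0 : Phase n → E₀ →L[ℂ] E₁) p) = 0 := by
      funext p
      simp
    rw [e]
    exact symbolEstimates_zero fun p _ => brXiMu_pos p

end Sums

/-! ### Green symbols -/

section Realizations

variable {n L M L' M' : ℕ} {E₀ E₁ F₀ F₁ : Type*}
  [NormedAddCommGroup E₀] [NormedSpace ℂ E₀] [SourceSpace E₀]
  [NormedAddCommGroup E₁] [NormedSpace ℂ E₁] [TargetSpace E₁]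
  [NormedAddCommGroup F₀] [NormedSpace ℂ F₀] [SourceSpace F₀]
  [NormedAddCommGroup F₁] [NormedSpace ℂ F₁] [TargetSpace F₁]
  {D D' : Set (Phase n)} {a b : Phase n → Block E₀ L M →L[ℂ] Block E₁ L' M'}

theorem Realizes.comp {I : F₀ →L[ℂ] E₀} {J : E₁ →L[ℂ] F₁}
    (hI : ∀ φ u, SourceSpace.isTest φ u → SourceSpace.isTest φ (I u))
    (hJ : ∀ w, TargetSpace.toDist (J w) = TargetSpace.toDist w) {g : D → GreenOp L M L' M'}
    (h : Realizes a g) (hs : D' ⊆ D) :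
    Realizes (fun p => blockMap J L' M' ∘L a p ∘L blockMap I L M)
      (fun p : D' => g (Set.inclusion hs p)) := by
  intro p φ u hu
  obtain ⟨h1, h2⟩ := h (Set.inclusion hs p) φ (fun i => I (u i)) fun i => hI _ _ (hu i)
  exact ⟨fun i => (hJ _).trans (h1 i), h2⟩

theorem Realizes.add [LinearTargetSpace E₁] {g g' : D → GreenOp L M L' M'} (h : Realizes a g)
    (h' : Realizes b g') : Realizes (a + b) (g + g') := by
  intro p φ u hu
  obtain ⟨h1, h2⟩ := h p φ u hu
  obtain ⟨h1', h2'⟩ := h' p φ u hu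
  exact ⟨fun i => (toDist_add _ _).trans (congrArg₂ (· + ·) (h1 i) (h1' i)),
    congrArg₂ (· + ·) h2 h2'⟩

theorem realizes_zero [LinearTargetSpace E₁] :
    Realizes (0 : Phase n → Block E₀ L M →L[ℂ] Block E₁ L' M') (0 : D → GreenOp L M L' M') :=
  fun _ _ _ _ => ⟨fun _ => toDist_zero, rfl⟩

end Realizations

section Membership

variable {n L M L' M' : ℕ} {E₀ E₁ F₀ F₁ : Type*}
  [NormedAddCommGroup E₀] [NormedSpace ℂ E₀] [KappaSpace E₀] [SourceSpace E₀]
  [NormedAddCommGroup E₁] [NormedSpace ℂ E₁] [KappaSpace E₁] [TargetSpace E₁]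
  [NormedAddCommGroup F₀] [NormedSpace ℂ F₀] [KappaSpace F₀] [SourceSpace F₀]
  [NormedAddCommGroup F₁] [NormedSpace ℂ F₁] [KappaSpace F₁] [TargetSpace F₁]
  {k₀ k₁ : Twist} {I : F₀ →L[ℂ] E₀} {J : E₁ →L[ℂ] F₁} {d ν : ℝ}

theorem MemStrong.memWeak [LinearKappaSpace E₁] [LinearKappaSpace F₁] (hν : ν ≤ 0)
    (hI : IsSourceTwist k₀ I ∧ ∀ φ u, SourceSpace.isTest φ u → SourceSpace.isTest φ (I u))
    (hJ : IsTargetTwist k₁ J ∧ ∀ w, TargetSpace.toDist (J w) = TargetSpace.toDist w)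
    {g : fullDomain n → GreenOp L M L' M'} (h : MemStrong E₀ E₁ d g) :
    MemWeak F₀ F₁ k₀ k₁ d ν g := by
  obtain ⟨a, ha, hg⟩ := h
  exact ⟨_, ha.comp_weakClassical (hI.1.block L M) (hJ.1.block L' M') hν,
    hg.comp hI.2 hJ.2 subset_rfl⟩

theorem MemStrongHom.memWeakHom (hν : ν ≤ 0)
    (hI : IsSourceTwist k₀ I ∧ ∀ φ u, SourceSpace.isTest φ u → SourceSpace.isTest φ (I u))
    (hJ : IsTargetTwist k₁ J ∧ ∀ w, TargetSpace.toDist (J w) = TargetSpace.toDist w)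
    {g : strongDomain n → GreenOp L M L' M'} (h : MemStrongHom E₀ E₁ d g) :
    MemWeakHom F₀ F₁ k₀ k₁ d ν (fun p => g (Set.inclusion (weakDomain_subset n) p)) := by
  obtain ⟨a, ha, hg⟩ := h
  exact ⟨_, ha.comp_weakHomogeneous (hI.1.block L M) (hJ.1.block L' M') hν,
    hg.comp hI.2 hJ.2 (weakDomain_subset n)⟩

theorem MemWeak.add [LinearKappaSpace E₁] [LinearTargetSpace E₁]
    {g g' : fullDomain n → GreenOp L M L' M'} (h : MemWeak E₀ E₁ k₀ k₁ d ν g)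
    (h' : MemWeak E₀ E₁ k₀ k₁ d ν g') : MemWeak E₀ E₁ k₀ k₁ d ν (g + g') := by
  obtain ⟨a, ha, hg⟩ := h
  obtain ⟨a', ha', hg'⟩ := h'
  exact ⟨a + a', ha.add ha', hg.add hg'⟩

end Membership

section Green

variable {n L M L' M' : ℕ} {d ν : ℝ}

/-- Boldface sides keep their space and use the identity, cone sides use the embeddings. The orders
and weights that the embeddings require are available because a strong Green symbol acts between all
weighted Sobolev spaces. -/
theorem strongGreen_subset_weakGreen (hν : ν ≤ 0) :
    StrongGreen n L M L' M' d ⊆ WeakGreen n L M L' M' d ν := by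
  intro g hg s s' δ δ'
  obtain ⟨k, ε, I, hI⟩ := exists_sourceEmbedding s δ
  obtain ⟨k', ε', J, hJ⟩ := exists_targetEmbedding s' δ'
  exact ⟨(hg s s' 0 0).memWeak hν ⟨isSourceTwist_id, fun _ _ h => h⟩
      ⟨isTargetTwist_id, fun _ => rfl⟩,
    (hg s k' 0 ε').memWeak hν ⟨isSourceTwist_id, fun _ _ h => h⟩ hJ,
    (hg k s' ε 0).memWeak hν hI ⟨isTargetTwist_id, fun _ => rfl⟩,
    (hg k k' ε ε').memWeak hν hI hJ⟩

theorem restrict_mem_weakGreenHom (hν : ν ≤ 0) {g : strongDomain n → GreenOp L M L' M'}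
    (hg : g ∈ StrongGreenHom n L M L' M' d) :
    (fun p => g (Set.inclusion (weakDomain_subset n) p)) ∈ WeakGreenHom n L M L' M' d ν := by
  intro s s' δ δ'
  obtain ⟨k, ε, I, hI⟩ := exists_sourceEmbedding s δ
  obtain ⟨k', ε', J, hJ⟩ := exists_targetEmbedding s' δ'
  exact ⟨(hg s s' 0 0).memWeakHom hν ⟨isSourceTwist_id, fun _ _ h => h⟩
      ⟨isTargetTwist_id, fun _ => rfl⟩,
    (hg s k' 0 ε').memWeakHom hν ⟨isSourceTwist_id, fun _ _ h => h⟩ hJ,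
    (hg k s' ε 0).memWeakHom hν hI ⟨isTargetTwist_id, fun _ => rfl⟩,
    (hg k k' ε ε').memWeakHom hν hI hJ⟩

theorem green_eq_weakGreen (hν : ν ≤ 0) : Green n L M L' M' d ν = WeakGreen n L M L' M' d ν := by
  refine Set.Subset.antisymm ?_ fun g hg => ?_
  · rintro _ ⟨g₀, hg₀, g₁, hg₁, rfl⟩ s s' δ δ'
    obtain ⟨a1, a2, a3, a4⟩ := strongGreen_subset_weakGreen hν hg₀ s s' δ δ'
    obtain ⟨b1, b2, b3, b4⟩ := hg₁ s s' δ δ'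
    exact ⟨a1.add b1, a2.add b2, a3.add b3, a4.add b4⟩
  · exact ⟨0, fun _ _ _ _ => ⟨0, strongClassical_zero d, realizes_zero⟩, g, hg, (zero_add g).symm⟩

end Green

end GreenSymbols

end

theorem mainTheorem7 (n L M L' M' : ℕ) (d : ℝ) :
    GreenSymbols.StrongGreen n L M L' M' d ⊆ GreenSymbols.WeakGreen n L M L' M' d 0 ∧
    (∀ g ∈ GreenSymbols.StrongGreenHom n L M L' M' d,
      (fun p => g (Set.inclusion (GreenSymbols.weakDomain_subset n) p)) ∈
        GreenSymbols.WeakGreenHom n L M L' M' d 0) ∧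
    (∀ ν : ℝ, ν ≤ 0 →
      GreenSymbols.Green n L M L' M' d ν = GreenSymbols.WeakGreen n L M L' M' d ν) :=
  ⟨GreenSymbols.strongGreen_subset_weakGreen le_rfl,
    fun _ hg => GreenSymbols.restrict_mem_weakGreenHom le_rfl hg,
    fun _ hν => GreenSymbols.green_eq_weakGreen hν⟩
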